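/- **Theorem** (There is a definably complete type complete structure without the pigeonhole property). *Conventions.* "Definable" means definable with parameters. Let $\mathcal M=\langle M;<,\dots\rangle$ be an expansion of a dense linear order without endpoints. $\mathcal M$ is *definably complete* if every nonempty definable subset of $M$ that is bounded above has a least upper bound in $M$. $\mathcal M$ is *type complete* if for every definable $A\subseteq M$: (i) for every $a\in M$ there are $b_1<a<b_2$ such that each $I\in\{(b_1,a),(a,b_2)\}$ satisfies $I\subseteq A$ or $I\cap A=\emptyset$; (ii) there are $c_1,c_2\in M$ such that each $I\in\{(-\infty,c_1),(c_2,+\infty)\}$ satisfies $I\subseteq A$ or $I\cap A=\emptyset$. A definable $X\subseteq M^n$ is *pseudo-finite* if it is closed, bounded and discrete. $\mathcal M$ has the *pigeonhole principle* if for every $n$ and every pseudo-finite $X\subseteq M^n$, every injective definable map $X\to X$ is surjective. For a language $\mathcal L\ni{<}$, $T^{omin}_{\mathcal L}$ is the set of $\mathcal L$-sentences true in all o-minimal $\mathcal L$-structures, i.e. in all expansions of dense linear orders without endpoints in which every definable subset of the universe is a finite union of points and open intervals with endpoints in the universe or $\pm\infty$. Write $C_<(a,b,c)$ for $(a<b<c)\lor(b<c<a)\lor(c<a<b)$.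 *The theories.* Let $\mathcal L_0=\langle <,Z;S,P,\pi;c_1,c_2,c_3,c_4\rangle$ with $Z$ a unary predicate, $S,P,\pi$ unary function symbols and $c_1,\dots,c_4$ constants. $T_0$ says: $T^{omin}_{\mathcal L_0}$; $<$ is a dense linear order without endpoints; every non-maximal (non-minimal) element of $Z$ has an immediate successor (predecessor) in $Z$; every $x\notin Z$ lies in an open interval disjoint from $Z$; $\min Z=c_1$, $\max Z=c_4$; $c_2,c_3\in Z$, $c_1<c_2<c_3<c_4$, and between any two of these constants there are infinitely many elements of $Z$; $\pi(x)\in Z$ and $\neg C_<(x,y,\pi(x))$ for all $x$ and all $y\in Z$, and $\pi(x)=x$ for $x\in Z$; $S(x)=y$ if and only if either $x\notin Z$ and $x=y$, or $x,y\in Z$, $x\ne y$ and there is no $z\in Z$ with $C_<(x,z,y)$; $P=S^{-1}$. Let $\mathcal L_1=\mathcal L_0\cup\{f,g\}$ with $f,g$ unary function symbols. $T_1$ is $T_0$ together with: $f$ is bijective and $g=f^{-1}$; $f$ restricts to an order isomorphism $Z\cap[c_1,c_2]\to Z\cap[c_3,c_4]$ and to an order isomorphism $Z\cap(c_2,c_4]\to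 Z\cap[c_1,c_3)$; for all $n>1$ and $z\in Z$ the sets $\{x\in Z: C_<(z,x,f^n(z))\}$ and $\{x\in Z:C_<(f^n(z),x,z)\}$ are infinite; $f(x)=x$ for $x\notin Z$; $C_<(f^m(z),f^n(z),z)$ for all $m>n>0$ and $z\in Z$. *The structure $\mathcal M_2$.* Given $\mathcal M_1\models T_1$ with universe $M$, let $\mathcal M_2$ be the $\mathcal L_1$-structure on $M$ with the same interpretation of $\mathcal L_0$ and with $$f^{\mathcal M_2}(x)=\begin{cases}P(f^{\mathcal M_1}(x)) & \text{if } S^n(x)=c_4\text{ for some }n\in\mathbb N,\\ f^{\mathcal M_1}(x)&\text{otherwise,}\end{cases}\qquad g^{\mathcal M_2}(x)=\begin{cases}g^{\mathcal M_1}(S(x)) & \text{if } S^n(x)=P(c_3)\text{ for some }n\in\mathbb N,\\ g^{\mathcal M_1}(x)&\text{otherwise.}\end{cases}$$ *Claim.* 1. $T_1$ has a model. 2. For every $\mathcal M_1\models T_1$, the structure $\mathcal M_2$ is an expansion of a dense linear order without endpoints that is definably complete and type complete but does not have the pigeonhole principle. Moreover, $Z$ is definable, closed, bounded and discrete, and $f^{\mathcal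 M_2}$ maps $Z$ to $Z$, is injective on $Z$, and $f^{\mathcal M_2}(Z)=Z\setminus\{P(c_3)\}$, so $f^{\mathcal M_2}|_Z:Z\to Z$ is not surjective. 3. Consequently, there is an expansion of a dense linear order without endpoints that is definably complete and type complete but does not have the pigeonhole principle. So Schoutens' question whether every definably complete type complete structure has the pigeonhole principle has a negative answer, and the analogue of Fornasiero's conjecture (definable completeness implies the pigeonhole principle) fails for expansions of dense linear orders. -/

import Mathlib

open FirstOrder Set

universe u v w

namespace PigeonholeFailure

/-! ### Expansions of dense linear orders and their tameness properties

Languages contain a distinguished symbol for the order (Mathlib's `IsOrdered`, where the symbol is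
for the non-strict order; in a linear order the strict one is quantifier-free interdefinable).
"Definable" always means definable with parameters. -/

section Tameness

variable (L : FirstOrder.Language.{u, v}) (M : Type w) [LinearOrder M] [L.Structure M]

/-- `M` is an expansion of a (nonempty) dense linear order without endpoints. -/
structure IsDLOExpansion [L.IsOrdered] : Prop where
  ordered : L.OrderedStructure M
  nonempty : Nonempty M
  dense : DenselyOrdered M
  noMin : NoMinOrder M
  noMax : NoMaxOrder M

/-- Every nonempty definable subset of `M` that is bounded above has a least upper bound in `M`. -/
def DefinablyComplete : Prop :=
  ∀ A : Set M, (univ : Set M).Definable₁ L A → A.Nonempty → BddAbove A → ∃ s, IsLUB A s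

/-- Every definable set is, near every point and on each side of it, everything or nothing. -/
def LocallyOMinimal : Prop :=
  ∀ A : Set M, (univ : Set M).Definable₁ L A → ∀ a : M, ∃ b₁ b₂ : M, b₁ < a ∧ a < b₂ ∧
    (Ioo b₁ a ⊆ A ∨ Disjoint (Ioo b₁ a) A) ∧ (Ioo a b₂ ⊆ A ∨ Disjoint (Ioo a b₂) A)

/-- Locally o-minimal, with the same property near `-∞` and near `+∞`. -/
def TypeComplete : Prop :=
  LocallyOMinimal L M ∧
    ∀ A : Set M, (univ : Set M).Definable₁ L A → ∃ c₁ c₂ : M,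
      (Iio c₁ ⊆ A ∨ Disjoint (Iio c₁) A) ∧ (Ioi c₂ ⊆ A ∨ Disjoint (Ioi c₂) A)

variable {M}

/-- A definable subset of `M ^ n` that is closed, bounded and discrete. `M` carries the order
topology and `M ^ n` the product topology; bounded means contained in a box. -/
def IsPseudoFinite {n : ℕ} (X : Set (Fin n → M)) : Prop :=
  letI : TopologicalSpace M := Preorder.topology M
  (univ : Set M).Definable L X ∧ IsClosed X ∧ BddBelow X ∧ BddAbove X ∧ IsDiscrete X

/-- A self-map of `X ⊆ M ^ n` whose graph, a subset of `M ^ n × M ^ n`, is definable. -/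
def IsDefinableSelfMap {n : ℕ} {X : Set (Fin n → M)} (h : X → X) : Prop :=
  (univ : Set M).Definable L
    {p : Fin n ⊕ Fin n → M | ∃ x : X, p ∘ Sum.inl = x.1 ∧ p ∘ Sum.inr = (h x).1}

variable (M)

/-- Every definable injective self-map of a pseudo-finite set is surjective. -/
def PigeonholePrinciple : Prop :=
  ∀ (n : ℕ) (X : Set (Fin n → M)), IsPseudoFinite L X →
    ∀ h : X → X, IsDefinableSelfMap L h → Function.Injective h → Function.Surjective h

variable {M} in
/-- A point, or an open interval with endpoints in `M ∪ {-∞, +∞}`. -/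
def IsPointOrInterval (I : Set M) : Prop :=
  (∃ a, I = {a}) ∨ (∃ a b, I = Ioo a b) ∨ (∃ a, I = Iio a) ∨ (∃ a, I = Ioi a) ∨ I = univ

/-- An expansion of a dense linear order without endpoints in which every definable subset of the
universe is a finite union of points and intervals. -/
def IsOMinimal [L.IsOrdered] : Prop :=
  IsDLOExpansion L M ∧ ∀ A : Set M, (univ : Set M).Definable₁ L A →
    ∃ F : Set (Set M), F.Finite ∧ (∀ I ∈ F, IsPointOrInterval I) ∧ A = ⋃₀ F

end Tameness

/-- The set of all `L`-sentences that hold in every o-minimal `L`-structure. (O-minimality passes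
to elementary substructures, so by Löwenheim–Skolem it suffices to look at structures of size at
most `max |L| ℵ₀`, all of which have copies in `Type (max u v)`.) -/
def commonOMinimalTheory (L : FirstOrder.Language.{u, v}) [L.IsOrdered] : L.Theory :=
  {φ | ∀ (M : Type (max u v)) [LinearOrder M] [L.Structure M], IsOMinimal L M → M ⊨ φ}

/-! ### The languages -/

/-- Function and constant symbols of `L₀`. -/
inductive Func₀ : ℕ → Type
  | S : Func₀ 1
  | P : Func₀ 1
  | π : Func₀ 1
  | c₁ : Func₀ 0
  | c₂ : Func₀ 0
  | c₃ : Func₀ 0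
  | c₄ : Func₀ 0

/-- Relation symbols of `L₀`: the order and the unary predicate `Z`. -/
inductive Rel₀ : ℕ → Type
  | le : Rel₀ 2
  | Z : Rel₀ 1

/-- The two additional unary function symbols of `L₁`. -/
inductive FuncFG : ℕ → Type
  | f : FuncFG 1
  | g : FuncFG 1

/-- `L₀ = ⟨≤, Z; S, P, π; c₁, c₂, c₃, c₄⟩`. -/
def L₀ : FirstOrder.Language.{0, 0} := ⟨Func₀, Rel₀⟩

/-- The language with just the unary function symbols `f` and `g`. -/
def LFG : FirstOrder.Language.{0, 0} := ⟨FuncFG, fun _ => Empty⟩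

/-- `L₁ = L₀ ∪ {f, g}`. An `L₁`-structure is an `L₀`-structure together with an
interpretation of `f` and `g`. -/
abbrev L₁ : FirstOrder.Language.{0, 0} := L₀.sum LFG

instance : L₀.IsOrdered := ⟨Rel₀.le⟩

instance : L₁.IsOrdered := ⟨Sum.inl Rel₀.le⟩

section Interpretations

variable {M : Type u}

/-- The interpretation of `Z`. -/
def Z (M : Type u) [L₀.Structure M] : Set M :=
  {x | FirstOrder.Language.Structure.RelMap (L := L₀) Rel₀.Z ![x]}

variable [L₀.Structure M]

/-- The interpretation of `S`. -/
def S (x : M) : M := FirstOrder.Language.Structure.funMap (L := L₀) Func₀.S ![x]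

/-- The interpretation of `P`. -/
def P (x : M) : M := FirstOrder.Language.Structure.funMap (L := L₀) Func₀.P ![x]

/-- The interpretation of `π`. -/
def proj (x : M) : M := FirstOrder.Language.Structure.funMap (L := L₀) Func₀.π ![x]

variable (M)

/-- The interpretation of `c₁`. -/
def c₁ : M := FirstOrder.Language.Structure.funMap (L := L₀) Func₀.c₁ ![]

/-- The interpretation of `c₂`. -/
def c₂ : M := FirstOrder.Language.Structure.funMap (L := L₀) Func₀.c₂ ![]

/-- The interpretation of `c₃`. -/
def c₃ : M := FirstOrder.Language.Structure.funMap (L := L₀) Func₀.c₃ ![]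

/-- The interpretation of `c₄`. -/
def c₄ : M := FirstOrder.Language.Structure.funMap (L := L₀) Func₀.c₄ ![]

end Interpretations

/-- The interpretation of `f`. -/
def f {M : Type u} [LFG.Structure M] (x : M) : M :=
  FirstOrder.Language.Structure.funMap (L := LFG) FuncFG.f ![x]

/-- The interpretation of `g`. -/
def g {M : Type u} [LFG.Structure M] (x : M) : M :=
  FirstOrder.Language.Structure.funMap (L := LFG) FuncFG.g ![x]

/-- The cyclic order induced by a linear order. -/
def Cyc {M : Type u} [LinearOrder M] (a b c : M) : Prop :=
  (a < b ∧ b < c) ∨ (b < c ∧ c < a) ∨ (c < a ∧ a < b)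

/-! ### Models of `T₀` and `T₁`

The clauses about infinite sets are first-order schemes. -/

/-- `M` is a model of `T₀`. -/
structure IsModelT₀ (M : Type u) [LinearOrder M] [L₀.Structure M] : Prop where
  dlo : IsDLOExpansion L₀ M
  common : M ⊨ commonOMinimalTheory L₀
  /-- non-maximal elements of `Z` have an immediate successor in `Z` -/
  exists_succ : ∀ x ∈ Z M, (∃ y ∈ Z M, x < y) → ∃ y ∈ Z M, x < y ∧ ∀ z ∈ Z M, ¬ (x < z ∧ z < y)
  /-- non-minimal elements of `Z` have an immediate predecessor in `Z` -/
  exists_pred : ∀ x ∈ Z M, (∃ y ∈ Z M, y < x) → ∃ y ∈ Z M, y < x ∧ ∀ z ∈ Z M, ¬ (y < z ∧ z < x)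
  /-- `Z` is closed -/
  closed : ∀ x ∉ Z M, ∃ a b : M, x ∈ Ioo a b ∧ Disjoint (Ioo a b) (Z M)
  isLeast : IsLeast (Z M) (c₁ M)
  isGreatest : IsGreatest (Z M) (c₄ M)
  c₂_mem : c₂ M ∈ Z M
  c₃_mem : c₃ M ∈ Z M
  c₁_lt_c₂ : c₁ M < c₂ M
  c₂_lt_c₃ : c₂ M < c₃ M
  c₃_lt_c₄ : c₃ M < c₄ M
  infinite₁₂ : (Z M ∩ Ioo (c₁ M) (c₂ M)).Infinite
  infinite₂₃ : (Z M ∩ Ioo (c₂ M) (c₃ M)).Infinite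
  infinite₃₄ : (Z M ∩ Ioo (c₃ M) (c₄ M)).Infinite
  /-- `π` is the cyclic forward projection onto `Z` -/
  proj_mem : ∀ x : M, proj x ∈ Z M
  proj_first : ∀ x : M, ∀ y ∈ Z M, ¬ Cyc x y (proj x)
  proj_of_mem : ∀ x ∈ Z M, proj x = x
  /-- `S` is the cyclic successor on `Z` and the identity off `Z` -/
  S_iff : ∀ x y : M, S x = y ↔
    (x ∉ Z M ∧ x = y) ∨ (x ∈ Z M ∧ y ∈ Z M ∧ x ≠ y ∧ ¬ ∃ z ∈ Z M, Cyc x z y)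
  /-- `P` is the inverse of `S` -/
  P_S : ∀ x : M, P (S x) = x
  S_P : ∀ x : M, S (P x) = x

/-- `M` is a model of `T₁`. -/
structure IsModelT₁ (M : Type u) [LinearOrder M] [L₀.Structure M] [LFG.Structure M] : Prop where
  modelT₀ : IsModelT₀ M
  f_bijective : Function.Bijective (f : M → M)
  g_f : ∀ x : M, g (f x) = x
  f_g : ∀ x : M, f (g x) = x
  f_image_left : f '' (Z M ∩ Icc (c₁ M) (c₂ M)) = Z M ∩ Icc (c₃ M) (c₄ M)
  f_strictMono_left : StrictMonoOn f (Z M ∩ Icc (c₁ M) (c₂ M))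
  f_image_right : f '' (Z M ∩ Ioc (c₂ M) (c₄ M)) = Z M ∩ Ico (c₁ M) (c₃ M)
  f_strictMono_right : StrictMonoOn f (Z M ∩ Ioc (c₂ M) (c₄ M))
  infinite_forward : ∀ n : ℕ, 1 < n → ∀ z ∈ Z M, (Z M ∩ {x | Cyc z x (f^[n] z)}).Infinite
  infinite_backward : ∀ n : ℕ, 1 < n → ∀ z ∈ Z M, (Z M ∩ {x | Cyc (f^[n] z) x z}).Infinite
  f_of_notMem : ∀ x : M, x ∉ Z M → f x = x
  f_cyc : ∀ m n : ℕ, 0 < n → n < m → ∀ z ∈ Z M, Cyc (f^[m] z) (f^[n] z) z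

/-! ### The structure `M₂`

`Shift M` is the universe of `M` with the same `L₀`-structure and with `f`, `g` modified. -/

/-- The universe of `M₂`: a copy of the universe of `M₁ = M`. -/
def Shift (M : Type u) : Type u := M

section Shift

variable (M : Type u)

instance [h : LinearOrder M] : LinearOrder (Shift M) := h

instance [h : L₀.Structure M] : L₀.Structure (Shift M) := h

variable {M} [L₀.Structure M] [LFG.Structure M]

open Classical in
/-- The new `f`: shifted back by one on the elements finitely many steps before `c₄`. -/
noncomputable def shiftF (x : M) : M := if ∃ n : ℕ, S^[n] x = c₄ M then P (f x) else f x

open Classical in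
/-- The new `g`: shifted on the elements finitely many steps before `P c₃`. -/
noncomputable def shiftG (x : M) : M := if ∃ n : ℕ, S^[n] x = P (c₃ M) then g (S x) else g x

/-- The new interpretations of `f` and `g`. -/
noncomputable instance : LFG.Structure (Shift M) where
  funMap {n} s := match n, s with
    | _, FuncFG.f => fun v => shiftF (M := M) (v 0)
    | _, FuncFG.g => fun v => shiftG (M := M) (v 0)
  RelMap r := r.elim

end Shift

end PigeonholeFailure

open PigeonholeFailure

/-! The failure of the pigeonhole principle is a computation: `f` is a bijection of `Z`, and moving
it back by one on the points finitely many steps before `c₄` keeps it injective but makes it skip `P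
c₃`. The content is that this change cannot be detected on the line: every definable subset of `M₂`
depends only on membership in `Z` and on the position relative to finitely many points
(`unaryTame_of_definable`). Since `Z` is bounded and discrete, all its elements other than the first
are successors, and its complement is dense, such sets have suprema and constant behaviour on each
side of a point and near infinity (`IsSparse`).

The description of definable sets is a quantifier elimination. The cyclic order `Z` is unrolled to
`ℤ ×ₗ Z`, with successor `S` and translation `T` by a full turn. There the modified `f` lifts to a
strictly increasing map `F` which commutes with `T`, commutes with `S` off one `T`-orbit, and omits
one `T`-orbit of values. It has an upper adjoint `G`, and the monoid generated by `S`, `T`, their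
inverses, `F` and `G` is closed under upper adjoints (`IsCover.exists_adjoint`). Hence an inequality
between two words in different variables can be solved for either variable, and a condition on a
quantified variable, other than membership in `Z`, says that it lies in an upper set or outside one.
Upper sets form a chain, so an existential quantifier reduces to conditions on pairs
(`Eliminable.tame_exists`).

What remains are the conditions `h x ≤ x` in a single variable. Off finitely many orbits a word `h`
equals `T ^ j ∘ S ^ k ∘ F ^ n`. As `f` turns `Z` by an infinite amount, and no number of iterations
completes a turn, such a map is at most the identity everywhere or above it everywhere
(`IsCover.eventually_le_const`), so the condition has finitely many exceptions.

A model of `T₁` is an ultraproduct of rational lines on which `Z` consists of `(N + 2) ^ 2`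
consecutive integers and `f` rotates them back by `N + 2`. Each line is o-minimal as an
`L₀`-structure, so the common theory passes to the ultraproduct by Łoś's theorem, while `N + 2` and
the ratio of `(N + 2) ^ 2` to it become infinite. -/

namespace PigeonholeFailure

/-! ### Sets depending on finitely many basic conditions -/

section Tame

variable {M : Type u} (U : Set (Set M)) (R : Set (M → M → Prop))

/-- The condition that one coordinate lies in a set of `U`, or that two coordinates are related
by a relation of `R`. -/
def IsBasic {ι : Type v} (B : Set (ι → M)) : Prop :=
  (∃ i, ∃ A ∈ U, B = {v | v i ∈ A}) ∨ ∃ i j, ∃ r ∈ R, B = {v | r (v i) (v j)}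

/-- Membership in `A` only depends on the truth values of finitely many basic conditions. -/
def Tame {ι : Type v} (A : Set (ι → M)) : Prop :=
  ∃ F : Set (Set (ι → M)), F.Finite ∧ (∀ B ∈ F, IsBasic U R B) ∧
    ∀ v w : ι → M, (∀ B ∈ F, v ∈ B ↔ w ∈ B) → (v ∈ A ↔ w ∈ A)

/-- Membership in `A` only depends on membership in finitely many sets of `U`. -/
def UnaryTame (A : Set M) : Prop :=
  ∃ F ⊆ U, F.Finite ∧ ∀ x y : M, (∀ B ∈ F, x ∈ B ↔ y ∈ B) → (x ∈ A ↔ y ∈ A)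

/-- A binary relation that is tame as a set of pairs. -/
def TameRel (r : M → M → Prop) : Prop := Tame U R {v : Fin 2 → M | r (v 0) (v 1)}

variable {U R} {ι : Type v}

theorem IsBasic.tame {B : Set (ι → M)} (h : IsBasic U R B) : Tame U R B :=
  ⟨{B}, finite_singleton B, by simpa using h, fun v w H => H B rfl⟩

theorem Tame.compl {A : Set (ι → M)} (h : Tame U R A) : Tame U R Aᶜ := by
  obtain ⟨F, hF, hB, H⟩ := h
  exact ⟨F, hF, hB, fun v w e => not_congr (H v w e)⟩

/-- A set which depends only on membership in finitely many tame sets is tame. -/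
theorem Tame.of_forall {A : Set (ι → M)} {C : Set (Set (ι → M))} (hC : C.Finite)
    (h : ∀ B ∈ C, Tame U R B)
    (H : ∀ v w : ι → M, (∀ B ∈ C, v ∈ B ↔ w ∈ B) → (v ∈ A ↔ w ∈ A)) : Tame U R A := by
  choose! F hF hB hFB using h
  refine ⟨⋃ B ∈ C, F B, hC.biUnion hF, ?_, fun v w e => H v w fun B hBC => ?_⟩
  · simp only [mem_iUnion]
    rintro B ⟨D, hD, hBD⟩
    exact hB D hD B hBD
  · exact hFB B hBC v w fun D hD => e D (mem_biUnion hBC hD)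

theorem Tame.inter {A B : Set (ι → M)} (hA : Tame U R A) (hB : Tame U R B) :
    Tame U R (A ∩ B) :=
  Tame.of_forall (C := {A, B}) (by simp) (by simp [hA, hB]) fun v w e => by
    simp only [mem_insert_iff, mem_singleton_iff, forall_eq_or_imp, forall_eq] at e
    exact and_congr e.1 e.2

theorem Tame.union {A B : Set (ι → M)} (hA : Tame U R A) (hB : Tame U R B) :
    Tame U R (A ∪ B) :=
  Tame.of_forall (C := {A, B}) (by simp) (by simp [hA, hB]) fun v w e => by
    simp only [mem_insert_iff, mem_singleton_iff, forall_eq_or_imp, forall_eq] at e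
    exact or_congr e.1 e.2

theorem tame_const (p : Prop) : Tame U R {_v : ι → M | p} :=
  ⟨∅, finite_empty, by simp, fun _ _ _ => Iff.rfl⟩

theorem Tame.and {p q : (ι → M) → Prop} (hA : Tame U R {v | p v}) (hB : Tame U R {v | q v}) :
    Tame U R {v | p v ∧ q v} := hA.inter hB

theorem Tame.or {p q : (ι → M) → Prop} (hA : Tame U R {v | p v}) (hB : Tame U R {v | q v}) :
    Tame U R {v | p v ∨ q v} := hA.union hB

theorem Tame.not {p : (ι → M) → Prop} (hA : Tame U R {v | p v}) :
    Tame U R {v | ¬ p v} := hA.compl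

theorem UnaryTame.tame {A : Set M} (h : UnaryTame U A) (i : ι) :
    Tame U R {v : ι → M | v i ∈ A} := by
  obtain ⟨F, hFU, hF, H⟩ := h
  refine ⟨(fun B => {v : ι → M | v i ∈ B}) '' F, hF.image _, ?_, fun v w e => H _ _ fun B hB =>
    e _ (mem_image_of_mem _ hB)⟩
  rintro _ ⟨B, hB, rfl⟩
  exact Or.inl ⟨i, B, hFU hB, rfl⟩

theorem unaryTame_of_mem {A : Set M} (h : A ∈ U) : UnaryTame U A :=
  ⟨{A}, by simpa using h, finite_singleton A, fun x y H => H A rfl⟩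

theorem UnaryTame.compl {A : Set M} (h : UnaryTame U A) : UnaryTame U Aᶜ := by
  obtain ⟨F, hFU, hF, H⟩ := h
  exact ⟨F, hFU, hF, fun x y e => not_congr (H x y e)⟩

theorem unaryTame_const (p : Prop) : UnaryTame U {_x : M | p} :=
  ⟨∅, empty_subset _, finite_empty, fun _ _ _ => Iff.rfl⟩

theorem UnaryTame.of_forall {A : Set M} {C : Set (Set M)} (hC : C.Finite)
    (h : ∀ B ∈ C, UnaryTame U B)
    (H : ∀ v w : M, (∀ B ∈ C, v ∈ B ↔ w ∈ B) → (v ∈ A ↔ w ∈ A)) : UnaryTame U A := by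
  choose! F hF hB hFB using h
  refine ⟨⋃ B ∈ C, F B, iUnion₂_subset hF, hC.biUnion hB, fun v w e => H v w fun B hBC => ?_⟩
  exact hFB B hBC v w fun D hD => e D (mem_biUnion hBC hD)

theorem UnaryTame.inter {A B : Set M} (hA : UnaryTame U A) (hB : UnaryTame U B) :
    UnaryTame U (A ∩ B) :=
  UnaryTame.of_forall (C := {A, B}) (by simp) (by simp [hA, hB]) fun v w e => by
    simp only [mem_insert_iff, mem_singleton_iff, forall_eq_or_imp, forall_eq] at e
    exact and_congr e.1 e.2

theorem TameRel.of_mem {r : M → M → Prop} (h : r ∈ R) : TameRel U R r :=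
  IsBasic.tame (Or.inr ⟨0, 1, r, h, rfl⟩)

/-- Evaluate a term that is a variable or a constant. -/
def evalAt (v : ι → M) : ι ⊕ M → M := Sum.elim v id

/-- Specializing coordinates of the relations in `R` to constants gives tame conditions on
one variable. -/
structure SpecializationTame (U : Set (Set M)) (R : Set (M → M → Prop)) : Prop where
  left : ∀ r ∈ R, ∀ m, UnaryTame U {x | r m x}
  right : ∀ r ∈ R, ∀ m, UnaryTame U {x | r x m}
  diag : ∀ r ∈ R, UnaryTame U {x | r x x}

/-- Only binary conditions need an argument: with two variables substituted they stay basic, and a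
parameter in one slot leaves a condition on one variable, which is tame by `SpecializationTame`. -/
theorem Tame.comp (hs : SpecializationTame U R) {κ : Type w} {A : Set (κ → M)} (h : Tame U R A)
    (s : κ → ι ⊕ M) : Tame U R {v : ι → M | (fun k => evalAt v (s k)) ∈ A} := by
  obtain ⟨F, hF, hB, H⟩ := h
  refine Tame.of_forall (C := (fun B => {v : ι → M | (fun k => evalAt v (s k)) ∈ B}) '' F)
    (hF.image _) ?_ fun v w e => H _ _ fun B hB => e _ (mem_image_of_mem _ hB)
  rintro _ ⟨B, hBF, rfl⟩
  rcases hB B hBF with ⟨i, A, hA, rfl⟩ | ⟨i, j, r, hr, rfl⟩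
  · simp only [mem_ofPred_eq]
    rcases s i with i' | m
    · exact (unaryTame_of_mem hA).tame i'
    · exact tame_const (ι := ι) (m ∈ A)
  · simp only [mem_ofPred_eq]
    rcases s i with i' | m <;> rcases s j with j' | m'
    · exact IsBasic.tame (Or.inr ⟨i', j', r, hr, rfl⟩)
    · exact (hs.right r hr m').tame i'
    · exact (hs.left r hr m).tame j'
    · exact tame_const (ι := ι) (r m m')

theorem TameRel.comp (hs : SpecializationTame U R) {r : M → M → Prop} (h : TameRel U R r)
    (a b : ι ⊕ M) : Tame U R {v : ι → M | r (evalAt v a) (evalAt v b)} :=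
  Tame.comp hs h ![a, b]

/-- With one variable every binary condition sits on the diagonal, so `diag` removes the relations
altogether. This is why `R` disappears from the description of definable subsets of the line. -/
theorem Tame.unaryTame (hs : SpecializationTame U R) {A : Set M}
    (h : Tame U R {v : Fin 1 → M | v 0 ∈ A}) : UnaryTame U A := by
  obtain ⟨F, hF, hB, H⟩ := h
  refine UnaryTame.of_forall (C := (fun B => {x : M | (fun _ => x) ∈ B}) '' F) (hF.image _) ?_
    fun v w e => H (fun _ => v) (fun _ => w) fun B hB => e _ (mem_image_of_mem _ hB)
  rintro _ ⟨B, hBF, rfl⟩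
  rcases hB B hBF with ⟨i, A, hA, rfl⟩ | ⟨i, j, r, hr, rfl⟩
  · exact unaryTame_of_mem hA
  · exact hs.diag r hr

/-! ### Elimination of a quantifier -/

/-- Among finitely many upper sets of a linear order there is a smallest one. -/
theorem exists_min_upperSet [LinearOrder M] {κ : Type w} {K : Set κ} (hK : K.Finite)
    (hne : K.Nonempty) (D : κ → Set M) (hD : ∀ k ∈ K, IsUpperSet (D k)) :
    ∃ k ∈ K, ∀ l ∈ K, D k ⊆ D l := by
  obtain ⟨k, hk, H⟩ := hK.exists_minimalFor D K hne
  exact ⟨k, hk, fun l hl => ((hD k hk).total (hD l hl)).elim id (H hl)⟩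

/-- Among finitely many upper sets of a linear order there is a largest one. -/
theorem exists_max_upperSet [LinearOrder M] {κ : Type w} {K : Set κ} (hK : K.Finite)
    (hne : K.Nonempty) (D : κ → Set M) (hD : ∀ k ∈ K, IsUpperSet (D k)) :
    ∃ k ∈ K, ∀ l ∈ K, D l ⊆ D k := by
  obtain ⟨k, hk, H⟩ := exists_min_upperSet (M := Mᵒᵈ) hK hne
    (fun k => OrderDual.ofDual ⁻¹' (D k)ᶜ) fun k hk => (hD k hk).compl.toDual
  exact ⟨k, hk, fun l hl => compl_subset_compl.1 (H l hl)⟩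

/-- `Z` and the relations in `V`, whose fibers are upper sets, suffice to express all conditions in
`U` and `R` on the last variable, and compositions of relations in `V` are tame. -/
structure Eliminable [LinearOrder M] (U : Set (Set M)) (R V : Set (M → M → Prop)) (Z : Set M) :
    Prop where
  upper : ∀ Q ∈ V, ∀ x, IsUpperSet {y | Q x y}
  unary : ∀ A ∈ U, A = Z ∨ ∃ Q ∈ V, ∃ m, A = {y | Q m y}
  right : ∀ r ∈ R, r ∈ V
  left : ∀ r ∈ R, ∃ Q ∈ V, ∀ x y, r y x ↔ ¬ Q x y
  exists_true : ∃ Q ∈ V, ∃ m, ∀ y, Q m y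
  exists_false : ∃ Q ∈ V, ∃ m, ∀ y, ¬ Q m y
  comp_mem : ∀ Q ∈ V, ∀ Q' ∈ V, TameRel U R fun x x' => ∃ y ∈ Z, Q x y ∧ ¬ Q' x' y
  comp_notMem : ∀ Q ∈ V, ∀ Q' ∈ V, TameRel U R fun x x' => ∃ y ∉ Z, Q x y ∧ ¬ Q' x' y

/-- Extend a tuple by a last coordinate. -/
def extend (v : ι → M) (y : M) : Option ι → M := fun o => o.elim y v

/-- For pairs of a tuple and a further element, membership only depends on finitely many basic
conditions on the tuple, on finitely many conditions `Q a y` where `a` is a coordinate or a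
constant, and on `y ∈ Z`. -/
def LastTame (U : Set (Set M)) (R V : Set (M → M → Prop)) (Z : Set M) (A : Set (Option ι → M)) :
    Prop :=
  ∃ (F : Set (Set (ι → M))) (K : Set ((ι ⊕ M) × (M → M → Prop))), F.Finite ∧ K.Finite ∧
    (∀ B ∈ F, IsBasic U R B) ∧ (∀ k ∈ K, k.2 ∈ V) ∧
    ∀ v v' y y', (∀ B ∈ F, v ∈ B ↔ v' ∈ B) →
      (∀ k ∈ K, k.2 (evalAt v k.1) y ↔ k.2 (evalAt v' k.1) y') → (y ∈ Z ↔ y' ∈ Z) →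
      (extend v y ∈ A ↔ extend v' y' ∈ A)

theorem LastTame.of_forall {V : Set (M → M → Prop)} {Z : Set M} {A : Set (Option ι → M)}
    {C : Set (Set (Option ι → M))} (hC : C.Finite) (h : ∀ B ∈ C, LastTame U R V Z B)
    (H : ∀ v w : Option ι → M, (∀ B ∈ C, v ∈ B ↔ w ∈ B) → (v ∈ A ↔ w ∈ A)) :
    LastTame U R V Z A := by
  choose! F K hF hK hFB hKV hFK using h
  refine ⟨⋃ B ∈ C, F B, ⋃ B ∈ C, K B, hC.biUnion hF, hC.biUnion hK, ?_, ?_,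
    fun v v' y y' e e' e'' => H _ _ fun B hB => hFK B hB v v' y y'
      (fun D hD => e D (mem_biUnion hB hD)) (fun k hk => e' k (mem_biUnion hB hk)) e''⟩
  · simp only [mem_iUnion]
    rintro B ⟨D, hD, hBD⟩
    exact hFB D hD B hBD
  · simp only [mem_iUnion]
    rintro k ⟨D, hD, hkD⟩
    exact hKV D hD k hkD

variable [LinearOrder M] {V : Set (M → M → Prop)} {Z : Set M}

theorem Eliminable.lastTame_unary (he : Eliminable U R V Z) {A : Set M} (hA : A ∈ U) :
    LastTame U R V Z {v : Option ι → M | v none ∈ A} := by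
  rcases he.unary A hA with rfl | ⟨Q, hQ, m, rfl⟩
  · exact ⟨∅, ∅, finite_empty, finite_empty, by simp, by simp, fun v v' y y' _ _ e => e⟩
  · exact ⟨∅, {(Sum.inr m, Q)}, finite_empty, finite_singleton _, by simp, by simpa using hQ,
      fun v v' y y' _ e _ => e _ rfl⟩

/-- The basic conditions are sorted by how they mention the last variable. If it stands on the left
of a relation, `left` turns the condition into the negation of one where it stands on the right; a
diagonal condition becomes unary. -/
theorem Eliminable.lastTame (he : Eliminable U R V Z) (hs : SpecializationTame U R)
    {A : Set (Option ι → M)} (hA : Tame U R A) : LastTame U R V Z A := by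
  obtain ⟨F, hF, hB, H⟩ := hA
  refine LastTame.of_forall hF (fun B hBF => ?_) H
  have old : ∀ D : Set (ι → M), IsBasic U R D →
      LastTame U R V Z {v : Option ι → M | (fun i => v (some i)) ∈ D} := fun D hD =>
    ⟨{D}, ∅, finite_singleton _, finite_empty, by simpa using hD, by simp,
      fun v v' y y' e _ _ => e D rfl⟩
  rcases hB B hBF with ⟨i, A, hA, rfl⟩ | ⟨i, j, r, hr, rfl⟩
  · rcases i with _ | i
    · exact he.lastTame_unary hA
    · exact old {v | v i ∈ A} (Or.inl ⟨i, A, hA, rfl⟩)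
  · rcases i with _ | i <;> rcases j with _ | j
    · obtain ⟨F', hF'U, hF', H'⟩ := hs.diag r hr
      refine LastTame.of_forall (C := (fun B => {v : Option ι → M | v none ∈ B}) '' F')
        (hF'.image _) ?_ fun v w e => H' _ _ fun B hB => e _ (mem_image_of_mem _ hB)
      rintro _ ⟨B, hB, rfl⟩
      exact he.lastTame_unary (hF'U hB)
    · obtain ⟨Q, hQ, hQr⟩ := he.left r hr
      refine ⟨∅, {(Sum.inl j, Q)}, finite_empty, finite_singleton _, by simp, by simpa using hQ,
        fun v v' y y' _ e _ => ?_⟩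
      exact (hQr _ _).trans ((not_congr (e _ rfl)).trans (hQr _ _).symm)
    · exact ⟨∅, {(Sum.inl i, r)}, finite_empty, finite_singleton _, by simp,
        by simpa using he.right r hr, fun v v' y y' _ e _ => e _ rfl⟩
    · exact old {v | r (v i) (v j)} (Or.inr ⟨i, j, r, hr, rfl⟩)

/-- Projections of tame sets are tame. -/
theorem Eliminable.tame_exists (he : Eliminable U R V Z) (hs : SpecializationTame U R)
    {A : Set (Option ι → M)} (hA : Tame U R A) : Tame U R {v : ι → M | ∃ y, extend v y ∈ A} := by
  obtain ⟨F, K₀, hF, hK₀, hFB, hK₀V, H⟩ := he.lastTame hs hA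
  obtain ⟨Qt, hQt, mt, ht⟩ := he.exists_true
  obtain ⟨Qf, hQf, mf, hf⟩ := he.exists_false
  -- The always true and the always false condition are added so that the conditions satisfied by a
  -- given `y`, and those it violates, both form nonempty families.
  let K : Set ((ι ⊕ M) × (M → M → Prop)) := insert (Sum.inr mt, Qt) (insert (Sum.inr mf, Qf) K₀)
  have hK : K.Finite := (hK₀.insert _).insert _
  have hKV : ∀ k ∈ K, k.2 ∈ V := by
    rintro k (rfl | rfl | hk)
    exacts [hQt, hQf, hK₀V k hk]
  let C₁ : ((ι ⊕ M) × (M → M → Prop)) × ((ι ⊕ M) × (M → M → Prop)) → Set (ι → M) := fun p =>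
    {v | ∃ y ∈ Z, p.1.2 (evalAt v p.1.1) y ∧ ¬ p.2.2 (evalAt v p.2.1) y}
  let C₂ : ((ι ⊕ M) × (M → M → Prop)) × ((ι ⊕ M) × (M → M → Prop)) → Set (ι → M) := fun p =>
    {v | ∃ y ∉ Z, p.1.2 (evalAt v p.1.1) y ∧ ¬ p.2.2 (evalAt v p.2.1) y}
  have key : ∀ v w : ι → M, (∀ B ∈ F ∪ (C₁ '' K ×ˢ K ∪ C₂ '' K ×ˢ K), v ∈ B ↔ w ∈ B) →
      (∃ y, extend v y ∈ A) → ∃ y, extend w y ∈ A := by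
    rintro v w e ⟨y, hy⟩
    -- Over `w` the conditions cut out a chain of upper sets. Here `k` has the smallest among those
    -- that `y` satisfies over `v`, and `l` the largest among those that `y` violates. A point in
    -- the first and outside the second has over `w` the same pattern as `y` over `v`, so testing
    -- pairs suffices.
    obtain ⟨k, ⟨hkK, hk⟩, hkm⟩ := exists_min_upperSet (K := {k ∈ K | k.2 (evalAt v k.1) y})
      (hK.subset (sep_subset _ _)) ⟨(Sum.inr mt, Qt), mem_insert _ _, ht y⟩
      (fun k => {y | k.2 (evalAt w k.1) y}) fun k hk => he.upper _ (hKV k hk.1) _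
    obtain ⟨l, ⟨hlK, hl⟩, hlm⟩ := exists_max_upperSet (K := {k ∈ K | ¬ k.2 (evalAt v k.1) y})
      (hK.subset (sep_subset _ _)) ⟨(Sum.inr mf, Qf), mem_insert_of_mem _ (mem_insert _ _), hf y⟩
      (fun k => {y | k.2 (evalAt w k.1) y}) fun k hk => he.upper _ (hKV k hk.1) _
    obtain ⟨y', hyy', hky', hly'⟩ : ∃ y', (y ∈ Z ↔ y' ∈ Z) ∧ k.2 (evalAt w k.1) y' ∧
        ¬ l.2 (evalAt w l.1) y' := by
      by_cases hyZ : y ∈ Z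
      · obtain ⟨y', h1, h2, h3⟩ := (e (C₁ (k, l)) (Or.inr (Or.inl
          (mem_image_of_mem _ ⟨hkK, hlK⟩)))).1 ⟨y, hyZ, hk, hl⟩
        exact ⟨y', by simp [hyZ, h1], h2, h3⟩
      · obtain ⟨y', h1, h2, h3⟩ := (e (C₂ (k, l)) (Or.inr (Or.inr
          (mem_image_of_mem _ ⟨hkK, hlK⟩)))).1 ⟨y, hyZ, hk, hl⟩
        exact ⟨y', by simp [hyZ, h1], h2, h3⟩
    refine ⟨y', (H v w y y' (fun B hB => e B (Or.inl hB)) (fun q hq => ?_) hyy').1 hy⟩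
    have hqK : q ∈ K := mem_insert_of_mem _ (mem_insert_of_mem _ hq)
    by_cases hqy : q.2 (evalAt v q.1) y
    · exact ⟨fun _ => hkm q ⟨hqK, hqy⟩ hky', fun _ => hqy⟩
    · exact ⟨fun h => absurd h hqy, fun h => absurd (hlm q ⟨hqK, hqy⟩ h) hly'⟩
  refine Tame.of_forall (C := F ∪ (C₁ '' K ×ˢ K ∪ C₂ '' K ×ˢ K))
    (hF.union (((hK.prod hK).image _).union ((hK.prod hK).image _))) ?_
    fun v w e => ⟨key v w e, key w v fun B hB => (e B hB).symm⟩
  rintro B (hB | ⟨⟨k, l⟩, ⟨hk, hl⟩, rfl⟩ | ⟨⟨k, l⟩, ⟨hk, hl⟩, rfl⟩)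
  · exact (hFB B hB).tame
  · exact (he.comp_mem _ (hKV k hk) _ (hKV l hl)).comp hs k.1 l.1
  · exact (he.comp_notMem _ (hKV k hk) _ (hKV l hl)).comp hs k.1 l.1

end Tame


/-! ### A monoid of monotone maps of a discrete linear order, closed under upper adjoints -/

section Cover

open Filter

variable {X : Type u} [LinearOrder X]

/-- A discrete linear order with successor `S` and a translation `T`, with a strictly monotone map
`F` with upper adjoint `G` such that `F`, `S` and `T` commute and `F` is invertible up to finitely
many orbits of `T`, and the iterates of `F` stay infinitely far from the identity and `T⁻¹`. -/
structure IsCover (S T : X ≃o X) (F G : X → X) : Prop where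
  lt_iff : ∀ u w, u < w ↔ S u ≤ w
  S_T : ∀ u, S (T u) = T (S u)
  F_T : ∀ u, F (T u) = T (F u)
  gc : GaloisConnection F G
  strictMono : StrictMono F
  F_S : ∃ c, ∀ u, (∀ j : ℤ, u ≠ (T ^ j) c) → F (S u) = S (F u)
  F_G : ∃ p, ∀ u, (∀ j : ℤ, u ≠ (T ^ j) p) → F (G u) = u
  below : ∀ (n : ℕ) (k : ℤ) (u : X), 0 < n → F^[n] u < (S ^ k) u
  above : ∀ (n : ℕ) (k : ℤ) (u : X), 0 < n → (S ^ k) u < T (F^[n] u)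

/-- The monoid of maps generated by `S`, `T`, their inverses, `F` and `G`. -/
inductive Gen (S T : X ≃o X) (F G : X → X) : (X → X) → Prop
  | id : Gen S T F G id
  | S : Gen S T F G S
  | S_symm : Gen S T F G S.symm
  | T : Gen S T F G T
  | T_symm : Gen S T F G T.symm
  | F : Gen S T F G F
  | G : Gen S T F G G
  | comp {h k} : Gen S T F G h → Gen S T F G k → Gen S T F G (h ∘ k)

/-- The filter of sets containing all but finitely many orbits of `T`. -/
def orbitCofinite (T : X ≃o X) : Filter X where
  sets := {A | ∃ E : Set X, E.Finite ∧ ∀ u ∉ A, ∃ e ∈ E, ∃ j : ℤ, u = (T ^ j) e}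
  univ_sets := ⟨∅, finite_empty, by simp⟩
  sets_of_superset := by
    rintro A B ⟨E, hE, H⟩ hAB
    exact ⟨E, hE, fun u hu => H u fun h => hu (hAB h)⟩
  inter_sets := by
    rintro A B ⟨E, hE, H⟩ ⟨E', hE', H'⟩
    refine ⟨E ∪ E', hE.union hE', fun u hu => ?_⟩
    by_cases hA : u ∈ A
    · obtain ⟨e, he, h⟩ := H' u fun hB => hu ⟨hA, hB⟩
      exact ⟨e, Or.inr he, h⟩
    · obtain ⟨e, he, h⟩ := H u hA
      exact ⟨e, Or.inl he, h⟩

theorem eventually_orbitCofinite {T : X ≃o X} {p : X → Prop} :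
    (∀ᶠ u in orbitCofinite T, p u) ↔
      ∃ E : Set X, E.Finite ∧ ∀ u, ¬ p u → ∃ e ∈ E, ∃ j : ℤ, u = (T ^ j) e := Iff.rfl

theorem eventually_of_exception {T : X ≃o X} {p : X → Prop}
    (h : ∃ c, ∀ u, (∀ j : ℤ, u ≠ (T ^ j) c) → p u) : ∀ᶠ u in orbitCofinite T, p u := by
  obtain ⟨c, hc⟩ := h
  refine eventually_orbitCofinite.2 ⟨{c}, finite_singleton c, fun u hu => ⟨c, rfl, ?_⟩⟩
  by_contra! h
  exact hu (hc u h)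

variable {S T : X ≃o X} {F G : X → X}

namespace IsCover

theorem lt_S (h : IsCover S T F G) (u : X) : u < S u := (h.lt_iff _ _).2 le_rfl

theorem lt_S_iff (h : IsCover S T F G) (u w : X) : u < S w ↔ u ≤ w := by
  rw [h.lt_iff, S.le_iff_le]

theorem le_S_symm_iff (h : IsCover S T F G) (u w : X) : u ≤ S.symm w ↔ u < w := by
  rw [← h.lt_S_iff, S.apply_symm_apply]

theorem G_F (h : IsCover S T F G) (u : X) : G (F u) = u :=
  le_antisymm (h.strictMono.le_iff_le.1 (h.gc.l_u_le _)) (h.gc.le_u_l _)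

/-- The lower adjoint of `F` is the map that later induces the modified `g`; it differs from `G`
only where `F` skips a value. -/
theorem lower_adjoint (h : IsCover S T F G) (u w : X) : S (G (S.symm u)) ≤ w ↔ u ≤ F w := by
  rw [← h.lt_iff, ← not_le, ← h.gc, h.le_S_symm_iff, not_lt]

/-- By discreteness `G u ≤ w` is the failure of `S w ≤ G u`, that is, of `F (S w) ≤ u`. So the upper
adjoint of `G` is a conjugate of `F`, and taking adjoints never leaves the monoid. -/
theorem G_le_iff (h : IsCover S T F G) (u w : X) : G u ≤ w ↔ u ≤ S.symm (F (S w)) := by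
  rw [h.le_S_symm_iff, ← not_le, h.gc, ← h.lt_iff, not_lt]

/-- Every map in the monoid has an upper adjoint in the monoid. -/
theorem exists_adjoint (h : IsCover S T F G) {a : X → X} (ha : Gen S T F G a) :
    ∃ b, Gen S T F G b ∧ GaloisConnection a b := by
  induction ha with
  | id => exact ⟨_, .id, GaloisConnection.id⟩
  | S => exact ⟨_, .S_symm, S.to_galoisConnection⟩
  | S_symm => exact ⟨_, .S, S.symm.to_galoisConnection⟩
  | T => exact ⟨_, .T_symm, T.to_galoisConnection⟩
  | T_symm => exact ⟨_, .T, T.symm.to_galoisConnection⟩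
  | F => exact ⟨_, .G, h.gc⟩
  | G => exact ⟨_, .comp .S_symm (.comp .F .S), h.G_le_iff⟩
  | comp _ _ ih ih' =>
    obtain ⟨b, hb, hab⟩ := ih
    obtain ⟨b', hb', hab'⟩ := ih'
    exact ⟨_, .comp hb' hb, hab'.compose hab⟩

theorem monotone (h : IsCover S T F G) {a : X → X} (ha : Gen S T F G a) : Monotone a :=
  (h.exists_adjoint ha).choose_spec.2.monotone_l

theorem G_T (h : IsCover S T F G) (u : X) : G (T u) = T (G u) := by
  refine eq_of_forall_le_iff fun w => ?_
  rw [← h.gc, ← T.symm_apply_le, ← T.symm_apply_le, ← h.gc]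
  have := h.F_T (T.symm w)
  rw [T.apply_symm_apply] at this
  rw [this, T.symm_apply_apply]

theorem comm_T (h : IsCover S T F G) {a : X → X} (ha : Gen S T F G a) (u : X) :
    a (T u) = T (a u) := by
  induction ha generalizing u with
  | id => rfl
  | S => exact h.S_T u
  | S_symm => rw [S.symm_apply_eq, h.S_T, S.apply_symm_apply]
  | T => rfl
  | T_symm => simp
  | F => exact h.F_T u
  | G => exact h.G_T u
  | comp _ _ ih ih' => simp only [Function.comp_apply, ih, ih']

theorem comm_T_zpow (h : IsCover S T F G) {a : X → X} (ha : Gen S T F G a) (j : ℤ) (u : X) :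
    a ((T ^ j) u) = (T ^ j) (a u) := by
  induction j using Int.induction_on generalizing u with
  | zero => rfl
  | succ j ih => 
    rw [zpow_add_one, RelIso.mul_apply, RelIso.mul_apply, ih, h.comm_T ha]
  | pred j ih => 
    have := h.comm_T ha (T.symm u)
    rw [T.apply_symm_apply] at this
    rw [zpow_sub_one, RelIso.mul_apply, RelIso.mul_apply, ih]
    congr 1
    exact ((T.symm_apply_eq).2 this).symm

theorem gen_S_zpow (k : ℤ) : Gen S T F G ⇑(S ^ k) := by
  induction k using Int.induction_on with
  | zero => exact .id
  | succ k ih => rw [zpow_add_one]; exact .comp (h := ⇑(S ^ (k : ℤ))) ih .S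
  | pred k ih => rw [zpow_sub_one]; exact .comp (h := ⇑(S ^ (-k : ℤ))) ih .S_symm

theorem gen_T_zpow (k : ℤ) : Gen S T F G ⇑(T ^ k) := by
  induction k using Int.induction_on with
  | zero => exact .id
  | succ k ih => rw [zpow_add_one]; exact .comp (h := ⇑(T ^ (k : ℤ))) ih .T
  | pred k ih => rw [zpow_sub_one]; exact .comp (h := ⇑(T ^ (-k : ℤ))) ih .T_symm

theorem gen_F_iterate (n : ℕ) : Gen S T F G F^[n] := by
  induction n with
  | zero => exact .id
  | succ n ih => exact .comp ih .F

theorem gen_G_iterate (n : ℕ) : Gen S T F G G^[n] := by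
  induction n with
  | zero => exact .id
  | succ n ih => exact .comp ih .G

/-- Since `a` commutes with `T`, the preimage of an orbit is the union of the orbits that meet the
fiber over one representative. -/
theorem tendsto_of_finite_fibers (h : IsCover S T F G) {a : X → X} (ha : Gen S T F G a)
    (H : ∀ e, ∃ E : Set X, E.Finite ∧ ∀ u, a u = e → ∃ e' ∈ E, ∃ j : ℤ, u = (T ^ j) e') :
    Tendsto a (orbitCofinite T) (orbitCofinite T) := by
  rintro A ⟨E, hE, hA⟩
  choose E' hE' H' using H
  refine ⟨⋃ e ∈ E, E' e, hE.biUnion fun e _ => hE' e, fun u hu => ?_⟩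
  obtain ⟨e, he, j, hj⟩ := hA (a u) hu
  have : a ((T ^ (-j)) u) = e := by
    rw [h.comm_T_zpow ha, hj, ← RelIso.mul_apply, ← zpow_add, neg_add_cancel]; rfl
  obtain ⟨e', he', i, hi⟩ := H' e _ this
  refine ⟨e', mem_biUnion he he', j + i, ?_⟩
  rw [zpow_add, RelIso.mul_apply, ← hi, ← RelIso.mul_apply, ← zpow_add, add_neg_cancel]; rfl

theorem tendsto_of_injective (h : IsCover S T F G) {a : X → X} (ha : Gen S T F G a)
    (hinj : Function.Injective a) : Tendsto a (orbitCofinite T) (orbitCofinite T) :=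
  h.tendsto_of_finite_fibers ha fun e => ⟨a ⁻¹' {e},
    (finite_singleton e).preimage hinj.injOn, fun u hu => ⟨u, hu, 0, rfl⟩⟩

theorem tendsto (h : IsCover S T F G) {a : X → X} (ha : Gen S T F G a) :
    Tendsto a (orbitCofinite T) (orbitCofinite T) := by
  induction ha with
  | id => exact tendsto_id
  | S => exact h.tendsto_of_injective .S S.injective
  | S_symm => exact h.tendsto_of_injective .S_symm S.symm.injective
  | T => exact h.tendsto_of_injective .T T.injective
  | T_symm => exact h.tendsto_of_injective .T_symm T.symm.injective
  | F => exact h.tendsto_of_injective .F h.strictMono.injective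
  | G =>
    obtain ⟨p, hp⟩ := h.F_G
    -- Off the orbit of `p`, `G u = e` forces `u = F (G u) = F e`.
    refine h.tendsto_of_finite_fibers .G fun e => ⟨{F e, p}, by simp, fun u hu => ?_⟩
    by_cases hup : ∀ j : ℤ, u ≠ (T ^ j) p
    · exact ⟨F e, Or.inl rfl, 0, by rw [← hu, hp u hup]; rfl⟩
    · push Not at hup
      exact ⟨p, Or.inr rfl, hup⟩
  | comp _ _ ih ih' => exact ih.comp ih'

/-! ### Commutation up to finitely many orbits, and normal forms of words. -/

theorem eventually_F_S_zpow (h : IsCover S T F G) (k : ℤ) :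
    ∀ᶠ u in orbitCofinite T, F ((S ^ k) u) = (S ^ k) (F u) := by
  induction k using Int.induction_on with
  | zero => exact Eventually.of_forall fun _ => rfl
  | succ k ih =>
    filter_upwards [(h.tendsto .S).eventually ih, eventually_of_exception h.F_S] with u h1 h2
    rw [zpow_add_one, RelIso.mul_apply, RelIso.mul_apply, h1, h2]
  | pred k ih =>
    filter_upwards [(h.tendsto .S_symm).eventually ih,
      (h.tendsto .S_symm).eventually (eventually_of_exception h.F_S)] with u h1 h2
    rw [zpow_sub_one, RelIso.mul_apply, RelIso.mul_apply]
    refine h1.trans (congrArg _ ?_)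
    rw [S.apply_symm_apply] at h2
    exact (S.symm_apply_eq.2 h2).symm

theorem eventually_G_S_zpow (h : IsCover S T F G) (k : ℤ) :
    ∀ᶠ u in orbitCofinite T, G ((S ^ k) u) = (S ^ k) (G u) := by
  filter_upwards [(h.tendsto .G).eventually (h.eventually_F_S_zpow k),
    eventually_of_exception h.F_G] with u h1 h2
  rw [h2] at h1
  rw [← h1, h.G_F]

variable (F G) in
/-- Integer powers of `F`, with `G` as the inverse. -/
def power : ℤ → X → X
  | Int.ofNat n => F^[n]
  | Int.negSucc n => G^[n + 1]

theorem gen_power (n : ℤ) : Gen S T F G (power F G n) := by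
  rcases n with n | n
  · exact gen_F_iterate n
  · exact gen_G_iterate _

/-- For negative exponents `F` has to cancel a `G`, which is only possible off the orbit in `F_G`.
In `G_power` nothing is excluded, because `G ∘ F` is the identity everywhere. -/
theorem eventually_F_power (h : IsCover S T F G) (n : ℤ) :
    ∀ᶠ u in orbitCofinite T, F (power F G n u) = power F G (n + 1) u := by
  rcases n with n | n
  · exact Eventually.of_forall fun u => (Function.iterate_succ_apply' F n u).symm
  · filter_upwards [(h.tendsto (gen_G_iterate n)).eventually (eventually_of_exception h.F_G)]
      with u hu
    rw [power, Function.iterate_succ_apply', hu]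
    rcases n with _ | n <;> rfl

theorem G_power (h : IsCover S T F G) (n : ℤ) (u : X) :
    G (power F G n u) = power F G (n - 1) u := by
  rcases n with n | n
  · rcases n with _ | n
    · rfl
    · have : Int.ofNat (n + 1) - 1 = Int.ofNat n := by simp
      rw [this, power, power, Function.iterate_succ_apply', h.G_F]
  · exact (Function.iterate_succ_apply' G (n + 1) u).symm

/-- Off finitely many orbits the generators commute and `G` inverts `F`, so a word collapses to its
exponents. The factor `b`, already in normal form, makes the induction pass through compositions. -/
theorem exists_normal_form_comp (h : IsCover S T F G) {a : X → X} (ha : Gen S T F G a)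
    {b : X → X} (hb : ∃ j k n : ℤ, ∀ᶠ u in orbitCofinite T,
      b u = (T ^ j) ((S ^ k) (power F G n u))) :
    ∃ j k n : ℤ, ∀ᶠ u in orbitCofinite T, a (b u) = (T ^ j) ((S ^ k) (power F G n u)) := by
  induction ha generalizing b with
  | id => exact hb
  | S =>
    obtain ⟨j, k, n, H⟩ := hb
    refine ⟨j, 1 + k, n, H.mono fun u hu => ?_⟩
    rw [hu, h.comm_T_zpow .S, zpow_add, zpow_one, RelIso.mul_apply]
  | S_symm =>
    obtain ⟨j, k, n, H⟩ := hb
    refine ⟨j, -1 + k, n, H.mono fun u hu => ?_⟩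
    rw [hu, h.comm_T_zpow .S_symm, zpow_add, zpow_neg_one, RelIso.mul_apply]; rfl
  | T =>
    obtain ⟨j, k, n, H⟩ := hb
    refine ⟨1 + j, k, n, H.mono fun u hu => ?_⟩
    rw [hu, zpow_add, zpow_one, RelIso.mul_apply]
  | T_symm =>
    obtain ⟨j, k, n, H⟩ := hb
    refine ⟨-1 + j, k, n, H.mono fun u hu => ?_⟩
    rw [hu, zpow_add, zpow_neg_one, RelIso.mul_apply]; rfl
  | F =>
    obtain ⟨j, k, n, H⟩ := hb
    refine ⟨j, k, n + 1, ?_⟩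
    filter_upwards [H, h.eventually_F_power n,
      (h.tendsto (gen_power n)).eventually (h.eventually_F_S_zpow k)] with u h1 h2 h3
    rw [h1, h.comm_T_zpow .F, h3, h2]
  | G =>
    obtain ⟨j, k, n, H⟩ := hb
    refine ⟨j, k, n - 1, ?_⟩
    filter_upwards [H, (h.tendsto (gen_power n)).eventually (h.eventually_G_S_zpow k)] with u h1 h3
    rw [h1, h.comm_T_zpow .G, h3, h.G_power]
  | comp _ _ ih ih' => exact ih (ih' hb)

theorem lt_S_zpow_T (h : IsCover S T F G) (k : ℤ) (u : X) : (S ^ k) u < T u :=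
  (h.above 1 k u one_pos).trans (T.lt_iff_lt.2 (h.below 1 0 u one_pos))

theorem S_zpow_lt (h : IsCover S T F G) {k : ℤ} (hk : 0 < k) (u : X) : u < (S ^ k) u := by
  obtain ⟨n, rfl⟩ : ∃ n : ℕ, k = n + 1 := ⟨(k - 1).toNat, by omega⟩
  clear hk
  induction n with
  | zero => simpa using h.lt_S u
  | succ n ih =>
    refine ih.trans ?_
    rw [Nat.cast_succ, add_comm ((n : ℤ) + 1), zpow_add _ 1, zpow_one, RelIso.mul_apply]
    exact h.lt_S _

theorem S_zpow_zpow (k l : ℤ) (u : X) : (S ^ k) ((S ^ l) u) = (S ^ (k + l)) u := by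
  rw [zpow_add, RelIso.mul_apply]

theorem S_zpow_lt_iff (k : ℤ) (u w : X) : (S ^ k) u < w ↔ u < (S ^ (-k)) w := by
  rw [← (S ^ (-k)).lt_iff_lt, S_zpow_zpow, neg_add_cancel]; rfl

theorem lt_S_zpow_iff (k : ℤ) (u w : X) : u < (S ^ k) w ↔ (S ^ (-k)) u < w := by
  rw [S_zpow_lt_iff, neg_neg]

theorem iterate_gc (h : IsCover S T F G) (n : ℕ) : GaloisConnection F^[n] G^[n] := by
  induction n with
  | zero => exact GaloisConnection.id
  | succ n ih =>
    rw [Function.iterate_succ', Function.iterate_succ]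
    exact ih.compose h.gc

theorem T_zpow_le (h : IsCover S T F G) {j : ℤ} (hj : 0 ≤ j) (u : X) : u ≤ (T ^ j) u := by
  obtain ⟨n, rfl⟩ : ∃ n : ℕ, j = n := ⟨j.toNat, by omega⟩
  clear hj
  induction n with
  | zero => exact le_rfl
  | succ n ih =>
    refine ih.trans ?_
    rw [Nat.cast_succ, add_comm (n : ℤ), zpow_add _ 1, zpow_one, RelIso.mul_apply]
    exact (h.lt_S_zpow_T 0 _).le

theorem T_zpow_mono (h : IsCover S T F G) {i j : ℤ} (hj : i ≤ j) (u : X) :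
    (T ^ i) u ≤ (T ^ j) u := by
  have := h.T_zpow_le (sub_nonneg.2 hj) ((T ^ i) u)
  rwa [← RelIso.mul_apply, ← zpow_add, sub_add_cancel] at this

/-- `T ^ j ∘ S ^ k ∘ F ^ n` is either below the identity everywhere or above it everywhere. -/
theorem normal_form_le (h : IsCover S T F G) (j k n : ℤ) :
    (∀ u, (T ^ j) ((S ^ k) (power F G n u)) ≤ u) ∨
      ∀ u, ¬ (T ^ j) ((S ^ k) (power F G n u)) ≤ u := by
  -- it suffices to bound `S ^ k ∘ F ^ n` between two consecutive powers of `T`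
  have key : (∃ i : ℤ, ∀ u, (T ^ i) u < (S ^ k) (power F G n u) ∧
      (S ^ k) (power F G n u) < (T ^ (i + 1)) u) → (∀ u, (T ^ j) ((S ^ k) (power F G n u)) ≤ u) ∨
      ∀ u, ¬ (T ^ j) ((S ^ k) (power F G n u)) ≤ u := by
    rintro ⟨i, hi⟩
    rcases le_or_gt (j + i + 1) 0 with hj | hj
    · refine Or.inl fun u => ((T ^ j).le_iff_le.2 (hi u).2.le).trans ?_
      rw [← RelIso.mul_apply, ← zpow_add]
      exact h.T_zpow_mono (j := 0) (by omega) u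
    · refine Or.inr fun u => not_le.2 (lt_of_le_of_lt ?_ ((T ^ j).lt_iff_lt.2 (hi u).1))
      rw [← RelIso.mul_apply, ← zpow_add]
      exact h.T_zpow_mono (i := 0) (by omega) u
  rcases n with n | n
  · rcases Nat.eq_zero_or_pos n with rfl | hn
    -- Without `F` the sign of `j` decides, and for `j = 0` the sign of `k`, because no power of `S`
    -- moves as far as `T`.
    · change (∀ u, (T ^ j) ((S ^ k) u) ≤ u) ∨ ∀ u, ¬ (T ^ j) ((S ^ k) u) ≤ u
      rcases lt_trichotomy j 0 with hj | rfl | hj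
      · refine Or.inl fun u => ((T ^ j).le_iff_le.2 (h.lt_S_zpow_T k u).le).trans ?_
        change (T ^ j * T) u ≤ u
        rw [← zpow_add_one]
        exact h.T_zpow_mono (j := 0) (by omega) u
      · rcases le_or_gt k 0 with hk | hk
        · refine Or.inl fun u => ?_
          rcases hk.eq_or_lt with rfl | hk
          · exact le_rfl
          · have := h.S_zpow_lt (neg_pos.2 hk) ((S ^ k) u)
            rw [S_zpow_zpow, neg_add_cancel] at this
            exact this.le
        · exact Or.inr fun u => not_le.2 (h.S_zpow_lt hk u)
      · refine Or.inr fun u => not_le.2 ?_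
        rw [← h.comm_T_zpow (gen_S_zpow k), lt_S_zpow_iff]
        exact (h.lt_S_zpow_T (-k) u).trans_le (h.T_zpow_mono (i := 1) hj u)
    -- Positive powers of `F` lie between `T⁻¹` and the identity, infinitely far from both, so the
    -- factor `S ^ k` is absorbed.
    · refine key ⟨-1, fun u => ⟨?_, ?_⟩⟩
      · rw [lt_S_zpow_iff, ← T.lt_iff_lt, ← h.comm_T (gen_S_zpow _), zpow_neg_one]
        exact (congrArg (⇑(S ^ (-k))) (T.apply_symm_apply u)).trans_lt (h.above n (-k) u hn)
      · rw [S_zpow_lt_iff]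
        exact h.below n (-k) u hn
  -- Through the adjunction the bounds on a power of `F` become bounds on the power of `G`, which
  -- lies between the identity and `T`.
  · refine key ⟨0, fun u => ⟨?_, ?_⟩⟩
    · change u < _
      rw [lt_S_zpow_iff, h.lt_iff, power, ← h.iterate_gc]
      have := (h.below (n + 1) (k - 1) (S ((S ^ (-k)) u)) n.succ_pos).le
      have e : (S ^ (k - 1)) (S ((S ^ (-k)) u)) = u := by
        change (S ^ (k - 1) * S * S ^ (-k)) u = u
        rw [← zpow_add_one, ← zpow_add, sub_add_cancel, add_neg_cancel]; rfl
      rwa [e] at this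
    · change _ < T u
      rw [S_zpow_lt_iff, power, ← not_le, ← h.iterate_gc, not_le, h.comm_T (gen_S_zpow _),
        h.comm_T (gen_F_iterate _)]
      have := h.above (n + 1) k ((S ^ (-k)) u) n.succ_pos
      rwa [S_zpow_zpow, add_neg_cancel] at this

/-- Away from finitely many orbits, a map in the monoid is either below the identity or above. -/
theorem eventually_le_const (h : IsCover S T F G) {a : X → X} (ha : Gen S T F G a) :
    (∀ᶠ u in orbitCofinite T, a u ≤ u) ∨ ∀ᶠ u in orbitCofinite T, ¬ a u ≤ u := by
  obtain ⟨j, k, n, H⟩ := h.exists_normal_form_comp ha (b := id)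
    ⟨0, 0, 0, Eventually.of_forall fun _ => rfl⟩
  rcases h.normal_form_le j k n with hn | hn
  · exact Or.inl (H.mono fun u hu => by rw [id] at hu; rw [hu]; exact hn u)
  · exact Or.inr (H.mono fun u hu => by rw [id] at hu; rw [hu]; exact hn u)

end IsCover

end Cover


/-! ### Unrolling a cyclic order -/

section Unroll

theorem near_succ_iff {B : Type u} {S : B ≃ B} {d z : B} (hz : z ≠ d) :
    (∃ n : ℕ, S^[n] (S z) = d) ↔ ∃ n : ℕ, S^[n] z = d := by
  constructor
  · rintro ⟨n, hn⟩
    exact ⟨n + 1, hn⟩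
  · rintro ⟨n, hn⟩
    rcases n with _ | n
    · exact absurd hn hz
    · exact ⟨n, hn⟩

theorem near_of_near_succ {B : Type u} {S : B ≃ B} {d z : B}
    (hz : ∃ n : ℕ, S^[n] (S z) = d) : ∃ n : ℕ, S^[n] z = d := by
  obtain ⟨n, hn⟩ := hz
  exact ⟨n + 1, hn⟩

variable {B : Type u} [LinearOrder B]

/-- The translation of `ℤ ×ₗ B`. -/
def translation (B : Type u) [LinearOrder B] : ℤ ×ₗ B ≃o ℤ ×ₗ B where
  toFun u := toLex ((ofLex u).1 + 1, (ofLex u).2)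
  invFun u := toLex ((ofLex u).1 - 1, (ofLex u).2)
  left_inv u := by simp
  right_inv u := by simp
  map_rel_iff' {u w} := by simp [Prod.Lex.le_iff]

/-- The bijection `φ` turns a lower set `L` and its complement into an upper set and its
complement, and is strictly monotone on both. -/
structure IsRotation (φ : B ≃ B) (L : Set B) : Prop where
  lower : IsLowerSet L
  mono : StrictMonoOn φ L
  mono_compl : StrictMonoOn φ Lᶜ
  lt : ∀ x ∈ L, ∀ y ∉ L, φ y < φ x

open Classical in
/-- The order automorphism of `ℤ ×ₗ B` induced by a rotation. -/
noncomputable def IsRotation.lift {φ : B ≃ B} {L : Set B} (h : IsRotation φ L) :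
    ℤ ×ₗ B ≃o ℤ ×ₗ B :=
  StrictMono.orderIsoOfRightInverse
    (fun u => toLex ((ofLex u).1 + if (ofLex u).2 ∈ L then 0 else 1, φ (ofLex u).2))
    (by
      intro u w huw
      rw [Prod.Lex.lt_iff] at huw ⊢
      simp only [ofLex_toLex]
      rcases huw with hlt | ⟨heq, hlt⟩
      · by_cases hu : (ofLex u).2 ∈ L <;> by_cases hw : (ofLex w).2 ∈ L <;>
          simp only [hu, hw, if_true, if_false]
        · left; omega
        · left; omega
        -- Here `u` is past the cut and gains a level while `w` does not. If `w` was only one level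
        -- higher the levels now tie, and the rotation property decides.
        · rcases (Int.add_one_le_iff.2 hlt).lt_or_eq with h1 | h1
          · left; omega
          · exact Or.inr ⟨by omega, h.lt _ hw _ hu⟩
        · left; omega
      · by_cases hu : (ofLex u).2 ∈ L <;> by_cases hw : (ofLex w).2 ∈ L <;>
          simp only [hu, hw, if_true, if_false, heq]
        · exact Or.inr ⟨trivial, h.mono hu hw hlt⟩
        · left; omega
        · exact absurd (h.lower hlt.le hw) hu
        · exact Or.inr ⟨trivial, h.mono_compl hu hw hlt⟩)
    (fun u => toLex ((ofLex u).1 - if φ.symm (ofLex u).2 ∈ L then 0 else 1, φ.symm (ofLex u).2))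
    (fun u => by by_cases hu : φ.symm (ofLex u).2 ∈ L <;> simp [hu])

open Classical in
theorem IsRotation.lift_apply {φ : B ≃ B} {L : Set B} (h : IsRotation φ L) (u : ℤ ×ₗ B) :
    h.lift u = toLex ((ofLex u).1 + if (ofLex u).2 ∈ L then 0 else 1, φ (ofLex u).2) := rfl

theorem IsRotation.lift_of_mem {φ : B ≃ B} {L : Set B} (h : IsRotation φ L) {z : B} (hz : z ∈ L)
    (i : ℤ) : h.lift (toLex (i, z)) = toLex (i, φ z) := by
  simp [h.lift_apply, hz]

theorem IsRotation.lift_of_notMem {φ : B ≃ B} {L : Set B} (h : IsRotation φ L) {z : B}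
    (hz : z ∉ L) (i : ℤ) : h.lift (toLex (i, z)) = toLex (i + 1, φ z) := by
  simp [h.lift_apply, hz]

theorem IsRotation.lift_translation {φ : B ≃ B} {L : Set B} (h : IsRotation φ L) (u : ℤ ×ₗ B) :
    h.lift (translation B u) = translation B (h.lift u) := by
  simp only [h.lift_apply]
  exact congrArg toLex (Prod.ext (add_right_comm _ _ _) rfl)

theorem translation_snd (u : ℤ ×ₗ B) : (ofLex (translation B u)).2 = (ofLex u).2 := rfl

theorem translation_toLex (i : ℤ) (z : B) :
    translation B (toLex (i, z)) = toLex (i + 1, z) := rfl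

theorem translation_zpow (j i : ℤ) (z : B) :
    (translation B ^ j) (toLex (i, z)) = toLex (i + j, z) := by
  induction j using Int.induction_on generalizing i with
  | zero => simp
  | succ j ih =>
    rw [zpow_add_one, RelIso.mul_apply, translation_toLex, ih, add_right_comm, add_assoc]
  | pred j ih =>
    rw [zpow_sub_one, RelIso.mul_apply]
    refine (ih (i - 1)).trans ?_
    congr 2
    ring

theorem exists_translation_of_snd_eq {u w : ℤ ×ₗ B} (h : (ofLex u).2 = (ofLex w).2) :
    ∃ j : ℤ, u = (translation B ^ j) w := by
  obtain ⟨⟨i, z⟩, rfl⟩ := toLex.surjective u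
  obtain ⟨⟨i', z'⟩, rfl⟩ := toLex.surjective w
  obtain rfl : z = z' := h
  exact ⟨i - i', by rw [translation_zpow]; congr 2; ring⟩

theorem translation_zpow_snd (j : ℤ) (u : ℤ ×ₗ B) :
    (ofLex ((translation B ^ j) u)).2 = (ofLex u).2 := by
  obtain ⟨⟨i, z⟩, rfl⟩ := toLex.surjective u
  rw [translation_zpow]; rfl

/-- A discrete linear order with endpoints `a` and `d`, with its cyclic successor map `S` and a
bijection `f` which rotates it backwards by an infinitely small but infinite amount. -/
structure IsSmallRotation (a d m : B) (S f : B ≃ B) : Prop where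
  bot_le : ∀ x, a ≤ x
  le_top : ∀ x, x ≤ d
  S_top : S d = a
  lt_S : ∀ x, x ≠ d → x < S x
  S_le : ∀ x y, x < y → S x ≤ y
  mono_left : StrictMonoOn f (Iic m)
  mono_right : StrictMonoOn f (Ioi m)
  right_lt_left : ∀ x ≤ m, ∀ y > m, f y < f x
  lt_left : ∀ x ≤ m, m < f x
  cyc : ∀ k n : ℕ, 0 < n → n < k → ∀ z, Cyc (f^[k] z) (f^[n] z) z
  forward : ∀ n : ℕ, 1 < n → ∀ z, {x | Cyc z x (f^[n] z)}.Infinite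
  backward : ∀ n : ℕ, 1 < n → ∀ z, {x | Cyc (f^[n] z) x z}.Infinite
  infinite : Infinite B

namespace IsSmallRotation

variable {a d m : B} {S f : B ≃ B}

theorem isRotation_S (h : IsSmallRotation a d m S f) : IsRotation S {x | x ≠ d} where
  lower := fun x y hyx hx => fun hy => hx (le_antisymm (h.le_top x) (hy ▸ hyx))
  mono := fun x _ y hy hxy => (h.S_le x y hxy).trans_lt (h.lt_S y hy)
  mono_compl := fun x hx y hy hxy => by
    simp only [mem_compl_iff, mem_ofPred_eq, not_not] at hx hy
    exact absurd hxy (by simp [hx, hy])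
  lt := fun x hx y hy => by
    simp only [mem_ofPred_eq, not_not] at hx hy
    rw [hy, h.S_top]
    exact (h.bot_le x).trans_lt (h.lt_S x hx)

theorem isRotation_f (h : IsSmallRotation a d m S f) : IsRotation f (Iic m) where
  lower := isLowerSet_Iic m
  mono := h.mono_left
  mono_compl := by simpa using h.mono_right
  lt := fun x hx y hy => h.right_lt_left x hx y (not_le.1 hy)

/-- The successor map of `ℤ ×ₗ B`. -/
noncomputable def succ (h : IsSmallRotation a d m S f) : ℤ ×ₗ B ≃o ℤ ×ₗ B := h.isRotation_S.lift

/-- The lift of `f` to `ℤ ×ₗ B` that is slightly smaller than the identity. -/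
noncomputable def liftF (h : IsSmallRotation a d m S f) : ℤ ×ₗ B ≃o ℤ ×ₗ B :=
  h.isRotation_f.lift.trans (translation B).symm

theorem succ_snd (h : IsSmallRotation a d m S f) (u : ℤ ×ₗ B) :
    (ofLex (h.succ u)).2 = S (ofLex u).2 := rfl

theorem succ_symm_snd (h : IsSmallRotation a d m S f) (u : ℤ ×ₗ B) :
    (ofLex (h.succ.symm u)).2 = S.symm (ofLex u).2 := by
  rw [Equiv.eq_symm_apply, ← h.succ_snd, OrderIso.apply_symm_apply]

theorem liftF_snd (h : IsSmallRotation a d m S f) (u : ℤ ×ₗ B) :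
    (ofLex (h.liftF u)).2 = f (ofLex u).2 := rfl

theorem succ_translation (h : IsSmallRotation a d m S f) (u : ℤ ×ₗ B) :
    h.succ (translation B u) = translation B (h.succ u) := h.isRotation_S.lift_translation u

theorem liftF_translation (h : IsSmallRotation a d m S f) (u : ℤ ×ₗ B) :
    h.liftF (translation B u) = translation B (h.liftF u) := by
  simp [liftF, h.isRotation_f.lift_translation]

theorem lt_iff_succ_le (h : IsSmallRotation a d m S f) (u w : ℤ ×ₗ B) :
    u < w ↔ h.succ u ≤ w := by
  obtain ⟨⟨i, z⟩, rfl⟩ := toLex.surjective u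
  obtain ⟨⟨i', z'⟩, rfl⟩ := toLex.surjective w
  by_cases hz : z = d
  · subst hz
    rw [succ, h.isRotation_S.lift_of_notMem (by simp), Prod.Lex.toLex_le_toLex,
      Prod.Lex.toLex_lt_toLex, h.S_top]
    have h1 := h.bot_le z'
    have h2 := not_lt.2 (h.le_top z')
    simp only [h1, h2, and_true, and_false, or_false]
    omega
  · rw [succ, h.isRotation_S.lift_of_mem hz, Prod.Lex.toLex_le_toLex, Prod.Lex.toLex_lt_toLex]
    have : z < z' ↔ S z ≤ z' := ⟨h.S_le z z', (h.lt_S z hz).trans_le⟩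
    rw [this]

theorem lt_succ_iff (h : IsSmallRotation a d m S f) (u w : ℤ ×ₗ B) :
    u < h.succ w ↔ u ≤ w := by
  rw [h.lt_iff_succ_le, OrderIso.le_iff_le]

theorem lt_succ (h : IsSmallRotation a d m S f) (u : ℤ ×ₗ B) : u < h.succ u :=
  (h.lt_succ_iff u u).2 le_rfl

/-- Order automorphisms commute with the successor map. -/
theorem succ_orderIso (h : IsSmallRotation a d m S f) (e : ℤ ×ₗ B ≃o ℤ ×ₗ B) (u : ℤ ×ₗ B) :
    e (h.succ u) = h.succ (e u) := by
  refine eq_of_forall_ge_iff fun w => ?_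
  rw [← h.lt_iff_succ_le, ← e.le_symm_apply, ← h.lt_iff_succ_le, e.lt_symm_apply]

theorem exists_iterate_eq (h : IsSmallRotation a d m S f) {n : ℕ} {u w : ℤ ×ₗ B} (h1 : u ≤ w)
    (h2 : w ≤ h.succ^[n] u) : ∃ i ≤ n, w = h.succ^[i] u := by
  induction n with
  | zero => exact ⟨0, le_rfl, le_antisymm h2 h1⟩
  | succ n ih =>
    rcases h2.eq_or_lt with h2 | h2
    · exact ⟨n + 1, le_rfl, h2⟩
    · rw [Function.iterate_succ_apply', h.lt_succ_iff] at h2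
      obtain ⟨i, hi, hw⟩ := ih h2
      exact ⟨i, hi.trans n.le_succ, hw⟩

theorem finite_Icc_iterate (h : IsSmallRotation a d m S f) (n : ℕ) (u : ℤ ×ₗ B) :
    (Icc u (h.succ^[n] u)).Finite := by
  refine ((Set.finite_Iic n).image fun i => h.succ^[i] u).subset fun w hw => ?_
  obtain ⟨i, hi, rfl⟩ := h.exists_iterate_eq hw.1 hw.2
  exact mem_image_of_mem _ hi

theorem iterate_succ_snd (h : IsSmallRotation a d m S f) (n : ℕ) (u : ℤ ×ₗ B) :
    (ofLex (h.succ^[n] u)).2 = S^[n] (ofLex u).2 := by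
  induction n generalizing u with
  | zero => rfl
  | succ n ih => rw [Function.iterate_succ_apply, ih, h.succ_snd, Function.iterate_succ_apply]

theorem iterate_liftF_snd (h : IsSmallRotation a d m S f) (n : ℕ) (u : ℤ ×ₗ B) :
    (ofLex (h.liftF^[n] u)).2 = f^[n] (ofLex u).2 := by
  induction n generalizing u with
  | zero => rfl
  | succ n ih => rw [Function.iterate_succ_apply, ih, h.liftF_snd, Function.iterate_succ_apply]

theorem le_iterate_succ (h : IsSmallRotation a d m S f) (n : ℕ) (u : ℤ ×ₗ B) :
    u ≤ h.succ^[n] u := by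
  induction n with
  | zero => exact le_rfl
  | succ n ih => 
    rw [Function.iterate_succ_apply']
    exact ih.trans (h.lt_succ _).le

/-- Otherwise the whole level `0` would lie in the finite interval from `(0, a)` to a finite
successor of it, against the infinity of `B`. Hence the modification of `f` near `d` stops at `d`
and does not continue from `a`. -/
theorem iterate_S_bot_ne (h : IsSmallRotation a d m S f) (n : ℕ) : S^[n] a ≠ d := by
  intro hn
  have h1 := h.iterate_succ_snd n (toLex (0, a))
  have h2 := h.le_iterate_succ n (toLex (0, a))
  have h3 := h.finite_Icc_iterate n (toLex (0, a))
  rw [show (ofLex (toLex ((0 : ℤ), a))).2 = a from rfl, hn] at h1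
  obtain ⟨⟨i, z⟩, hu⟩ := toLex.surjective (h.succ^[n] (toLex (0, a)))
  rw [← hu] at h1 h2 h3
  obtain rfl : z = d := h1
  have hi : 0 ≤ i := by
    rw [Prod.Lex.toLex_le_toLex] at h2
    omega
  refine h.infinite.not_finite (Set.finite_univ_iff.1 (Finite.of_finite_image (f := fun x : B =>
    (toLex ((0 : ℤ), x))) (h3.subset ?_) ?_))
  · rintro _ ⟨x, -, rfl⟩
    refine ⟨Prod.Lex.toLex_le_toLex.2 (Or.inr ⟨rfl, h.bot_le x⟩), Prod.Lex.toLex_le_toLex.2 ?_⟩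
    rcases hi.lt_or_eq with hi | hi
    · exact Or.inl hi
    · exact Or.inr ⟨hi, h.le_top x⟩
  · intro x _ y _ hxy
    exact (Prod.ext_iff.1 (toLex.injective hxy)).2

theorem liftF_of_le (h : IsSmallRotation a d m S f) {z : B} (hz : z ≤ m) (i : ℤ) :
    h.liftF (toLex (i, z)) = toLex (i - 1, f z) :=
  congrArg (translation B).symm (h.isRotation_f.lift_of_mem (Set.mem_Iic.2 hz) i)

theorem liftF_of_lt (h : IsSmallRotation a d m S f) {z : B} (hz : m < z) (i : ℤ) :
    h.liftF (toLex (i, z)) = toLex (i, f z) := by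
  refine (congrArg (translation B).symm (h.isRotation_f.lift_of_notMem (by simpa using hz) i)).trans
    ?_
  rw [← translation_toLex, OrderIso.symm_apply_apply]

theorem cyc_ne (h : IsSmallRotation a d m S f) {n : ℕ} (hn : 0 < n) (z : B) : f^[n] z ≠ z := by
  intro e
  have := h.cyc (n + 1) n hn n.lt_succ_self z
  rw [e] at this
  rcases this with ⟨h1, h2⟩ | ⟨h1, h2⟩ | ⟨h1, h2⟩
  · exact lt_irrefl _ h2
  · exact lt_irrefl _ h1
  · exact lt_asymm h1 h2

/-- If a point beyond `m` were moved up, monotonicity would move its image up again, and `z < f z <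
f (f z)` contradicts the orientation prescribed by `cyc`. -/
theorem liftF_lt (h : IsSmallRotation a d m S f) (u : ℤ ×ₗ B) : h.liftF u < u := by
  obtain ⟨⟨i, z⟩, rfl⟩ := toLex.surjective u
  rcases le_or_gt z m with hz | hz
  · rw [h.liftF_of_le hz, Prod.Lex.toLex_lt_toLex]
    left; simp
  · rw [h.liftF_of_lt hz, Prod.Lex.toLex_lt_toLex]
    refine Or.inr ⟨rfl, ?_⟩
    by_contra! hlt
    have hlt : z < f z := hlt.lt_of_ne (h.cyc_ne one_pos z).symm
    have hlt2 : f z < f (f z) := h.mono_right hz (hz.trans hlt) hlt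
    rcases h.cyc 2 1 one_pos one_lt_two z with ⟨h1, -⟩ | ⟨h1, -⟩ | ⟨-, h2⟩
    · exact lt_asymm h1 hlt2
    · exact lt_asymm h1 hlt
    · exact lt_asymm h2 hlt2

theorem translation_symm_lt_liftF (h : IsSmallRotation a d m S f) (u : ℤ ×ₗ B) :
    (translation B).symm u < h.liftF u := by
  obtain ⟨⟨i, z⟩, rfl⟩ := toLex.surjective u
  change toLex (i - 1, z) < _
  rcases le_or_gt z m with hz | hz
  · rw [h.liftF_of_le hz, Prod.Lex.toLex_lt_toLex]
    exact Or.inr ⟨rfl, hz.trans_lt (h.lt_left z hz)⟩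
  · rw [h.liftF_of_lt hz, Prod.Lex.toLex_lt_toLex]
    left; simp

/-- Within one turn the linear order of the cover projects to the cyclic order. Three patterns of
levels are possible, one for each disjunct of `Cyc`. -/
theorem cyc_of_lt {u v w : ℤ ×ₗ B} (h1 : u < v) (h2 : v < w) (h3 : w < translation B u) :
    Cyc (ofLex u).2 (ofLex v).2 (ofLex w).2 := by
  obtain ⟨⟨i, x⟩, rfl⟩ := toLex.surjective u
  obtain ⟨⟨j, y⟩, rfl⟩ := toLex.surjective v
  obtain ⟨⟨k, z⟩, rfl⟩ := toLex.surjective w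
  rw [translation_toLex] at h3
  rw [Prod.Lex.toLex_lt_toLex] at h1 h2 h3
  simp only at h1 h2 h3
  change Cyc x y z
  rcases h1 with h1 | ⟨h1, h1'⟩ <;> rcases h2 with h2 | ⟨h2, h2'⟩ <;>
    rcases h3 with h3 | ⟨h3, h3'⟩
  all_goals first | omega | skip
  · exact Or.inr (Or.inl ⟨h2', h3'⟩)
  · exact Or.inr (Or.inr ⟨h3', h1'⟩)
  · exact Or.inl ⟨h1', h2'⟩

/-- Lets infinite cyclic intervals of `B` bound distances in the cover from below. -/
theorem exists_lift_of_cyc {u w : ℤ ×ₗ B} (h1 : u < w) (h3 : w < translation B u) {y : B}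
    (h : Cyc (ofLex u).2 y (ofLex w).2) : ∃ v, u < v ∧ v < w ∧ (ofLex v).2 = y := by
  obtain ⟨⟨i, x⟩, rfl⟩ := toLex.surjective u
  obtain ⟨⟨k, z⟩, rfl⟩ := toLex.surjective w
  rw [translation_toLex] at h3
  rw [Prod.Lex.toLex_lt_toLex] at h1 h3
  simp only at h1 h3
  change Cyc x y z at h
  have hk : (k = i ∧ x < z) ∨ (k = i + 1 ∧ z < x) := by
    rcases h1 with h1 | ⟨h1, h1'⟩ <;> rcases h3 with h3 | ⟨h3, h3'⟩
    · omega
    · exact Or.inr ⟨h3, h3'⟩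
    · exact Or.inl ⟨h1.symm, h1'⟩
    · omega
  rcases hk with ⟨rfl, hxz⟩ | ⟨rfl, hxz⟩
  · refine ⟨toLex (k, y), ?_, ?_, rfl⟩ <;> rw [Prod.Lex.toLex_lt_toLex] <;>
      refine Or.inr ⟨rfl, ?_⟩ <;> rcases h with h | h | h
    all_goals first | exact h.1 | exact h.2 | exact absurd hxz (lt_asymm h.2) |
      exact absurd hxz (lt_asymm h.1)
  · rcases h with h | h | h
    · exact absurd hxz (lt_asymm (h.1.trans h.2))
    · refine ⟨toLex (i + 1, y), ?_, ?_, rfl⟩ <;> rw [Prod.Lex.toLex_lt_toLex]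
      · left; simp
      · exact Or.inr ⟨rfl, h.1⟩
    · refine ⟨toLex (i, y), ?_, ?_, rfl⟩ <;> rw [Prod.Lex.toLex_lt_toLex]
      · exact Or.inr ⟨rfl, h.2⟩
      · left; simp

/-! ### Iterates of the lift stay infinitely far from the identity and from a full turn. -/

theorem iterate_liftF_lt (h : IsSmallRotation a d m S f) {n : ℕ} (hn : 0 < n) (u : ℤ ×ₗ B) :
    h.liftF^[n] u < u := by
  induction n, hn using Nat.le_induction with
  | base => exact h.liftF_lt u
  | succ n hn ih =>
    rw [Function.iterate_succ_apply']
    exact (h.liftF_lt _).trans ih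

/-- Suppose the step from `n` to `n + 1` completed a turn. Then, with `F` the lift and `T` the
translation, `F^[n] u < T (F^[n + 1] u) < u < T (F^[n] u)`, whose projection has the orientation
opposite to `cyc`. -/
theorem lt_translation_iterate_liftF (h : IsSmallRotation a d m S f) {n : ℕ} (hn : 0 < n)
    (u : ℤ ×ₗ B) : u < translation B (h.liftF^[n] u) := by
  induction n, hn using Nat.le_induction with
  | base => rw [← OrderIso.symm_apply_lt]; exact h.translation_symm_lt_liftF u
  | succ n hn ih =>
    by_contra! hle
    have hlt : translation B (h.liftF^[n + 1] u) < u := hle.lt_of_ne fun e => by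
      have := congrArg (fun u => (ofLex u).2) e
      simp only [translation_snd, h.iterate_liftF_snd] at this
      exact h.cyc_ne n.succ_pos _ this
    have h1 : h.liftF^[n] u < translation B (h.liftF^[n + 1] u) := by
      rw [Function.iterate_succ_apply', ← OrderIso.symm_apply_lt]
      exact h.translation_symm_lt_liftF _
    have h2 := cyc_of_lt h1 hlt ih
    simp only [translation_snd, h.iterate_liftF_snd] at h2
    rcases h.cyc (n + 1) n hn n.lt_succ_self (ofLex u).2 with h3 | h3 | h3 <;>
      rcases h2 with h2 | h2 | h2
    all_goals first
      | exact lt_asymm h3.1 h2.1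
      | exact lt_asymm h3.1 h2.2
      | exact lt_asymm h3.2 h2.1
      | exact lt_asymm h3.2 h2.2

theorem commute_liftF_succ (h : IsSmallRotation a d m S f) : Commute h.liftF h.succ :=
  RelIso.ext fun u => h.succ_orderIso h.liftF u

theorem commute_translation_succ (h : IsSmallRotation a d m S f) :
    Commute (translation B) h.succ :=
  RelIso.ext fun u => (h.succ_translation u).symm

theorem succ_zpow_natCast (h : IsSmallRotation a d m S f) (n : ℕ) (u : ℤ ×ₗ B) :
    (h.succ ^ (n : ℤ)) u = h.succ^[n] u := by
  induction n generalizing u with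
  | zero => rfl
  | succ n ih =>
    rw [Nat.cast_succ, zpow_add_one, RelIso.mul_apply, ih, Function.iterate_succ_apply]

theorem finite_Icc_zpow_self (h : IsSmallRotation a d m S f) (k : ℤ) (u : ℤ ×ₗ B) :
    (Icc ((h.succ ^ k) u) u).Finite := by
  refine (h.finite_Icc_iterate k.natAbs ((h.succ ^ k) u)).subset (Icc_subset_Icc_right ?_)
  obtain ⟨n, rfl | rfl⟩ := k.eq_nat_or_neg
  · rw [h.succ_zpow_natCast]
    exact (h.le_iterate_succ _ _).trans (h.le_iterate_succ _ _)
  · rw [Int.natAbs_neg, Int.natAbs_natCast, ← h.succ_zpow_natCast, ← RelIso.mul_apply, ← zpow_add,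
      add_neg_cancel]
    rfl

theorem finite_Icc_self_zpow (h : IsSmallRotation a d m S f) (k : ℤ) (u : ℤ ×ₗ B) :
    (Icc u ((h.succ ^ k) u)).Finite := by
  have := h.finite_Icc_zpow_self (-k) ((h.succ ^ k) u)
  rwa [← RelIso.mul_apply, ← zpow_add, neg_add_cancel] at this

theorem iterate_liftF_lt_zpow (h : IsSmallRotation a d m S f) {n : ℕ} (hn : 0 < n) (k : ℤ)
    (u : ℤ ×ₗ B) : h.liftF^[n] u < (h.succ ^ k) u := by
  have key : ∀ n : ℕ, 1 < n → ∀ k : ℤ, h.liftF^[n] u < (h.succ ^ k) u := by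
    intro n hn k
    by_contra! hle
    -- Otherwise the infinite cyclic interval from `f^[n] z` to `z` would lie in the projection of a
    -- finite interval of the cover.
    refine h.backward n hn (ofLex u).2 (((h.finite_Icc_zpow_self k u).image
      fun u => (ofLex u).2).subset fun x hx => ?_)
    rw [mem_ofPred_eq, ← h.iterate_liftF_snd] at hx
    obtain ⟨v, h1, h2, h3⟩ := exists_lift_of_cyc (h.iterate_liftF_lt (by omega) u)
      (h.lt_translation_iterate_liftF (by omega) u) hx
    exact ⟨v, ⟨hle.trans h1.le, h2.le⟩, h3⟩
  rcases (Nat.succ_le_iff.2 hn).eq_or_lt with rfl | hn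
  -- The infinity axioms start at exponent `2`. For exponent `1`, a bound by `S ^ k` from below,
  -- applied twice, gives a bound by `S ^ (2 * k)` for the second iterate.
  · by_contra! hle
    refine (key 2 one_lt_two (k + k)).not_ge ?_
    change _ ≤ h.liftF (h.liftF u)
    refine le_trans ?_ (h.liftF.monotone hle)
    rw [← RelIso.mul_apply h.liftF, (h.commute_liftF_succ.zpow_right k).eq, zpow_add,
      RelIso.mul_apply, RelIso.mul_apply]
    exact (h.succ ^ k).monotone hle
  · exact key n hn k

theorem zpow_lt_translation_iterate_liftF (h : IsSmallRotation a d m S f) {n : ℕ} (hn : 0 < n)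
    (k : ℤ) (u : ℤ ×ₗ B) : (h.succ ^ k) u < translation B (h.liftF^[n] u) := by
  have key : ∀ n : ℕ, 1 < n → (h.succ ^ k) u < translation B (h.liftF^[n] u) := by
    intro n hn
    by_contra! hle
    refine h.forward n hn (ofLex u).2 (((h.finite_Icc_self_zpow k u).image
      fun u => (ofLex u).2).subset fun x hx => ?_)
    rw [mem_ofPred_eq, ← h.iterate_liftF_snd, ← translation_snd] at hx
    obtain ⟨v, h1, h2, h3⟩ := exists_lift_of_cyc (h.lt_translation_iterate_liftF (by omega) u)
      ((translation B).lt_iff_lt.2 (h.iterate_liftF_lt (by omega) u)) hx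
    exact ⟨v, ⟨h1.le, h2.le.trans hle⟩, h3⟩
  rcases (Nat.succ_le_iff.2 hn).eq_or_lt with rfl | hn
  · exact (key 2 one_lt_two).trans ((translation B).lt_iff_lt.2 (h.liftF_lt _))
  · exact key n hn

/-! ### The shifted rotation -/

open Classical in
/-- The lift of the map obtained by shifting `f` back by one finitely many steps before `d`. -/
noncomputable def shiftedF (h : IsSmallRotation a d m S f) (u : ℤ ×ₗ B) : ℤ ×ₗ B :=
  if ∃ n : ℕ, S^[n] (ofLex u).2 = d then h.succ.symm (h.liftF u) else h.liftF u

theorem shiftedF_of_near (h : IsSmallRotation a d m S f) {u : ℤ ×ₗ B}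
    (hu : ∃ n : ℕ, S^[n] (ofLex u).2 = d) : h.shiftedF u = h.succ.symm (h.liftF u) := if_pos hu

theorem shiftedF_of_not_near (h : IsSmallRotation a d m S f) {u : ℤ ×ₗ B}
    (hu : ¬ ∃ n : ℕ, S^[n] (ofLex u).2 = d) : h.shiftedF u = h.liftF u := if_neg hu

theorem not_near_succ_top (h : IsSmallRotation a d m S f) : ¬ ∃ n : ℕ, S^[n] (S d) = d := by
  rintro ⟨n, hn⟩
  rw [h.S_top] at hn
  exact h.iterate_S_bot_ne n hn

theorem shiftedF_le (h : IsSmallRotation a d m S f) (u : ℤ ×ₗ B) : h.shiftedF u ≤ h.liftF u := by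
  by_cases hu : ∃ n : ℕ, S^[n] (ofLex u).2 = d
  · rw [h.shiftedF_of_near hu, OrderIso.symm_apply_le]
    exact (h.lt_succ _).le
  · rw [h.shiftedF_of_not_near hu]

theorem le_shiftedF (h : IsSmallRotation a d m S f) (u : ℤ ×ₗ B) :
    h.succ.symm (h.liftF u) ≤ h.shiftedF u := by
  by_cases hu : ∃ n : ℕ, S^[n] (ofLex u).2 = d
  · rw [h.shiftedF_of_near hu]
  · rw [h.shiftedF_of_not_near hu, OrderIso.symm_apply_le]
    exact (h.lt_succ _).le

/-- The map differs from an automorphism by at most one step down, so the critical case is an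
unshifted `u` below a shifted `w`. The predecessor of a shifted point is shifted, so `w` is not the
successor of `u`, and the gap of at least two steps survives. -/
theorem shiftedF_strictMono (h : IsSmallRotation a d m S f) : StrictMono h.shiftedF := by
  intro u w huw
  by_cases hu : ∃ n : ℕ, S^[n] (ofLex u).2 = d
  · rw [h.shiftedF_of_near hu]
    refine lt_of_lt_of_le ?_ (h.le_shiftedF w)
    exact h.succ.symm.strictMono (h.liftF.strictMono huw)
  · rw [h.shiftedF_of_not_near hu]
    by_cases hw : ∃ n : ℕ, S^[n] (ofLex w).2 = d
    · rw [h.shiftedF_of_near hw, h.lt_iff_succ_le, OrderIso.le_symm_apply, ← h.lt_iff_succ_le,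
        ← h.succ_orderIso, h.liftF.lt_iff_lt]
      refine ((h.lt_iff_succ_le _ _).1 huw).lt_of_ne ?_
      rintro rfl
      rw [h.succ_snd] at hw
      exact hu (near_of_near_succ hw)
    · rw [h.shiftedF_of_not_near hw]
      exact h.liftF.strictMono huw

theorem shiftedF_translation (h : IsSmallRotation a d m S f) (u : ℤ ×ₗ B) :
    h.shiftedF (translation B u) = translation B (h.shiftedF u) := by
  by_cases hu : ∃ n : ℕ, S^[n] (ofLex u).2 = d
  · rw [h.shiftedF_of_near hu, h.shiftedF_of_near (by rwa [translation_snd]), h.liftF_translation,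
      OrderIso.symm_apply_eq, h.succ_translation, OrderIso.apply_symm_apply]
  · rw [h.shiftedF_of_not_near hu, h.shiftedF_of_not_near (by rwa [translation_snd]),
      h.liftF_translation]

theorem shiftedF_succ (h : IsSmallRotation a d m S f) {u : ℤ ×ₗ B} (hu : (ofLex u).2 ≠ d) :
    h.shiftedF (h.succ u) = h.succ (h.shiftedF u) := by
  by_cases hu' : ∃ n : ℕ, S^[n] (ofLex u).2 = d
  · rw [h.shiftedF_of_near hu', h.shiftedF_of_near (by rwa [h.succ_snd, near_succ_iff hu]),
      h.succ_orderIso, OrderIso.apply_symm_apply, OrderIso.symm_apply_apply]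
  · rw [h.shiftedF_of_not_near hu', h.shiftedF_of_not_near (by rwa [h.succ_snd, near_succ_iff hu]),
      h.succ_orderIso]

theorem shiftedF_succ_of_top (h : IsSmallRotation a d m S f) {u : ℤ ×ₗ B} (hu : (ofLex u).2 = d) :
    h.shiftedF (h.succ u) = h.liftF (h.succ u) :=
  h.shiftedF_of_not_near (by rw [h.succ_snd, hu]; exact h.not_near_succ_top)

/-- Near `d`, the old value at a point is taken over by its successor, so only the values at points
over `d` are lost. -/
theorem mem_range_shiftedF (h : IsSmallRotation a d m S f) {v : ℤ ×ₗ B} (hv : (ofLex v).2 ≠ d) :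
    ∃ u, h.shiftedF u = h.liftF v := by
  by_cases hv' : ∃ n : ℕ, S^[n] (ofLex v).2 = d
  · refine ⟨h.succ v, ?_⟩
    rw [h.shiftedF_of_near (by rwa [h.succ_snd, near_succ_iff hv]), h.succ_orderIso,
      OrderIso.symm_apply_apply]
  · exact ⟨v, h.shiftedF_of_not_near hv'⟩

/-- The skipped value: `shiftedF` jumps over `liftF v` between `v` and its successor, so an upper
adjoint exists there too. -/
theorem shiftedF_le_liftF_iff_of_top (h : IsSmallRotation a d m S f) {v : ℤ ×ₗ B}
    (hv : (ofLex v).2 = d) (u : ℤ ×ₗ B) : h.shiftedF u ≤ h.liftF v ↔ u ≤ v := by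
  constructor
  · intro hle
    by_contra! hlt
    have := h.shiftedF_strictMono.monotone ((h.lt_iff_succ_le _ _).1 hlt)
    rw [h.shiftedF_succ_of_top hv, h.succ_orderIso] at this
    exact (h.lt_succ _).not_ge (this.trans hle)
  · intro huv
    exact (h.shiftedF_strictMono.monotone huv).trans (h.shiftedF_le v)

theorem exists_upper_adjoint (h : IsSmallRotation a d m S f) (w : ℤ ×ₗ B) :
    ∃ v, ∀ u, h.shiftedF u ≤ w ↔ u ≤ v := by
  obtain ⟨v, rfl⟩ := h.liftF.surjective w
  by_cases hv : (ofLex v).2 = d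
  · exact ⟨v, h.shiftedF_le_liftF_iff_of_top hv⟩
  · obtain ⟨u', hu'⟩ := h.mem_range_shiftedF hv
    exact ⟨u', fun u => by rw [← hu', h.shiftedF_strictMono.le_iff_le]⟩

/-- The upper adjoint of the shifted map. -/
noncomputable def shiftedG (h : IsSmallRotation a d m S f) (w : ℤ ×ₗ B) : ℤ ×ₗ B :=
  (h.exists_upper_adjoint w).choose

theorem shiftedF_gc (h : IsSmallRotation a d m S f) : GaloisConnection h.shiftedF h.shiftedG :=
  fun u w => (h.exists_upper_adjoint w).choose_spec u

theorem iterate_shiftedF_le (h : IsSmallRotation a d m S f) (n : ℕ) (u : ℤ ×ₗ B) :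
    h.shiftedF^[n] u ≤ h.liftF^[n] u := by
  induction n with
  | zero => exact le_rfl
  | succ n ih =>
    rw [Function.iterate_succ_apply', Function.iterate_succ_apply']
    exact (h.shiftedF_le _).trans (h.liftF.monotone ih)

theorem le_iterate_shiftedF (h : IsSmallRotation a d m S f) (n : ℕ) (u : ℤ ×ₗ B) :
    (h.succ ^ (-n : ℤ)) (h.liftF^[n] u) ≤ h.shiftedF^[n] u := by
  induction n with
  | zero => exact le_rfl
  | succ n ih =>
    rw [Function.iterate_succ_apply', Function.iterate_succ_apply']
    refine le_trans ?_ (h.le_shiftedF _)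
    have := h.succ.symm.monotone (h.liftF.monotone ih)
    rw [← RelIso.mul_apply h.liftF, (h.commute_liftF_succ.zpow_right _).eq, RelIso.mul_apply]
      at this
    refine le_trans (le_of_eq ?_) this
    rw [Nat.cast_succ, neg_add_rev, zpow_add, zpow_neg_one, RelIso.mul_apply]
    rfl

theorem isCover (h : IsSmallRotation a d m S f) :
    IsCover h.succ (translation B) h.shiftedF h.shiftedG where
  lt_iff := h.lt_iff_succ_le
  S_T := h.succ_translation
  F_T := h.shiftedF_translation
  gc := h.shiftedF_gc
  strictMono := h.shiftedF_strictMono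
  F_S := by
    refine ⟨toLex (0, d), fun u hu => h.shiftedF_succ fun hd => ?_⟩
    obtain ⟨j, hj⟩ := exists_translation_of_snd_eq (u := u) (w := toLex (0, d)) hd
    exact hu j hj
  F_G := by
    refine ⟨h.liftF (toLex (0, d)), fun u hu => ?_⟩
    obtain ⟨v, rfl⟩ := h.liftF.surjective u
    have hv : (ofLex v).2 ≠ d := fun hd => by
      obtain ⟨j, hj⟩ := exists_translation_of_snd_eq (u := h.liftF v)
        (w := h.liftF (toLex (0, d))) (by rw [h.liftF_snd, hd, h.liftF_snd]; rfl)
      exact hu j hj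
    obtain ⟨u', hu'⟩ := h.mem_range_shiftedF hv
    rw [← hu', h.shiftedF_gc.l_u_l_eq_l]
  below := fun n k u hn => (h.iterate_shiftedF_le n u).trans_lt (h.iterate_liftF_lt_zpow hn k u)
  -- In `n` iterations the shifts cost at most `n` successor steps, which the infinite gap absorbs.
  above := fun n k u hn => by
    refine lt_of_lt_of_le ?_ ((translation B).monotone (h.le_iterate_shiftedF n u))
    rw [← RelIso.mul_apply (translation B), (h.commute_translation_succ.zpow_right _).eq,
      RelIso.mul_apply, ← (h.succ ^ (n : ℤ)).lt_iff_lt, ← RelIso.mul_apply, ← RelIso.mul_apply,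
      ← zpow_add, ← zpow_add, add_neg_cancel]
    exact h.zpow_lt_translation_iterate_liftF hn _ u

end IsSmallRotation

end Unroll


/-! ### Elimination of quantifiers in a dense linear order with a discrete closed subset -/

section Ladder

variable {M : Type u} [LinearOrder M] {Z : Set M}

/-- `pr x` is the least element of `Z` above `x`, and `a` if there is none. -/
structure IsProjection (a d : Z) (pr : M → Z) : Prop where
  pr_coe : ∀ z : Z, pr z = z
  le_pr : ∀ x ≤ d.1, x ≤ pr x
  pr_le : ∀ (x : M) (z : Z), x ≤ z → pr x ≤ z
  pr_of_gt : ∀ x > d.1, pr x = a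

/-- The least element of `ℤ ×ₗ Z` above `(0, x)`. -/
noncomputable def up (a d : Z) (pr : M → Z) (x : M) : ℤ ×ₗ Z :=
  if x ≤ d then toLex (0, pr x) else toLex (1, a)

/-- The basic unary conditions. -/
def unarySets (Z : Set M) : Set (Set M) := {A | A = Z ∨ (∃ m, A = Ici m) ∨ ∃ m, A = Ioi m}

/-- The basic binary relations. -/
def binaryRels (a d : Z) (pr : M → Z) (S T : ℤ ×ₗ Z ≃o ℤ ×ₗ Z) (F G : ℤ ×ₗ Z → ℤ ×ₗ Z) :
    Set (M → M → Prop) :=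
  {r | r = (· < ·) ∨ r = (· ≤ ·) ∨ ∃ h, Gen S T F G h ∧
    r = fun x y => h (up a d pr x) ≤ up a d pr y}

/-- A map which is given by maps in the monoid on a tame set and on its complement. -/
def IsThreshold (a d : Z) (pr : M → Z) (S T : ℤ ×ₗ Z ≃o ℤ ×ₗ Z) (F G : ℤ ×ₗ Z → ℤ ×ₗ Z)
    (τ : M → ℤ ×ₗ Z) : Prop :=
  ∃ D, UnaryTame (unarySets Z) D ∧ ∃ h h', Gen S T F G h ∧ Gen S T F G h' ∧
    ∀ x, (x ∈ D → τ x = h (up a d pr x)) ∧ (x ∉ D → τ x = h' (up a d pr x))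

variable {a d m : Z} {pr : M → Z} {S f : Z ≃ Z}

namespace IsProjection

theorem up_coe (hp : IsProjection a d pr) (h : IsSmallRotation a d m S f) (z : Z) :
    up a d pr z = toLex (0, z) := by
  rw [up, if_pos (Subtype.coe_le_coe.2 (h.le_top z)), hp.pr_coe]

theorem up_of_gt (x : M) (hx : d.1 < x) : up a d pr x = toLex (1, a) := by
  rw [up, if_neg hx.not_ge]

theorem snd_up (hp : IsProjection a d pr) (x : M) : (ofLex (up a d pr x)).2 = pr x := by
  rw [up]
  split_ifs with hx
  · rfl
  · exact (hp.pr_of_gt x (not_le.1 hx)).symm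

theorem up_le_coe_iff (hp : IsProjection a d pr) (h : IsSmallRotation a d m S f) (x : M) (z : Z) :
    up a d pr x ≤ toLex (0, z) ↔ x ≤ z := by
  rw [up]
  split_ifs with hx
  · rw [Prod.Lex.toLex_le_toLex]
    simp only [lt_irrefl, false_or, true_and]
    exact ⟨fun hz => (hp.le_pr x hx).trans hz, hp.pr_le x z⟩
  · rw [Prod.Lex.toLex_le_toLex]
    simp only [one_ne_zero, false_and, or_false, not_lt_of_ge zero_le_one, false_iff]
    exact fun hxz => hx (hxz.trans (h.le_top z))

theorem bot_le_up (h : IsSmallRotation a d m S f) (x : M) : toLex (0, a) ≤ up a d pr x := by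
  rw [up]
  split_ifs with hx <;> rw [Prod.Lex.toLex_le_toLex]
  · exact Or.inr ⟨rfl, h.bot_le _⟩
  · exact Or.inl one_pos

theorem up_le_top (x : M) : up a d pr x ≤ toLex (1, a) := by
  rw [up]
  split_ifs with hx
  · rw [Prod.Lex.toLex_le_toLex]
    exact Or.inl one_pos
  · exact le_rfl

theorem monotone_up (hp : IsProjection a d pr) (h : IsSmallRotation a d m S f) :
    Monotone (up a d pr) := by
  intro x y hxy
  by_cases hy : y ≤ d
  · rw [up.eq_1 a d pr y, if_pos hy, hp.up_le_coe_iff h]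
    exact hxy.trans (hp.le_pr y hy)
  · rw [up.eq_1 a d pr y, if_neg hy]
    exact up_le_top x

/-- The elements of `ℤ ×ₗ Z` in a fundamental domain. -/
theorem exists_eq_coe (h : IsSmallRotation a d m S f) {w : ℤ ×ₗ Z} (h1 : toLex (0, a) ≤ w)
    (h2 : w < toLex (1, a)) : ∃ z, w = toLex (0, z) := by
  obtain ⟨⟨i, z⟩, rfl⟩ := toLex.surjective w
  rw [Prod.Lex.toLex_le_toLex] at h1
  rw [Prod.Lex.toLex_lt_toLex] at h2
  have := (h.bot_le z).not_gt
  simp only [this, and_false, or_false] at h1 h2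
  obtain rfl : i = 0 := by omega
  exact ⟨z, rfl⟩

/-- `up` takes values only from `(0, a)` to `(1, a)`. Thresholds outside this range are trivial, and
those inside it cut the line at a point of `Z`. -/
theorem unaryTame_up_le (hp : IsProjection a d pr) (h : IsSmallRotation a d m S f) (w : ℤ ×ₗ Z) :
    UnaryTame (unarySets Z) {x | up a d pr x ≤ w} := by
  rcases lt_or_ge w (toLex (0, a)) with h1 | h1
  · convert! unaryTame_const False using 3 with x
    exact iff_false_intro (h1.trans_le (bot_le_up h x)).not_ge
  · rcases lt_or_ge w (toLex (1, a)) with h2 | h2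
    · obtain ⟨z, rfl⟩ := exists_eq_coe h h1 h2
      simp only [hp.up_le_coe_iff h]
      convert! (unaryTame_of_mem (U := unarySets Z) (A := Ioi z.1) (Or.inr (Or.inr ⟨_, rfl⟩))).compl
        using 1
      ext x; simp
    · convert! unaryTame_const True using 3 with x
      exact iff_true_intro ((up_le_top x).trans h2)

theorem unaryTame_up_lt (hp : IsProjection a d pr) (h : IsSmallRotation a d m S f) (w : ℤ ×ₗ Z) :
    UnaryTame (unarySets Z) {x | up a d pr x < w} := by
  simp only [← h.isCover.le_S_symm_iff]
  exact hp.unaryTame_up_le h _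

theorem unaryTame_le_up (hp : IsProjection a d pr) (h : IsSmallRotation a d m S f) (w : ℤ ×ₗ Z) :
    UnaryTame (unarySets Z) {x | w ≤ up a d pr x} := by
  simp only [← not_lt]
  exact (hp.unaryTame_up_lt h w).compl

theorem unaryTame_gen_le (hp : IsProjection a d pr) (h : IsSmallRotation a d m S f)
    {b : ℤ ×ₗ Z → ℤ ×ₗ Z} (hb : Gen h.succ (translation Z) h.shiftedF h.shiftedG b) (w : ℤ ×ₗ Z) :
    UnaryTame (unarySets Z) {x | b (up a d pr x) ≤ w} := by
  obtain ⟨c, -, hc⟩ := h.isCover.exists_adjoint hb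
  simp only [hc.le_iff_le]
  exact hp.unaryTame_up_le h _

theorem unaryTame_up_eq (hp : IsProjection a d pr) (h : IsSmallRotation a d m S f) (w : ℤ ×ₗ Z) :
    UnaryTame (unarySets Z) {x | up a d pr x = w} := by
  convert! (hp.unaryTame_up_le h w).inter (hp.unaryTame_le_up h w) using 1
  ext x
  exact le_antisymm_iff

/-- By `eventually_le_const` the truth value is constant off finitely many orbits of the
translation. As `up` meets an orbit only at the levels `0` and `1`, it has finitely many exceptional
values, and each of them is taken on a tame set. -/
theorem unaryTame_gen_diag (hp : IsProjection a d pr) (h : IsSmallRotation a d m S f)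
    {b : ℤ ×ₗ Z → ℤ ×ₗ Z} (hb : Gen h.succ (translation Z) h.shiftedF h.shiftedG b) :
    UnaryTame (unarySets Z) {x | b (up a d pr x) ≤ up a d pr x} := by
  obtain ⟨p, hp'⟩ : ∃ p : Prop, ∀ᶠ w in orbitCofinite (translation Z), (b w ≤ w ↔ p) := by
    rcases h.isCover.eventually_le_const hb with H | H
    · exact ⟨True, H.mono fun _ hw => iff_true_intro hw⟩
    · exact ⟨False, H.mono fun _ hw => iff_false_intro hw⟩
  obtain ⟨E, hE, H⟩ := eventually_orbitCofinite.1 hp'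
  let E' : Set (ℤ ×ₗ Z) := toLex '' (({0, 1} : Set ℤ) ×ˢ ((fun u => (ofLex u).2) '' E))
  have hE' : E'.Finite := (Set.Finite.prod (by simp) (hE.image _)).image _
  have key : ∀ x, up a d pr x ∉ E' → (b (up a d pr x) ≤ up a d pr x ↔ p) := by
    intro x hx
    by_contra hxp
    obtain ⟨e, he, j, hj⟩ := H _ hxp
    refine hx ⟨ofLex (up a d pr x), ⟨?_, ⟨e, he, ?_⟩⟩, rfl⟩
    · rw [up]; split_ifs <;> simp
    · simp only [hj, translation_zpow_snd]
  refine UnaryTame.of_forall (C := (fun w => {x | up a d pr x = w}) '' E') (hE'.image _) ?_ ?_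
  · rintro _ ⟨w, -, rfl⟩
    exact hp.unaryTame_up_eq h w
  · intro x y hxy
    have hxy' : ∀ w ∈ E', up a d pr x = w ↔ up a d pr y = w := fun w hw =>
      hxy _ (mem_image_of_mem _ hw)
    by_cases hx : up a d pr x ∈ E'
    · simp only [mem_ofPred_eq, (hxy' _ hx).1 rfl]
    · have hy : up a d pr y ∉ E' := fun hy => hx ((hxy' _ hy).2 rfl ▸ hy)
      exact (key x hx).trans (key y hy).symm

theorem specializationTame (hp : IsProjection a d pr) (h : IsSmallRotation a d m S f) :
    SpecializationTame (unarySets Z)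
      (binaryRels a d pr h.succ (translation Z) h.shiftedF h.shiftedG) where
  left := by
    rintro _ (rfl | rfl | ⟨b, hb, rfl⟩) x
    · exact unaryTame_of_mem (Or.inr (Or.inr ⟨x, rfl⟩))
    · exact unaryTame_of_mem (Or.inr (Or.inl ⟨x, rfl⟩))
    · exact hp.unaryTame_le_up h _
  right := by
    rintro _ (rfl | rfl | ⟨b, hb, rfl⟩) x
    · simp only [← not_le]
      exact UnaryTame.compl (unaryTame_of_mem (Or.inr (Or.inl ⟨x, rfl⟩)))
    · simp only [← not_lt]
      exact UnaryTame.compl (unaryTame_of_mem (Or.inr (Or.inr ⟨x, rfl⟩)))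
    · exact hp.unaryTame_gen_le h hb _
  diag := by
    rintro _ (rfl | rfl | ⟨b, hb, rfl⟩)
    · simp only [lt_irrefl]
      exact unaryTame_const _
    · simp only [le_refl]
      exact unaryTame_const _
    · exact hp.unaryTame_gen_diag h hb

/-- With `c'` the upper adjoint of `c`, `b u < c w` says `c' (b u) < w`, hence `S (c' (b u)) ≤ w`.
The two words merge into a single one on the left. -/
theorem tameRel_gen_lt (h : IsSmallRotation a d m S f) {b c : ℤ ×ₗ Z → ℤ ×ₗ Z}
    (hb : Gen h.succ (translation Z) h.shiftedF h.shiftedG b)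
    (hc : Gen h.succ (translation Z) h.shiftedF h.shiftedG c) :
    TameRel (unarySets Z) (binaryRels a d pr h.succ (translation Z) h.shiftedF h.shiftedG)
      fun x y => b (up a d pr x) < c (up a d pr y) := by
  obtain ⟨c', hc', hcc'⟩ := h.isCover.exists_adjoint hc
  simp only [← not_le, hcc'.le_iff_le]
  simp only [not_le, h.isCover.lt_iff]
  exact TameRel.of_mem (Or.inr (Or.inr ⟨_, .comp .S (.comp hc' hb), rfl⟩))

theorem tame_mem {ι : Type v} {R : Set (M → M → Prop)} (i : ι) :
    Tame (unarySets Z) R {v | v i ∈ Z} :=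
  (unaryTame_of_mem (U := unarySets Z) (Or.inl rfl)).tame i

theorem tame_notMem {ι : Type v} {R : Set (M → M → Prop)} (i : ι) :
    Tame (unarySets Z) R {v | v i ∉ Z} :=
  (tame_mem i).compl

theorem isThreshold_gen {b : ℤ ×ₗ Z → ℤ ×ₗ Z} {S T : ℤ ×ₗ Z ≃o ℤ ×ₗ Z} {F G : ℤ ×ₗ Z → ℤ ×ₗ Z}
    (hb : Gen S T F G b) : IsThreshold a d pr S T F G fun x => b (up a d pr x) :=
  ⟨univ, unaryTame_const True, b, b, hb, hb, fun _ => ⟨fun _ => rfl, fun _ => rfl⟩⟩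

open Classical in
theorem isThreshold_ite {S T : ℤ ×ₗ Z ≃o ℤ ×ₗ Z} {F G : ℤ ×ₗ Z → ℤ ×ₗ Z} :
    IsThreshold a d pr S T F G fun x => if x ∈ Z then S (up a d pr x) else up a d pr x :=
  ⟨Z, unaryTame_of_mem (Or.inl rfl), S, id, .S, .id, fun _ => ⟨fun hx => if_pos hx, fun hx => if_neg hx⟩⟩

theorem tameRel_threshold_lt (h : IsSmallRotation a d m S f) {τ τ' : M → ℤ ×ₗ Z}
    (hτ : IsThreshold a d pr h.succ (translation Z) h.shiftedF h.shiftedG τ)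
    (hτ' : IsThreshold a d pr h.succ (translation Z) h.shiftedF h.shiftedG τ') :
    TameRel (unarySets Z) (binaryRels a d pr h.succ (translation Z) h.shiftedF h.shiftedG)
      fun x y => τ x < τ' y := by
  obtain ⟨D, hD, b, b', hb, hb', H⟩ := hτ
  obtain ⟨D', hD', c, c', hc, hc', H'⟩ := hτ'
  have e : ∀ x y, τ x < τ' y ↔
      ((x ∈ D ∧ y ∈ D') ∧ b (up a d pr x) < c (up a d pr y)) ∨
      ((x ∈ D ∧ y ∉ D') ∧ b (up a d pr x) < c' (up a d pr y)) ∨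
      ((x ∉ D ∧ y ∈ D') ∧ b' (up a d pr x) < c (up a d pr y)) ∨
      ((x ∉ D ∧ y ∉ D') ∧ b' (up a d pr x) < c' (up a d pr y)) := by
    intro x y
    by_cases hx : x ∈ D <;> by_cases hy : y ∈ D' <;> simp [H x, H' y, hx, hy]
  simp only [e]
  exact (((hD.tame 0).and (hD'.tame 1)).and (tameRel_gen_lt h hb hc)).or
    ((((hD.tame 0).and (hD'.compl.tame 1)).and (tameRel_gen_lt h hb hc')).or
    ((((hD.compl.tame 0).and (hD'.tame 1)).and (tameRel_gen_lt h hb' hc)).or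
    (((hD.compl.tame 0).and (hD'.compl.tame 1)).and (tameRel_gen_lt h hb' hc'))))

theorem _root_.PigeonholeFailure.IsThreshold.comp_S {S T : ℤ ×ₗ Z ≃o ℤ ×ₗ Z} {F G : ℤ ×ₗ Z → ℤ ×ₗ Z} {τ : M → ℤ ×ₗ Z}
    (hτ : IsThreshold a d pr S T F G τ) : IsThreshold a d pr S T F G fun x => S (τ x) := by
  obtain ⟨D, hD, b, b', hb, hb', H⟩ := hτ
  exact ⟨D, hD, _, _, .comp .S hb, .comp .S hb', fun x =>
    ⟨fun hx => congrArg S ((H x).1 hx), fun hx => congrArg S ((H x).2 hx)⟩⟩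

theorem tameRel_threshold_le (h : IsSmallRotation a d m S f) {τ τ' : M → ℤ ×ₗ Z}
    (hτ : IsThreshold a d pr h.succ (translation Z) h.shiftedF h.shiftedG τ)
    (hτ' : IsThreshold a d pr h.succ (translation Z) h.shiftedF h.shiftedG τ') :
    TameRel (unarySets Z) (binaryRels a d pr h.succ (translation Z) h.shiftedF h.shiftedG)
      fun x y => τ x ≤ τ' y := by
  simp only [← h.lt_succ_iff]
  exact tameRel_threshold_lt h hτ hτ'.comp_S

theorem tame_threshold_le (hp : IsProjection a d pr) (h : IsSmallRotation a d m S f)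
    {τ : M → ℤ ×ₗ Z} {R : Set (M → M → Prop)}
    (hτ : IsThreshold a d pr h.succ (translation Z) h.shiftedF h.shiftedG τ)
    (w : ℤ ×ₗ Z) {ι : Type v} (i : ι) : Tame (unarySets Z) R {v : ι → M | τ (v i) ≤ w} := by
  obtain ⟨D, hD, b, b', hb, hb', H⟩ := hτ
  have e : ∀ x, τ x ≤ w ↔ (x ∈ D ∧ b (up a d pr x) ≤ w) ∨ (x ∉ D ∧ b' (up a d pr x) ≤ w) := by
    intro x
    by_cases hx : x ∈ D <;> simp [H x, hx]
  simp only [e]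
  exact ((hD.tame i).and ((hp.unaryTame_gen_le h hb w).tame i)).or
    ((hD.compl.tame i).and ((hp.unaryTame_gen_le h hb' w).tame i))

/-! ### Density of the complement of `Z` -/

/-- If two points found by density both lie in `Z`, the gap between the first and its successor in
`Z` contains a point off `Z`. -/
theorem exists_notMem_between [DenselyOrdered M] (h : IsSmallRotation a d m S f) {x y : M}
    (hxy : x < y) : ∃ t ∉ Z, x < t ∧ t < y := by
  obtain ⟨t, hxt, hty⟩ := exists_between hxy
  by_cases ht : t ∈ Z
  · obtain ⟨t', htt', hty'⟩ := exists_between hty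
    by_cases ht' : t' ∈ Z
    · have htd : (⟨t, ht⟩ : Z) ≠ d := fun e => (h.le_top ⟨t', ht'⟩).not_gt (e ▸ htt')
      obtain ⟨s, hts, hs⟩ := exists_between (Subtype.coe_lt_coe.2 (h.lt_S _ htd))
      refine ⟨s, fun hsZ => ?_, hxt.trans hts, (hs.trans_le ?_).trans hty'⟩
      · exact hs.not_ge (h.S_le ⟨t, ht⟩ ⟨s, hsZ⟩ hts)
      · exact h.S_le ⟨t, ht⟩ ⟨t', ht'⟩ htt'
    · exact ⟨t', ht', hxt.trans htt', hty'⟩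
  · exact ⟨t, ht, hxt, hty⟩

theorem notMem_of_gt (h : IsSmallRotation a d m S f) {x : M} (hx : d.1 < x) : x ∉ Z :=
  fun hxZ => hx.not_ge (h.le_top ⟨x, hxZ⟩)

theorem up_eq_of_le (hp : IsProjection a d pr) (h : IsSmallRotation a d m S f) {x y : M}
    (hxy : x ≤ y) (hy : y ≤ pr x) : up a d pr y = up a d pr x := by
  refine le_antisymm ?_ (hp.monotone_up h hxy)
  rw [up.eq_1 a d pr x, if_pos (hxy.trans (hy.trans (h.le_top _))), hp.up_le_coe_iff h]
  exact hy

theorem up_eq_coe_iff (hp : IsProjection a d pr) (h : IsSmallRotation a d m S f) {z : Z} {y : M}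
    (h1 : z.1 < y) (h2 : y ≤ S z) (hz : z ≠ d) : up a d pr y = toLex (0, S z) := by
  refine le_antisymm ((hp.up_le_coe_iff h _ _).2 h2) ?_
  have : h.succ (toLex (0, z)) = toLex (0, S z) := h.isRotation_S.lift_of_mem hz 0
  rw [← this, ← h.lt_iff_succ_le, ← not_le, hp.up_le_coe_iff h, not_le]
  exact h1

open Classical in
-- The value of `up` just to the right of `x`: it jumps by one step at a point of `Z` and is locally
-- constant elsewhere. This and `exists_lt_up_eq` supply the witnesses off `Z`.
theorem exists_gt_up_eq [DenselyOrdered M] [NoMaxOrder M] (hp : IsProjection a d pr)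
    (h : IsSmallRotation a d m S f) (x : M) :
    ∃ y ∉ Z, x < y ∧ up a d pr y = if x ∈ Z then h.succ (up a d pr x) else up a d pr x := by
  by_cases hx : x ∈ Z
  · rw [if_pos hx]
    lift x to Z using hx
    rw [hp.up_coe h]
    by_cases hxd : x = d
    · subst hxd
      obtain ⟨y, hy⟩ := exists_gt x.1
      refine ⟨y, notMem_of_gt h hy, hy, ?_⟩
      rw [up_of_gt y hy]
      refine Eq.trans ?_ (h.isRotation_S.lift_of_notMem (by simp) 0).symm
      rw [h.S_top, zero_add]
    · obtain ⟨y, hyZ, hxy, hy⟩ := exists_notMem_between h (Subtype.coe_lt_coe.2 (h.lt_S x hxd))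
      exact ⟨y, hyZ, hxy, (hp.up_eq_coe_iff h hxy hy.le hxd).trans
        (h.isRotation_S.lift_of_mem hxd 0).symm⟩
  · rw [if_neg hx]
    rcases le_or_gt x d with hxd | hxd
    · have hlt : x < pr x := (hp.le_pr x hxd).lt_of_ne fun e => hx (e ▸ (pr x).2)
      obtain ⟨y, hyZ, hxy, hy⟩ := exists_notMem_between h hlt
      exact ⟨y, hyZ, hxy, hp.up_eq_of_le h hxy.le hy.le⟩
    · obtain ⟨y, hy⟩ := exists_gt x
      exact ⟨y, notMem_of_gt h (hxd.trans hy), hy, by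
        rw [up_of_gt x hxd, up_of_gt y (hxd.trans hy)]⟩

theorem exists_lt_up_eq [DenselyOrdered M] [NoMinOrder M] (hp : IsProjection a d pr)
    (h : IsSmallRotation a d m S f) (x : M) : ∃ y ∉ Z, y < x ∧ up a d pr y = up a d pr x := by
  rcases le_or_gt x d with hxd | hxd
  · by_cases ha : pr x = a
    · obtain ⟨y, hy⟩ := exists_lt x
      have hxa : x ≤ a := ha ▸ hp.le_pr x hxd
      refine ⟨y, fun hyZ => (h.bot_le ⟨y, hyZ⟩).not_gt (hy.trans_le hxa), hy,
        le_antisymm (hp.monotone_up h hy.le) ?_⟩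
      exact ((hp.up_le_coe_iff h _ _).2 hxa).trans (bot_le_up h y)
    · obtain ⟨z, hz⟩ := S.surjective (pr x)
      have hzd : z ≠ d := by
        rintro rfl
        exact ha (hz.symm.trans h.S_top)
      have hzx : z.1 < x := by
        by_contra! hxz
        exact (hp.pr_le x z hxz).not_gt (hz ▸ h.lt_S z hzd)
      have hxz : x ≤ S z := hz ▸ hp.le_pr x hxd
      obtain ⟨y, hyZ, hzy, hy⟩ := exists_notMem_between h hzx
      exact ⟨y, hyZ, hy, (hp.up_eq_coe_iff h hzy (hy.le.trans hxz) hzd).trans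
        (hp.up_eq_coe_iff h hzx hxz hzd).symm⟩
  · obtain ⟨y, hyZ, hdy, hy⟩ := exists_notMem_between h hxd
    exact ⟨y, hyZ, hy, by rw [up_of_gt x hxd, up_of_gt y hdy]⟩

theorem exists_up_eq [DenselyOrdered M] [NoMinOrder M] [NoMaxOrder M] (hp : IsProjection a d pr)
    (h : IsSmallRotation a d m S f) {w : ℤ ×ₗ Z} (h1 : toLex (0, a) ≤ w) (h2 : w ≤ toLex (1, a)) :
    ∃ y ∉ Z, up a d pr y = w := by
  rcases h2.eq_or_lt with rfl | h2
  · obtain ⟨y, hy⟩ := exists_gt d.1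
    exact ⟨y, notMem_of_gt h hy, up_of_gt y hy⟩
  · obtain ⟨z, rfl⟩ := exists_eq_coe h h1 h2
    obtain ⟨y, hyZ, -, hy⟩ := hp.exists_lt_up_eq h z
    exact ⟨y, hyZ, hy.trans (hp.up_coe h z)⟩

/-! ### Compositions of basic relations -/

open Classical in
-- Against elements of `Z` every basic relation is a threshold; the strict order costs one successor
-- exactly when `x` itself lies in `Z`.
theorem exists_threshold (hp : IsProjection a d pr) (h : IsSmallRotation a d m S f)
    {Q : M → M → Prop}
    (hQ : Q ∈ binaryRels a d pr h.succ (translation Z) h.shiftedF h.shiftedG) :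
    ∃ τ, IsThreshold a d pr h.succ (translation Z) h.shiftedF h.shiftedG τ ∧
      ∀ x, ∀ z : Z, Q x z ↔ τ x ≤ toLex (0, z) := by
  rcases hQ with rfl | rfl | ⟨b, hb, rfl⟩
  · refine ⟨_, isThreshold_ite, fun x z => ?_⟩
    by_cases hx : x ∈ Z
    · rw [if_pos hx, ← h.lt_iff_succ_le, hp.up_coe h ⟨x, hx⟩, Prod.Lex.toLex_lt_toLex]
      simp [← Subtype.coe_lt_coe]
    · rw [if_neg hx, hp.up_le_coe_iff h]
      exact ⟨le_of_lt, fun hxz => hxz.lt_of_ne fun e => hx (e ▸ z.2)⟩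
  · exact ⟨_, isThreshold_gen .id, fun x z => (hp.up_le_coe_iff h x z).symm⟩
  · exact ⟨_, isThreshold_gen hb, fun x z => by simp only [hp.up_coe h]⟩

/-- A witness is an element of level `0` in the half-open interval from `τ x` to `τ' x'`. If there
is one, the maximum of `τ x` and `(0, a)` is one, which leaves only comparisons of thresholds. -/
theorem tameRel_comp_mem (hp : IsProjection a d pr) (h : IsSmallRotation a d m S f)
    {Q Q' : M → M → Prop}
    (hQ : Q ∈ binaryRels a d pr h.succ (translation Z) h.shiftedF h.shiftedG)
    (hQ' : Q' ∈ binaryRels a d pr h.succ (translation Z) h.shiftedF h.shiftedG) :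
    TameRel (unarySets Z) (binaryRels a d pr h.succ (translation Z) h.shiftedF h.shiftedG)
      fun x x' => ∃ y ∈ Z, Q x y ∧ ¬ Q' x' y := by
  obtain ⟨τ, hτ, H⟩ := hp.exists_threshold h hQ
  obtain ⟨τ', hτ', H'⟩ := hp.exists_threshold h hQ'
  have e : ∀ x x', (∃ y ∈ Z, Q x y ∧ ¬ Q' x' y) ↔
      τ x < τ' x' ∧ ¬ toLex (1, a) ≤ τ x ∧ ¬ τ' x' ≤ toLex (0, a) := by
    intro x x'
    constructor
    · rintro ⟨y, hy, h1, h2⟩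
      rw [H x ⟨y, hy⟩] at h1
      rw [H' x' ⟨y, hy⟩, not_le] at h2
      refine ⟨h1.trans_lt h2, not_le.2 (h1.trans_lt ?_), not_le.2 (lt_of_le_of_lt ?_ h2)⟩
      · exact Prod.Lex.toLex_lt_toLex.2 (Or.inl one_pos)
      · exact Prod.Lex.toLex_le_toLex.2 (Or.inr ⟨rfl, h.bot_le _⟩)
    · rintro ⟨h1, h2, h3⟩
      rw [not_le] at h2 h3
      obtain ⟨z, hz⟩ := exists_eq_coe h (le_max_right (τ x) (toLex (0, a)))
        (max_lt h2 (Prod.Lex.toLex_lt_toLex.2 (Or.inl one_pos)))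
      refine ⟨z, z.2, (H x z).2 ?_, ?_⟩
      · rw [← hz]; exact le_max_left _ _
      · rw [H' x' z, ← hz, not_le]; exact max_lt h1 h3
  simp only [e]
  have e' : ∀ x, toLex (1, a) ≤ τ x ↔ ¬ τ x ≤ h.succ.symm (toLex (1, a)) := fun x => by
    rw [h.isCover.le_S_symm_iff, not_lt]
  simp only [e']
  exact (tameRel_threshold_lt h hτ hτ').and
    ((hp.tame_threshold_le h hτ _ 0).not.not.and (hp.tame_threshold_le h hτ' _ 1).not)

open Classical in
/-- Composition of an order relation with a relation through the monoid. -/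
theorem exists_lt_up_iff [DenselyOrdered M] [NoMaxOrder M] (hp : IsProjection a d pr)
    (h : IsSmallRotation a d m S f) {Q : M → M → Prop} (h1 : ∀ x y, x < y → Q x y)
    (h2 : ∀ x y, Q x y → x ≤ y) (x : M) (w : ℤ ×ₗ Z) :
    (∃ y ∉ Z, Q x y ∧ ¬ w ≤ up a d pr y) ↔
      (if x ∈ Z then h.succ (up a d pr x) else up a d pr x) < w := by
  constructor
  · rintro ⟨y, hy, hxy, hw⟩
    refine lt_of_le_of_lt ?_ (not_le.1 hw)
    have hxy := h2 _ _ hxy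
    split_ifs with hx
    · have hlt : x < y := hxy.lt_of_ne fun e => hy (e ▸ hx)
      rw [← h.lt_iff_succ_le, hp.up_coe h ⟨x, hx⟩, ← not_le, hp.up_le_coe_iff h]
      exact hlt.not_ge
    · exact hp.monotone_up h hxy
  · intro hw
    obtain ⟨y, hy, hxy, e⟩ := hp.exists_gt_up_eq h x
    exact ⟨y, hy, h1 _ _ hxy, by rwa [e, not_le]⟩

theorem exists_up_lt_iff [DenselyOrdered M] [NoMinOrder M] (hp : IsProjection a d pr)
    (h : IsSmallRotation a d m S f) {Q : M → M → Prop} (h1 : ∀ x y, x < y → Q x y)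
    (h2 : ∀ x y, Q x y → x ≤ y) (w : ℤ ×ₗ Z) (x : M) :
    (∃ y ∉ Z, w ≤ up a d pr y ∧ ¬ Q x y) ↔ w ≤ up a d pr x := by
  constructor
  · rintro ⟨y, -, hw, hxy⟩
    refine hw.trans (hp.monotone_up h ?_)
    by_contra! hlt
    exact hxy (h1 _ _ hlt)
  · intro hw
    obtain ⟨y, hy, hyx, e⟩ := hp.exists_lt_up_eq h x
    exact ⟨y, hy, hw.trans_eq e.symm, fun hxy => hyx.not_ge (h2 _ _ hxy)⟩

/-- In contrast to witnesses in `Z`, the value `(1, a)` is allowed here, since `up` takes it at the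
points above `d`. -/
theorem exists_up_between_iff [DenselyOrdered M] [NoMinOrder M] [NoMaxOrder M]
    (hp : IsProjection a d pr) (h : IsSmallRotation a d m S f) (w w' : ℤ ×ₗ Z) :
    (∃ y ∉ Z, w ≤ up a d pr y ∧ ¬ w' ≤ up a d pr y) ↔
      w < w' ∧ w ≤ toLex (1, a) ∧ ¬ w' ≤ toLex (0, a) := by
  constructor
  · rintro ⟨y, -, h1, h2⟩
    rw [not_le] at h2
    exact ⟨h1.trans_lt h2, h1.trans (up_le_top y), not_le.2 ((bot_le_up h y).trans_lt h2)⟩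
  · rintro ⟨h1, h2, h3⟩
    rw [not_le] at h3
    obtain ⟨y, hy, e⟩ := hp.exists_up_eq h (le_max_right w (toLex (0, a)))
      (max_le h2 (Prod.Lex.toLex_le_toLex.2 (Or.inl one_pos)))
    exact ⟨y, hy, e ▸ le_max_left _ _, by rw [e, not_le]; exact max_lt h1 h3⟩

theorem tameRel_comp_notMem [DenselyOrdered M] [NoMinOrder M] [NoMaxOrder M]
    (hp : IsProjection a d pr) (h : IsSmallRotation a d m S f) {Q Q' : M → M → Prop}
    (hQ : Q ∈ binaryRels a d pr h.succ (translation Z) h.shiftedF h.shiftedG)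
    (hQ' : Q' ∈ binaryRels a d pr h.succ (translation Z) h.shiftedF h.shiftedG) :
    TameRel (unarySets Z) (binaryRels a d pr h.succ (translation Z) h.shiftedF h.shiftedG)
      fun x x' => ∃ y ∉ Z, Q x y ∧ ¬ Q' x' y := by
  have order : ∀ Q : M → M → Prop, Q = (· < ·) ∨ Q = (· ≤ ·) →
      (∀ x y, x < y → Q x y) ∧ ∀ x y, Q x y → x ≤ y := by
    rintro Q (rfl | rfl)
    · exact ⟨fun _ _ => id, fun _ _ => le_of_lt⟩
    · exact ⟨fun _ _ => le_of_lt, fun _ _ => id⟩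
  rw [binaryRels, mem_ofPred_eq, ← or_assoc] at hQ hQ'
  rcases hQ with hQ | ⟨b, hb, rfl⟩ <;> rcases hQ' with hQ' | ⟨b', hb', rfl⟩
  · have hlt : TameRel (unarySets Z)
        (binaryRels a d pr h.succ (translation Z) h.shiftedF h.shiftedG) fun x y => x < y :=
      TameRel.of_mem (Or.inl rfl)
    have hle : TameRel (unarySets Z)
        (binaryRels a d pr h.succ (translation Z) h.shiftedF h.shiftedG) fun x y => x ≤ y :=
      TameRel.of_mem (Or.inr (Or.inl rfl))
    -- Only the closed interval from `x` to `x'` can be nonempty with `x = x'`, and then it matters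
    -- whether `x` lies in `Z`.
    by_cases hQQ : Q = (· ≤ ·) ∧ Q' = (· < ·)
    · obtain ⟨rfl, rfl⟩ := hQQ
      have e : ∀ x x' : M, (∃ y ∉ Z, x ≤ y ∧ ¬ x' < y) ↔ x < x' ∨ (x ∉ Z ∧ x ≤ x') := by
        intro x x'
        constructor
        · rintro ⟨y, hy, h1, h2⟩
          rw [not_lt] at h2
          rcases (h1.trans h2).lt_or_eq with hlt | rfl
          · exact Or.inl hlt
          · obtain rfl := le_antisymm h1 h2
            exact Or.inr ⟨hy, le_rfl⟩
        · rintro (hlt | ⟨hx, hle⟩)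
          · obtain ⟨y, hy, h1, h2⟩ := exists_notMem_between h hlt
            exact ⟨y, hy, h1.le, h2.not_gt⟩
          · exact ⟨x, hx, le_rfl, hle.not_gt⟩
      simp only [e]
      exact hlt.or ((tame_notMem 0).and hle)
    · have e : ∀ x x' : M, (∃ y ∉ Z, Q x y ∧ ¬ Q' x' y) ↔ x < x' := by
        intro x x'
        constructor
        · rintro ⟨y, hy, h1, h2⟩
          rcases hQ with rfl | rfl <;> rcases hQ' with rfl | rfl
          · exact lt_of_lt_of_le h1 (not_lt.1 h2)
          · exact lt_trans h1 (not_le.1 h2)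
          · exact absurd ⟨rfl, rfl⟩ hQQ
          · exact lt_of_le_of_lt h1 (not_le.1 h2)
        · intro hlt
          obtain ⟨y, hy, h1, h2⟩ := exists_notMem_between h hlt
          exact ⟨y, hy, (order Q hQ).1 _ _ h1, fun h3 => h2.not_ge ((order Q' hQ').2 _ _ h3)⟩
      simp only [e]
      exact hlt
  · simp only [hp.exists_lt_up_iff h (order Q hQ).1 (order Q hQ).2]
    exact tameRel_threshold_lt h isThreshold_ite (isThreshold_gen hb')
  · simp only [hp.exists_up_lt_iff h (order Q' hQ').1 (order Q' hQ').2]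
    exact TameRel.of_mem (Or.inr (Or.inr ⟨b, hb, rfl⟩))
  · simp only [hp.exists_up_between_iff h]
    exact (tameRel_gen_lt h hb hb').and ((hp.tame_threshold_le h (isThreshold_gen hb) _ 0).and
      (hp.tame_threshold_le h (isThreshold_gen hb') _ 1).not)

theorem eliminable [DenselyOrdered M] [NoMinOrder M] [NoMaxOrder M]
    (hp : IsProjection a d pr) (h : IsSmallRotation a d m S f) :
    Eliminable (unarySets Z) (binaryRels a d pr h.succ (translation Z) h.shiftedF h.shiftedG)
      (binaryRels a d pr h.succ (translation Z) h.shiftedF h.shiftedG) Z where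
  upper := by
    rintro _ (rfl | rfl | ⟨b, hb, rfl⟩) x y y' hyy' hy
    · exact lt_of_lt_of_le hy hyy'
    · exact le_trans hy hyy'
    · exact le_trans hy (hp.monotone_up h hyy')
  unary := by
    rintro _ (rfl | ⟨x, rfl⟩ | ⟨x, rfl⟩)
    · exact Or.inl rfl
    · exact Or.inr ⟨_, Or.inr (Or.inl rfl), x, rfl⟩
    · exact Or.inr ⟨_, Or.inl rfl, x, rfl⟩
  right := fun _ => id
  left := by
    rintro _ (rfl | rfl | ⟨b, hb, rfl⟩)
    · exact ⟨_, Or.inr (Or.inl rfl), fun _ _ => not_le.symm⟩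
    · exact ⟨_, Or.inl rfl, fun _ _ => not_lt.symm⟩
    · obtain ⟨c, hc, hbc⟩ := h.isCover.exists_adjoint hb
      refine ⟨_, Or.inr (Or.inr ⟨_, .comp .S hc, rfl⟩), fun x y => ?_⟩
      simp only [Function.comp_apply, ← h.lt_iff_succ_le, not_lt]
      exact hbc.le_iff_le
  -- `up` stays within a single turn, endpoints included. One turn down therefore gives a condition
  -- that always holds, and one turn and one further step up a condition that never does.
  exists_true := by
    refine ⟨_, Or.inr (Or.inr ⟨_, .T_symm, rfl⟩), a, fun y => ?_⟩
    rw [OrderIso.symm_apply_le]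
    exact (up_le_top _).trans ((translation Z).monotone (bot_le_up h y))
  exists_false := by
    refine ⟨_, Or.inr (Or.inr ⟨_, .comp .S .T, rfl⟩), a, fun y => ?_⟩
    rw [Function.comp_apply, ← h.lt_iff_succ_le, not_lt]
    exact (up_le_top y).trans ((translation Z).monotone (bot_le_up h a.1))
  comp_mem := fun _ hQ _ hQ' => hp.tameRel_comp_mem h hQ hQ'
  comp_notMem := fun _ hQ _ hQ' => hp.tameRel_comp_notMem h hQ hQ'

end IsProjection

end Ladder


/-! ### Definable sets are tame -/

section Values

variable {M : Type u} [LinearOrder M] {Z : Set M} {a d m : Z} {pr : M → Z} {S f : Z ≃ Z}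

/-- The element of `Z` below an element of `ℤ ×ₗ Z`. -/
def base (u : ℤ ×ₗ Z) : M := (ofLex u).2

/-- The identity, or a map given by a map in the monoid. -/
def IsValue (a d : Z) (pr : M → Z) (S T : ℤ ×ₗ Z ≃o ℤ ×ₗ Z) (F G : ℤ ×ₗ Z → ℤ ×ₗ Z)
    (α : M → M) : Prop :=
  α = id ∨ ∃ k, Gen S T F G k ∧ α = fun x => base (k (up a d pr x))

/-- A map given by a map in the monoid on `Z`, and possibly by another one off `Z`. -/
def IsWordMap (a d : Z) (pr : M → Z) (S T : ℤ ×ₗ Z ≃o ℤ ×ₗ Z) (F G : ℤ ×ₗ Z → ℤ ×ₗ Z)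
    (α : M → M) : Prop :=
  (∃ k, Gen S T F G k ∧ ∀ x ∈ Z, α x = base (k (up a d pr x))) ∧
    ∃ β, IsValue a d pr S T F G β ∧ ∀ x ∉ Z, α x = β x

/-- A map induced by a map in the monoid, which is the identity or the projection off `Z`. -/
def IsBasicMap (a d : Z) (pr : M → Z) (S T : ℤ ×ₗ Z ≃o ℤ ×ₗ Z) (F G : ℤ ×ₗ Z → ℤ ×ₗ Z)
    (α : M → M) : Prop :=
  (∃ k, Gen S T F G k ∧ ∀ u, α (base u) = base (k u)) ∧
    ((∀ x ∉ Z, α x = x) ∨ ∀ x ∉ Z, α x = base (up a d pr x))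

namespace IsProjection

theorem isWordMap_id (hp : IsProjection a d pr) (h : IsSmallRotation a d m S f)
    {S T : ℤ ×ₗ Z ≃o ℤ ×ₗ Z} {F G : ℤ ×ₗ Z → ℤ ×ₗ Z} : IsWordMap a d pr S T F G id :=
  ⟨⟨id, .id, fun x hx => by
    have := hp.up_coe h ⟨x, hx⟩
    simp only at this
    rw [id, id, this]; rfl⟩, id, Or.inl rfl, fun _ _ => rfl⟩

theorem isWordMap_comp {S T : ℤ ×ₗ Z ≃o ℤ ×ₗ Z} {F G : ℤ ×ₗ Z → ℤ ×ₗ Z} {α β : M → M}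
    (hα : IsBasicMap a d pr S T F G α) (hβ : IsWordMap a d pr S T F G β) :
    IsWordMap a d pr S T F G (α ∘ β) := by
  obtain ⟨⟨k, hk, hαk⟩, hαZ⟩ := hα
  obtain ⟨⟨l, hl, hβl⟩, γ, hγ, hβγ⟩ := hβ
  refine ⟨⟨k ∘ l, .comp hk hl, fun x hx => by simp only [Function.comp_apply, hβl x hx, hαk]⟩, ?_⟩
  rcases hγ with rfl | ⟨l', hl', rfl⟩
  · rcases hαZ with hαZ | hαZ
    · exact ⟨id, Or.inl rfl, fun x hx => by simp only [Function.comp_apply, hβγ x hx, id, hαZ x hx]⟩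
    · exact ⟨_, Or.inr ⟨id, .id, rfl⟩, fun x hx => by
        simp only [Function.comp_apply, hβγ x hx, id, hαZ x hx]⟩
  · exact ⟨_, Or.inr ⟨k ∘ l', .comp hk hl', rfl⟩, fun x hx => by
      simp only [Function.comp_apply, hβγ x hx, hαk]⟩

/-- The representative in `{0} × Z` of a map in the monoid. -/
theorem isThreshold_base (hp : IsProjection a d pr) (h : IsSmallRotation a d m S f)
    {k : ℤ ×ₗ Z → ℤ ×ₗ Z} (hk : Gen h.succ (translation Z) h.shiftedF h.shiftedG k) :
    IsThreshold a d pr h.succ (translation Z) h.shiftedF h.shiftedG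
      fun x => toLex (0, (ofLex (k (up a d pr x))).2) := by
  obtain ⟨⟨i₀, z₀⟩, h₀⟩ := toLex.surjective (k (toLex (0, a)))
  have key : ∀ u i, (ofLex u).1 = i →
      toLex ((0 : ℤ), (ofLex u).2) = (translation Z ^ (-i)) u := by
    rintro u i rfl
    obtain ⟨⟨i, z⟩, rfl⟩ := toLex.surjective u
    rw [translation_zpow]
    simp
  -- While `up x` runs through one turn, `k (up x)` stays between `k (0, a)` and its translate. So
  -- its level is `i₀` or `i₀ + 1`, the cut decides which, and a power of the translation brings it
  -- to level `0`.
  refine ⟨{x | k (up a d pr x) ≤ h.succ.symm (toLex (i₀ + 1, a))}, hp.unaryTame_gen_le h hk _,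
    (translation Z ^ (-i₀)) ∘ k, (translation Z ^ (-(i₀ + 1))) ∘ k,
    .comp (IsCover.gen_T_zpow _) hk, .comp (IsCover.gen_T_zpow _) hk, fun x => ?_⟩
  have h1 : k (toLex (0, a)) ≤ k (up a d pr x) := h.isCover.monotone hk (bot_le_up h x)
  have h2 : k (up a d pr x) ≤ translation Z (k (toLex (0, a))) := by
    rw [← h.isCover.comm_T hk]
    exact h.isCover.monotone hk (up_le_top x)
  rw [← h₀] at h1 h2
  rw [translation_toLex] at h2
  obtain ⟨⟨i, z⟩, hu⟩ := toLex.surjective (k (up a d pr x))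
  simp only [mem_ofPred_eq, h.isCover.le_S_symm_iff, Function.comp_apply, ← hu] at h1 h2 ⊢
  rw [Prod.Lex.toLex_lt_toLex]
  rw [Prod.Lex.toLex_le_toLex] at h1 h2
  have ha := (h.bot_le z).not_gt
  simp only [ha, and_false, or_false] at h1 h2 ⊢
  exact ⟨fun hi => key (toLex (i, z)) i₀ (by change i = i₀; omega),
    fun hi => key (toLex (i, z)) (i₀ + 1) (by change i = i₀ + 1; omega)⟩

theorem tameRel_value_le (hp : IsProjection a d pr) (h : IsSmallRotation a d m S f)
    {α β : M → M} (hα : IsValue a d pr h.succ (translation Z) h.shiftedF h.shiftedG α)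
    (hβ : IsValue a d pr h.succ (translation Z) h.shiftedF h.shiftedG β) :
    TameRel (unarySets Z) (binaryRels a d pr h.succ (translation Z) h.shiftedF h.shiftedG)
      fun x y => α x ≤ β y := by
  rcases hα with rfl | ⟨k, hk, rfl⟩ <;> rcases hβ with rfl | ⟨l, hl, rfl⟩
  · exact TameRel.of_mem (Or.inr (Or.inl rfl))
  · simp only [base, id, ← hp.up_le_coe_iff h]
    exact tameRel_threshold_le h (isThreshold_gen .id) (hp.isThreshold_base h hl)
  -- Off `Z`, `up y` lies strictly past `y`, so an element of `Z` below `y` is strictly below `up y`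
  -- in the cover.
  · have e : ∀ x y, base (k (up a d pr x)) ≤ id y ↔
        (y ∈ Z ∧ toLex ((0 : ℤ), (ofLex (k (up a d pr x))).2) ≤ id (up a d pr y)) ∨
        (y ∉ Z ∧ toLex ((0 : ℤ), (ofLex (k (up a d pr x))).2) < id (up a d pr y)) := by
      intro x y
      by_cases hy : y ∈ Z
      · lift y to Z using hy
        simp [base, hp.up_coe h, Prod.Lex.toLex_le_toLex]
      · simp only [hy, false_and, false_or, not_false_eq_true, true_and, id]
        rw [← not_le, ← not_lt, hp.up_le_coe_iff h]
        exact not_congr ⟨le_of_lt, fun hle => hle.lt_of_ne fun e => hy (e ▸ Subtype.coe_prop _)⟩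
    simp only [e]
    exact ((tame_mem 1).and
      (tameRel_threshold_le h (hp.isThreshold_base h hk) (isThreshold_gen .id))).or
      ((tame_notMem 1).and
      (tameRel_threshold_lt h (hp.isThreshold_base h hk) (isThreshold_gen .id)))
  · have e : ∀ x y, base (k (up a d pr x)) ≤ base (l (up a d pr y)) ↔
        toLex ((0 : ℤ), (ofLex (k (up a d pr x))).2) ≤
          toLex ((0 : ℤ), (ofLex (l (up a d pr y))).2) := by
      intro x y
      simp [base, Prod.Lex.toLex_le_toLex]
    simp only [e]
    exact tameRel_threshold_le h (hp.isThreshold_base h hk) (hp.isThreshold_base h hl)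

theorem tameRel_wordMap_le (hp : IsProjection a d pr) (h : IsSmallRotation a d m S f)
    {α β : M → M} (hα : IsWordMap a d pr h.succ (translation Z) h.shiftedF h.shiftedG α)
    (hβ : IsWordMap a d pr h.succ (translation Z) h.shiftedF h.shiftedG β) :
    TameRel (unarySets Z) (binaryRels a d pr h.succ (translation Z) h.shiftedF h.shiftedG)
      fun x y => α x ≤ β y := by
  obtain ⟨⟨k, hk, hαk⟩, γ, hγ, hαγ⟩ := hα
  obtain ⟨⟨l, hl, hβl⟩, δ, hδ, hβδ⟩ := hβ
  have e : ∀ x y, α x ≤ β y ↔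
      ((x ∈ Z ∧ y ∈ Z) ∧ base (k (up a d pr x)) ≤ base (l (up a d pr y))) ∨
      ((x ∈ Z ∧ y ∉ Z) ∧ base (k (up a d pr x)) ≤ δ y) ∨
      ((x ∉ Z ∧ y ∈ Z) ∧ γ x ≤ base (l (up a d pr y))) ∨
      ((x ∉ Z ∧ y ∉ Z) ∧ γ x ≤ δ y) := by
    intro x y
    by_cases hx : x ∈ Z <;> by_cases hy : y ∈ Z <;> simp [hx, hy, hαk, hβl, hαγ, hβδ]
  simp only [e]
  have hk' : IsValue a d pr h.succ (translation Z) h.shiftedF h.shiftedG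
      fun x => base (k (up a d pr x)) := Or.inr ⟨k, hk, rfl⟩
  have hl' : IsValue a d pr h.succ (translation Z) h.shiftedF h.shiftedG
      fun x => base (l (up a d pr x)) := Or.inr ⟨l, hl, rfl⟩
  exact (((tame_mem 0).and (tame_mem 1)).and (hp.tameRel_value_le h hk' hl')).or
    ((((tame_mem 0).and (tame_notMem 1)).and (hp.tameRel_value_le h hk' hδ)).or
    ((((tame_notMem 0).and (tame_mem 1)).and (hp.tameRel_value_le h hγ hl')).or
    (((tame_notMem 0).and (tame_notMem 1)).and (hp.tameRel_value_le h hγ hδ))))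

/-- The ignored second argument gives the condition the form of a binary relation, so that
`TameRel.comp` applies to it. -/
theorem tameRel_wordMap_mem {S T : ℤ ×ₗ Z ≃o ℤ ×ₗ Z} {F G : ℤ ×ₗ Z → ℤ ×ₗ Z} {α : M → M}
    (hα : IsWordMap a d pr S T F G α) :
    TameRel (unarySets Z) (binaryRels a d pr S T F G) fun x _ => α x ∈ Z := by
  obtain ⟨⟨k, hk, hαk⟩, γ, hγ, hαγ⟩ := hα
  rcases hγ with rfl | ⟨l, hl, rfl⟩
  · have e : ∀ x, α x ∈ Z ↔ x ∈ Z := by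
      intro x
      by_cases hx : x ∈ Z
      · simp [hx, hαk, base]
      · rw [hαγ x hx, id]
    simp only [e]
    exact tame_mem 0
  · have e : ∀ x, α x ∈ Z := by
      intro x
      by_cases hx : x ∈ Z
      · simp [hx, hαk, base]
      · simp [hx, hαγ, base]
    simp only [e]
    exact tame_const True

end IsProjection

end Values

/-! ### Terms as words, and induction on formulas. -/

section Formulas

open FirstOrder.Language

variable {N : Type u} [LinearOrder N] [L₁.Structure N] {Z : Set N} {a d m : Z} {pr : N → Z}
  {S f : Z ≃ Z}

/-- All basic symbols of `L₁` have the intended meaning. -/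
structure IsInterpretation (Z : Set N) (a d : Z) (pr : N → Z) (S T : ℤ ×ₗ Z ≃o ℤ ×ₗ Z)
    (F G : ℤ ×ₗ Z → ℤ ×ₗ Z) : Prop where
  func₀ : ∀ φ : Func₀ 1, IsBasicMap a d pr S T F G fun x : N =>
    Structure.funMap (L := L₁) (Sum.inl φ) ![x]
  funcFG : ∀ φ : FuncFG 1, IsBasicMap a d pr S T F G fun x : N =>
    Structure.funMap (L := L₁) (Sum.inr φ) ![x]
  le : ∀ v : Fin 2 → N, Structure.RelMap (L := L₁) (Sum.inl Rel₀.le) v ↔ v 0 ≤ v 1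
  mem : ∀ v : Fin 1 → N, Structure.RelMap (L := L₁) (Sum.inl Rel₀.Z) v ↔ v 0 ∈ Z

variable {β : Type v}

/-- All function symbols have arity at most one, so a term is a composition of unary maps applied to
one variable or one constant. -/
theorem exists_wordMap_of_term (hp : IsProjection a d pr) (h : IsSmallRotation a d m S f)
    (hi : IsInterpretation Z a d pr h.succ (translation Z) h.shiftedF h.shiftedG)
    (t : L₁[[(univ : Set N)]].Term β) : ∃ (s : β ⊕ N) (α : N → N),
      IsWordMap a d pr h.succ (translation Z) h.shiftedF h.shiftedG α ∧
      ∀ v : β → N, t.realize v = α (evalAt v s) := by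
  have hid : IsWordMap a d pr h.succ (translation Z) h.shiftedF h.shiftedG id := hp.isWordMap_id h
  have const : ∀ {c : N} {t : L₁[[(univ : Set N)]].Term β}, (∀ v : β → N, t.realize v = c) →
      ∃ (s : β ⊕ N) (α : N → N),
        IsWordMap a d pr h.succ (translation Z) h.shiftedF h.shiftedG α ∧
        ∀ v : β → N, t.realize v = α (evalAt v s) :=
    fun {c _} hc => ⟨Sum.inr c, id, hid, hc⟩
  have unary : ∀ {φ : N → N} {s t : L₁[[(univ : Set N)]].Term β},
      IsBasicMap a d pr h.succ (translation Z) h.shiftedF h.shiftedG φ →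
      (∀ v : β → N, t.realize v = φ (s.realize v)) → (∃ (r : β ⊕ N) (α : N → N),
        IsWordMap a d pr h.succ (translation Z) h.shiftedF h.shiftedG α ∧
        ∀ v : β → N, s.realize v = α (evalAt v r)) → ∃ (r : β ⊕ N) (α : N → N),
        IsWordMap a d pr h.succ (translation Z) h.shiftedF h.shiftedG α ∧
        ∀ v : β → N, t.realize v = α (evalAt v r) := by
    rintro φ s t hφ ht ⟨r, α, hα, hs⟩
    exact ⟨r, _, IsProjection.isWordMap_comp hφ hα, fun v => by
      rw [ht, hs, Function.comp_apply]⟩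
  induction t with
  | var b => exact ⟨Sum.inl b, id, hid, fun v => rfl⟩
  | @func n φ ts ih =>
    have hv : ∀ (ts : Fin 1 → L₁[[(univ : Set N)]].Term β) (v : β → N),
        (fun i => (ts i).realize v) = ![(ts 0).realize v] := fun ts v =>
      funext fun i => by rw [Subsingleton.elim i 0]; rfl
    rcases φ with (φ | φ) | φ
    · match n, φ with
      | 1, φ =>
        exact unary (s := ts 0) (hi.func₀ φ) (fun v =>
          congrArg (Structure.funMap (L := L₁) (Sum.inl φ)) (hv ts v)) (ih 0)
      | 0, φ =>
        exact const (c := Structure.funMap (L := L₁) (Sum.inl φ) default) fun v =>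
          congrArg (Structure.funMap (L := L₁) (Sum.inl φ)) (Subsingleton.elim _ _)
    · match n, φ with
      | 1, φ =>
        exact unary (s := ts 0) (hi.funcFG φ) (fun v =>
          congrArg (Structure.funMap (L := L₁) (Sum.inr φ)) (hv ts v)) (ih 0)
    · match n, φ with
      | 0, c => exact const (c := c.1) fun v => rfl

theorem tame_realize [DenselyOrdered N] [NoMinOrder N] [NoMaxOrder N]
    (hp : IsProjection a d pr) (h : IsSmallRotation a d m S f)
    (hi : IsInterpretation Z a d pr h.succ (translation Z) h.shiftedF h.shiftedG) {n : ℕ}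
    (φ : L₁[[(univ : Set N)]].BoundedFormula β n) :
    Tame (unarySets Z) (binaryRels a d pr h.succ (translation Z) h.shiftedF h.shiftedG)
      {v : β ⊕ Fin n → N | φ.Realize (v ∘ Sum.inl) (v ∘ Sum.inr)} := by
  have hs := hp.specializationTame h
  have hle : ∀ {n : ℕ} (t₁ t₂ : L₁[[(univ : Set N)]].Term (β ⊕ Fin n)),
      Tame (unarySets Z) (binaryRels a d pr h.succ (translation Z) h.shiftedF h.shiftedG)
        {v : β ⊕ Fin n → N | t₁.realize v ≤ t₂.realize v} := by
    intro n t₁ t₂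
    obtain ⟨s₁, α₁, hα₁, h₁⟩ := exists_wordMap_of_term hp h hi t₁
    obtain ⟨s₂, α₂, hα₂, h₂⟩ := exists_wordMap_of_term hp h hi t₂
    simp only [h₁, h₂]
    exact (hp.tameRel_wordMap_le h hα₁ hα₂).comp hs s₁ s₂
  induction φ with
  | falsum => exact tame_const False
  | equal t₁ t₂ =>
    simp only [BoundedFormula.Realize, Sum.elim_comp_inl_inr, le_antisymm_iff]
    exact (hle t₁ t₂).and (hle t₂ t₁)
  | @rel n k R ts =>
    simp only [BoundedFormula.Realize, Sum.elim_comp_inl_inr]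
    rcases R with (R | R) | R
    · cases R with
      | le =>
        convert! hle (ts 0) (ts 1) using 1
        ext v
        exact hi.le _
      | Z =>
        obtain ⟨s, α, hα, hs'⟩ := exists_wordMap_of_term hp h hi (ts 0)
        convert! (IsProjection.tameRel_wordMap_mem hα).comp hs s s using 1
        ext v
        refine (hi.mem _).trans ?_
        simp only [hs', mem_ofPred_eq]
    · exact R.elim
    · exact Empty.elim R
  | imp φ ψ ihφ ihψ =>
    simp only [BoundedFormula.realize_imp, imp_iff_not_or]
    exact ihφ.not.or ihψ
  | @all n φ ih =>
    -- A universal quantifier is a negated existential one. The quantified variable, last in its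
    -- tuple, is renamed to `none`.
    have h1 := ih.not.comp hs (ι := Option (β ⊕ Fin n)) (Sum.elim
      (fun b => Sum.inl (some (Sum.inl b)))
      (Fin.snoc (α := fun _ => Option (β ⊕ Fin n) ⊕ N) (fun i => Sum.inl (some (Sum.inr i)))
        (Sum.inl none)))
    convert! ((hp.eliminable h).tame_exists hs h1).not using 1
    ext v
    simp only [BoundedFormula.Realize, mem_ofPred_eq, not_exists, not_not]
    refine forall_congr' fun y => iff_of_eq (congrArg₂ _ rfl (funext fun i => ?_))
    refine Fin.lastCases ?_ (fun i => ?_) i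
    · simp [extend, evalAt]
    · simp [extend, evalAt]

theorem unaryTame_of_definable [DenselyOrdered N] [NoMinOrder N] [NoMaxOrder N]
    (hp : IsProjection a d pr) (h : IsSmallRotation a d m S f)
    (hi : IsInterpretation Z a d pr h.succ (translation Z) h.shiftedF h.shiftedG) {A : Set N}
    (hA : (univ : Set N).Definable₁ L₁ A) : UnaryTame (unarySets Z) A := by
  obtain ⟨φ, hφ⟩ := hA
  have hs := hp.specializationTame h
  have := (tame_realize hp h hi φ).comp hs (ι := Fin 1) (Sum.elim Sum.inl Fin.elim0)
  refine Tame.unaryTame hs (R := binaryRels a d pr h.succ (translation Z) h.shiftedF h.shiftedG) ?_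
  rw [hφ]
  convert! this using 1
  ext v
  exact iff_of_eq (congrArg (fun w => BoundedFormula.Realize φ v w) (Subsingleton.elim _ _))

end Formulas

/-! ### Tame subsets of the line -/

section Line

theorem subset_or_disjoint {N : Type u} {I A : Set N} (h : ∀ x ∈ I, ∀ y ∈ I, x ∈ A ↔ y ∈ A) :
    I ⊆ A ∨ Disjoint I A := by
  by_cases hI : ∃ x ∈ I, x ∈ A
  · obtain ⟨x, hx, hxA⟩ := hI
    exact Or.inl fun y hy => (h x hx y hy).1 hxA
  · exact Or.inr (Set.disjoint_left.2 fun x hx hxA => hI ⟨x, hx, hxA⟩)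

variable {N : Type u} [LinearOrder N] {Z : Set N}

/-- Membership in a tame set of points depends only on `Z` and on the position relative to
finitely many points. -/
theorem UnaryTame.exists_finite {A : Set N} (hA : UnaryTame (unarySets Z) A) :
    ∃ E : Set N, E.Finite ∧ ∀ x y, (x ∈ Z ↔ y ∈ Z) →
      (∀ e ∈ E, (e ≤ x ↔ e ≤ y) ∧ (e < x ↔ e < y)) → (x ∈ A ↔ y ∈ A) := by
  obtain ⟨F, hFU, hF, H⟩ := hA
  have hinj : Function.Injective (Ioi : N → Set N) := fun x y hxy => by
    by_contra hne
    rcases lt_or_gt_of_ne hne with hlt | hlt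
    · exact lt_irrefl y (hxy ▸ hlt : y ∈ Ioi y)
    · exact lt_irrefl x (hxy ▸ hlt : x ∈ Ioi x)
  refine ⟨Ici ⁻¹' F ∪ Ioi ⁻¹' F, (hF.preimage Ici_injective.injOn).union
    (hF.preimage hinj.injOn), fun x y hZ hE => H x y fun B hB => ?_⟩
  rcases hFU hB with rfl | ⟨m, rfl⟩ | ⟨m, rfl⟩
  · exact hZ
  · exact (hE m (Or.inl hB)).1
  · exact (hE m (Or.inr hB)).2

/-- A bounded discrete closed subset without interior, in which all elements are successors. -/
structure IsSparse (Z : Set N) : Prop where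
  left : ∀ x, ∃ y < x, ∀ t ∈ Z, y < t → ¬ t < x
  right : ∀ x, ∃ y > x, ∀ t ∈ Z, x < t → ¬ t < y
  dense : ∀ x y, x < y → ∃ t ∉ Z, x < t ∧ t < y
  greatest : ∀ x, (∃ t ∈ Z, t < x) → ∃ z ∈ Z, z < x ∧ ∀ t ∈ Z, t < x → t ≤ z
  bddBelow : BddBelow Z
  bddAbove : BddAbove Z

theorem exists_lt_forall_le {E : Set N} (hE : E.Finite) {x y : N} (hyx : y < x) :
    ∃ b < x, y ≤ b ∧ ∀ e ∈ E, e < x → e ≤ b := by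
  obtain ⟨b, ⟨hb, hbx⟩, H⟩ := Set.exists_max_image {e ∈ insert y E | e < x} id
    ((hE.insert y).subset (sep_subset _ _)) ⟨y, mem_insert _ _, hyx⟩
  exact ⟨b, hbx, H y ⟨mem_insert _ _, hyx⟩, fun e he hex => H e ⟨mem_insert_of_mem _ he, hex⟩⟩

theorem exists_gt_forall_ge {E : Set N} (hE : E.Finite) {x y : N} (hxy : x < y) :
    ∃ b > x, b ≤ y ∧ ∀ e ∈ E, x < e → b ≤ e := by
  obtain ⟨b, ⟨hb, hbx⟩, H⟩ := Set.exists_min_image {e ∈ insert y E | x < e} id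
    ((hE.insert y).subset (sep_subset _ _)) ⟨y, mem_insert _ _, hxy⟩
  exact ⟨b, hbx, H y ⟨mem_insert _ _, hxy⟩, fun e he hex => H e ⟨mem_insert_of_mem _ he, hex⟩⟩

namespace IsSparse

theorem locally (hZ : IsSparse Z) {A : Set N} (hA : UnaryTame (unarySets Z) A) (a : N) :
    ∃ b₁ b₂ : N, b₁ < a ∧ a < b₂ ∧
      (Ioo b₁ a ⊆ A ∨ Disjoint (Ioo b₁ a) A) ∧ (Ioo a b₂ ⊆ A ∨ Disjoint (Ioo a b₂) A) := by
  obtain ⟨E, hE, H⟩ := hA.exists_finite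
  obtain ⟨y₁, hy₁, hyZ₁⟩ := hZ.left a
  obtain ⟨y₂, hy₂, hyZ₂⟩ := hZ.right a
  obtain ⟨b₁, hb₁, hyb₁, hbE₁⟩ := exists_lt_forall_le hE hy₁
  obtain ⟨b₂, hb₂, hyb₂, hbE₂⟩ := exists_gt_forall_ge hE hy₂
  refine ⟨b₁, b₂, hb₁, hb₂, subset_or_disjoint fun x hx y hy => H x y ?_ fun e he => ?_,
    subset_or_disjoint fun x hx y hy => H x y ?_ fun e he => ?_⟩
  · exact iff_of_false (fun h => hyZ₁ x h (hyb₁.trans_lt hx.1) hx.2)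
      fun h => hyZ₁ y h (hyb₁.trans_lt hy.1) hy.2
  · rcases lt_or_ge e a with hea | hea
    · have h1 := (hbE₁ e he hea).trans_lt hx.1
      have h2 := (hbE₁ e he hea).trans_lt hy.1
      exact ⟨iff_of_true h1.le h2.le, iff_of_true h1 h2⟩
    · have h1 := hx.2.trans_le hea
      have h2 := hy.2.trans_le hea
      exact ⟨iff_of_false h1.not_ge h2.not_ge, iff_of_false h1.not_gt h2.not_gt⟩
  · exact iff_of_false (fun h => hyZ₂ x h hx.1 (hx.2.trans_le hyb₂))
      fun h => hyZ₂ y h hy.1 (hy.2.trans_le hyb₂)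
  · rcases lt_or_ge a e with hea | hea
    · have h1 := hx.2.trans_le (hbE₂ e he hea)
      have h2 := hy.2.trans_le (hbE₂ e he hea)
      exact ⟨iff_of_false h1.not_ge h2.not_ge, iff_of_false h1.not_gt h2.not_gt⟩
    · have h1 := hea.trans_lt hx.1
      have h2 := hea.trans_lt hy.1
      exact ⟨iff_of_true h1.le h2.le, iff_of_true h1 h2⟩

theorem at_infinity [Nonempty N] [NoMinOrder N] [NoMaxOrder N] (hZ : IsSparse Z) {A : Set N}
    (hA : UnaryTame (unarySets Z) A) : ∃ c₁ c₂ : N,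
      (Iio c₁ ⊆ A ∨ Disjoint (Iio c₁) A) ∧ (Ioi c₂ ⊆ A ∨ Disjoint (Ioi c₂) A) := by
  obtain ⟨E, hE, H⟩ := hA.exists_finite
  obtain ⟨c₁, hc₁⟩ := hE.bddBelow.union hZ.bddBelow
  obtain ⟨c₂, hc₂⟩ := hE.bddAbove.union hZ.bddAbove
  refine ⟨c₁, c₂, subset_or_disjoint fun x hx y hy => H x y ?_ fun e he => ?_,
    subset_or_disjoint fun x hx y hy => H x y ?_ fun e he => ?_⟩
  · exact iff_of_false (fun h => hx.not_ge (hc₁ (Or.inr h))) fun h => hy.not_ge (hc₁ (Or.inr h))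
  · have h1 := lt_of_lt_of_le hx (hc₁ (Or.inl he))
    have h2 := lt_of_lt_of_le hy (hc₁ (Or.inl he))
    exact ⟨iff_of_false h1.not_ge h2.not_ge, iff_of_false h1.not_gt h2.not_gt⟩
  · exact iff_of_false (fun h => hx.not_ge (hc₂ (Or.inr h))) fun h => hy.not_ge (hc₂ (Or.inr h))
  · have h1 := lt_of_le_of_lt (hc₂ (Or.inl he)) hx
    have h2 := lt_of_le_of_lt (hc₂ (Or.inl he)) hy
    exact ⟨iff_of_true h1.le h2.le, iff_of_true h1 h2⟩

/-- Let `b` be the least point of `E` bounding `A`, and `c` the greatest point of `E` not bounding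
it. Between them membership in `A` depends only on `Z`. Unless an element of `A` is already a bound,
either `A` contains all points off `Z` there and the supremum is `b`, by density, or it contains
only the points of `Z` there and the supremum is the last of these. -/
theorem exists_isLUB (hZ : IsSparse Z) {A : Set N} (hA : UnaryTame (unarySets Z) A)
    (hne : A.Nonempty) (hbdd : BddAbove A) : ∃ s, IsLUB A s := by
  obtain ⟨E₀, hE₀, H₀⟩ := hA.exists_finite
  obtain ⟨x₀, hx₀⟩ := hne
  obtain ⟨b₀, hb₀⟩ := hbdd
  let E := insert x₀ (insert b₀ E₀)
  have hE : E.Finite := (hE₀.insert _).insert _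
  have H : ∀ x y, (x ∈ Z ↔ y ∈ Z) →
      (∀ e ∈ E, (e ≤ x ↔ e ≤ y) ∧ (e < x ↔ e < y)) → (x ∈ A ↔ y ∈ A) := fun x y h1 h2 =>
    H₀ x y h1 fun e he => h2 e (mem_insert_of_mem _ (mem_insert_of_mem _ he))
  by_cases hx₀u : x₀ ∈ upperBounds A
  · exact ⟨x₀, hx₀u, fun u hu => hu hx₀⟩
  obtain ⟨b, ⟨hbE, hbA⟩, hbmin⟩ := Set.exists_min_image {e ∈ E | e ∈ upperBounds A} id
    (hE.subset (sep_subset _ _)) ⟨b₀, mem_insert_of_mem _ (mem_insert _ _), hb₀⟩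
  obtain ⟨c, ⟨hcE, hcA⟩, hcmax⟩ := Set.exists_max_image {e ∈ E | e ∉ upperBounds A} id
    (hE.subset (sep_subset _ _)) ⟨x₀, mem_insert _ _, hx₀u⟩
  by_cases hbA' : b ∈ A
  · exact ⟨b, hbA, fun u hu => hu hbA'⟩
  have hlt : ∀ x ∈ A, x < b := fun x hx => (hbA hx).lt_of_ne fun e => hbA' (e ▸ hx)
  have cell : ∀ x y, c < x → x < b → c < y → y < b → (x ∈ Z ↔ y ∈ Z) → (x ∈ A ↔ y ∈ A) := by
    intro x y h1 h2 h3 h4 h5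
    refine H x y h5 fun e he => ?_
    by_cases heA : e ∈ upperBounds A
    · have hbe : b ≤ e := hbmin e ⟨he, heA⟩
      have h1 := h2.trans_le hbe
      have h2 := h4.trans_le hbe
      exact ⟨iff_of_false h1.not_ge h2.not_ge, iff_of_false h1.not_gt h2.not_gt⟩
    · have hec : e ≤ c := hcmax e ⟨he, heA⟩
      have h1 := hec.trans_lt h1
      have h2 := hec.trans_lt h3
      exact ⟨iff_of_true h1.le h2.le, iff_of_true h1 h2⟩
  obtain ⟨x₁, hx₁A, hcx₁⟩ : ∃ x ∈ A, c < x := by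
    by_contra! hcon
    exact hcA hcon
  by_cases hAZ : ∃ x ∈ A, c < x ∧ x ∉ Z
  · obtain ⟨x, hxA, hcx, hxZ⟩ := hAZ
    refine ⟨b, hbA, fun u hu => ?_⟩
    by_contra! hub
    obtain ⟨t, htZ, hut, htb⟩ := hZ.dense (max u x) b (max_lt hub (hlt x hxA))
    have htA : t ∈ A := (cell x t hcx (hlt x hxA) (hcx.trans ((le_max_right _ _).trans_lt hut)) htb
      (iff_of_false hxZ htZ)).1 hxA
    exact (hu htA).not_gt ((le_max_left _ _).trans_lt hut)
  · push Not at hAZ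
    have hx₁Z : x₁ ∈ Z := hAZ x₁ hx₁A hcx₁
    obtain ⟨z, hzZ, hzb, hz⟩ := hZ.greatest b ⟨x₁, hx₁Z, hlt x₁ hx₁A⟩
    have hcz : c < z := hcx₁.trans_le (hz x₁ hx₁Z (hlt x₁ hx₁A))
    have hzA : z ∈ A := (cell x₁ z hcx₁ (hlt x₁ hx₁A) hcz hzb (iff_of_true hx₁Z hzZ)).1 hx₁A
    refine ⟨z, fun x hx => ?_, fun u hu => hu hzA⟩
    rcases le_or_gt x c with hxc | hxc
    · exact hxc.trans hcz.le
    · exact hz x (hAZ x hx hxc) (hlt x hx)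

end IsSparse

theorem IsProjection.isSparse [DenselyOrdered N] [NoMinOrder N] [NoMaxOrder N] {a d m : Z}
    {pr : N → Z} {S f : Z ≃ Z} (hp : IsProjection a d pr) (h : IsSmallRotation a d m S f) :
    IsSparse Z where
  left x := by
    obtain ⟨y, -, hyx, e⟩ := hp.exists_lt_up_eq h x
    refine ⟨y, hyx, fun t ht hyt htx => ?_⟩
    lift t to Z using ht
    have h1 := hp.monotone_up h hyt.le
    rw [e, hp.up_coe h, hp.up_le_coe_iff h] at h1
    exact h1.not_gt htx
  right x := by
    classical
    obtain ⟨y, -, hxy, e⟩ := hp.exists_gt_up_eq h x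
    refine ⟨y, hxy, fun t ht hxt hty => ?_⟩
    lift t to Z using ht
    have h1 : up a d pr y ≤ up a d pr t := by
      rw [e]
      split_ifs with hx
      · rw [← h.lt_iff_succ_le, hp.up_coe h ⟨x, hx⟩, hp.up_coe h, Prod.Lex.toLex_lt_toLex]
        exact Or.inr ⟨rfl, hxt⟩
      · exact hp.monotone_up h hxt.le
    rw [hp.up_coe h, hp.up_le_coe_iff h] at h1
    exact h1.not_gt hty
  dense x y hxy := IsProjection.exists_notMem_between h hxy
  greatest x := by
    rintro ⟨t, ht, htx⟩
    rcases le_or_gt x d with hxd | hxd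
    · obtain ⟨z, hz⟩ := S.surjective (pr x)
      have hzd : z ≠ d := by
        rintro rfl
        rw [h.S_top] at hz
        exact (htx.trans_le ((hp.le_pr x hxd).trans_eq (congrArg _ hz.symm))).not_ge
          (h.bot_le ⟨t, ht⟩)
      refine ⟨z, z.2, ?_, fun s hs hsx => ?_⟩
      · by_contra! hxz
        exact (hp.pr_le x z hxz).not_gt (hz ▸ h.lt_S z hzd)
      · by_contra! hzs
        have h1 := h.S_le z ⟨s, hs⟩ hzs
        rw [hz] at h1
        exact (hsx.trans_le (hp.le_pr x hxd)).not_ge h1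
    · exact ⟨d, d.2, hxd, fun s hs _ => h.le_top ⟨s, hs⟩⟩
  bddBelow := ⟨a, fun t ht => h.bot_le ⟨t, ht⟩⟩
  bddAbove := ⟨d, fun t ht => h.le_top ⟨t, ht⟩⟩

end Line


/-! ### Models of `T₁` -/

theorem infinite_subtype {M : Type u} {Y : Set M} {p : M → Prop} (h : (Y ∩ {x | p x}).Infinite) :
    {x : Y | p x.1}.Infinite := by
  intro hfin
  refine h ((hfin.image Subtype.val).subset ?_)
  rintro x ⟨hx, hpx⟩
  exact ⟨⟨x, hx⟩, hpx, rfl⟩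

open FirstOrder.Language in
theorem definable_Z {M : Type u} [L₀.Structure M] [LFG.Structure M] : (univ : Set (Shift M)).Definable L₁
    {v : Fin 1 → Shift M | v 0 ∈ Z (Shift M)} := by
  let R : L₁.Relations 1 := Sum.inl Rel₀.Z
  refine Definable.mono (A := ∅) (empty_definable_iff.2
    ⟨R.formula₁ (Term.var 0), ?_⟩) (empty_subset _)
  ext v
  exact (Formula.realize_rel₁ (M := Shift M) (R := R) (t := Term.var 0) (v := v)).symm

open FirstOrder.Language in
theorem definable_graph {M : Type u} [L₀.Structure M] [LFG.Structure M] : (univ : Set (Shift M)).Definable L₁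
    {p : Fin 1 ⊕ Fin 1 → Shift M |
      p (Sum.inl 0) ∈ Z (Shift M) ∧ p (Sum.inr 0) = f (p (Sum.inl 0))} := by
  let R : L₁.Relations 1 := Sum.inl Rel₀.Z
  let φ : L₁.Functions 1 := Sum.inr FuncFG.f
  let t : L₁.Term (Fin 1 ⊕ Fin 1) := Term.var (Sum.inl 0)
  refine Definable.mono (A := ∅) (empty_definable_iff.2
    ⟨R.formula₁ t ⊓ (Term.var (Sum.inr 0)).equal (φ.apply₁ t), ?_⟩) (empty_subset _)
  ext p
  refine Iff.trans (and_congr ?_ ?_) Formula.realize_inf.symm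
  · exact (Formula.realize_rel₁ (M := Shift M) (R := R) (t := t) (v := p)).symm
  · rw [Formula.realize_equal, Term.realize_functions_apply₁]
    rfl

namespace IsModelT₁

variable {M : Type u} [LinearOrder M] [L₀.Structure M] [LFG.Structure M]

theorem c₁_mem (h : IsModelT₁ M) : c₁ M ∈ Z M := h.modelT₀.isLeast.1

theorem c₄_mem (h : IsModelT₁ M) : c₄ M ∈ Z M := h.modelT₀.isGreatest.1

theorem c₁_le (h : IsModelT₁ M) {x : M} (hx : x ∈ Z M) : c₁ M ≤ x := h.modelT₀.isLeast.2 hx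

theorem le_c₄ (h : IsModelT₁ M) {x : M} (hx : x ∈ Z M) : x ≤ c₄ M := h.modelT₀.isGreatest.2 hx

theorem c₁_lt_c₄ (h : IsModelT₁ M) : c₁ M < c₄ M :=
  h.modelT₀.c₁_lt_c₂.trans (h.modelT₀.c₂_lt_c₃.trans h.modelT₀.c₃_lt_c₄)

theorem S_of_notMem (h : IsModelT₁ M) {x : M} (hx : x ∉ Z M) : S x = x :=
  (h.modelT₀.S_iff x x).2 (Or.inl ⟨hx, rfl⟩)

theorem S_mem (h : IsModelT₁ M) {x : M} (hx : x ∈ Z M) : S x ∈ Z M := by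
  rcases (h.modelT₀.S_iff x (S x)).1 rfl with h1 | h1
  · exact absurd hx h1.1
  · exact h1.2.1

theorem P_of_notMem (h : IsModelT₁ M) {x : M} (hx : x ∉ Z M) : P x = x := by
  conv_lhs => rw [← h.S_of_notMem hx]
  exact h.modelT₀.P_S x

theorem P_mem (h : IsModelT₁ M) {x : M} (hx : x ∈ Z M) : P x ∈ Z M := by
  by_contra hP
  have := h.S_of_notMem hP
  rw [h.modelT₀.S_P] at this
  exact hP (this ▸ hx)

theorem S_c₄ (h : IsModelT₁ M) : S (c₄ M) = c₁ M := by
  refine (h.modelT₀.S_iff _ _).2 (Or.inr ⟨h.c₄_mem, h.c₁_mem, h.c₁_lt_c₄.ne', ?_⟩)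
  rintro ⟨z, hz, h1 | h1 | h1⟩
  · exact h1.1.not_ge (h.le_c₄ hz)
  · exact h1.1.not_ge (h.c₁_le hz)
  · exact h1.2.not_ge (h.le_c₄ hz)

theorem exists_S_eq (h : IsModelT₁ M) {x : M} (hx : x ∈ Z M) (hx' : x ≠ c₄ M) :
    x < S x ∧ ∀ z ∈ Z M, ¬ (x < z ∧ z < S x) := by
  obtain ⟨y, hy, hxy, H⟩ := h.modelT₀.exists_succ x hx
    ⟨c₄ M, h.c₄_mem, (h.le_c₄ hx).lt_of_ne hx'⟩
  have : S x = y := by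
    refine (h.modelT₀.S_iff _ _).2 (Or.inr ⟨hx, hy, hxy.ne, ?_⟩)
    rintro ⟨z, hz, h1 | h1 | h1⟩
    · exact H z hz h1
    · exact lt_asymm hxy h1.2
    · exact lt_asymm hxy h1.1
  rw [this]
  exact ⟨hxy, H⟩

/-- The successor map on `Z`. -/
def succEquiv (h : IsModelT₁ M) : Z M ≃ Z M where
  toFun x := ⟨S x.1, h.S_mem x.2⟩
  invFun x := ⟨P x.1, h.P_mem x.2⟩
  left_inv x := Subtype.ext (h.modelT₀.P_S x)
  right_inv x := Subtype.ext (h.modelT₀.S_P x)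

theorem f_of_le (h : IsModelT₁ M) {x : M} (hx : x ∈ Z M) (hxc : x ≤ c₂ M) :
    f x ∈ Z M ∧ c₃ M ≤ f x := by
  have : f x ∈ f '' (Z M ∩ Icc (c₁ M) (c₂ M)) := mem_image_of_mem _ ⟨hx, h.c₁_le hx, hxc⟩
  rw [h.f_image_left] at this
  exact ⟨this.1, this.2.1⟩

theorem f_of_gt (h : IsModelT₁ M) {x : M} (hx : x ∈ Z M) (hxc : c₂ M < x) :
    f x ∈ Z M ∧ f x < c₃ M := by
  have : f x ∈ f '' (Z M ∩ Ioc (c₂ M) (c₄ M)) := mem_image_of_mem _ ⟨hx, hxc, h.le_c₄ hx⟩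
  rw [h.f_image_right] at this
  exact ⟨this.1, this.2.2⟩

theorem f_mem (h : IsModelT₁ M) {x : M} (hx : x ∈ Z M) : f x ∈ Z M :=
  (le_or_gt x (c₂ M)).elim (fun h1 => (h.f_of_le hx h1).1) fun h1 => (h.f_of_gt hx h1).1

theorem exists_f_eq (h : IsModelT₁ M) {y : M} (hy : y ∈ Z M) : ∃ x ∈ Z M, f x = y := by
  rcases le_or_gt (c₃ M) y with hyc | hyc
  · have : y ∈ Z M ∩ Icc (c₃ M) (c₄ M) := ⟨hy, hyc, h.le_c₄ hy⟩
    rw [← h.f_image_left] at this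
    obtain ⟨x, hx, hxy⟩ := this
    exact ⟨x, hx.1, hxy⟩
  · have : y ∈ Z M ∩ Ico (c₁ M) (c₃ M) := ⟨hy, h.c₁_le hy, hyc⟩
    rw [← h.f_image_right] at this
    obtain ⟨x, hx, hxy⟩ := this
    exact ⟨x, hx.1, hxy⟩

/-- The restriction of `f` to `Z`. -/
noncomputable def fEquiv (h : IsModelT₁ M) : Z M ≃ Z M :=
  Equiv.ofBijective (fun x => ⟨f x.1, h.f_mem x.2⟩)
    ⟨fun _ _ hxy => Subtype.ext (h.f_bijective.1 (Subtype.ext_iff.1 hxy)), fun y => by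
      obtain ⟨x, hx, hxy⟩ := h.exists_f_eq y.2
      exact ⟨⟨x, hx⟩, Subtype.ext hxy⟩⟩

theorem fEquiv_coe (h : IsModelT₁ M) (x : Z M) : (h.fEquiv x : M) = f (x : M) := rfl

theorem succEquiv_coe (h : IsModelT₁ M) (x : Z M) : (h.succEquiv x : M) = S (x : M) := rfl

theorem iterate_fEquiv_coe (h : IsModelT₁ M) (n : ℕ) (x : Z M) :
    (h.fEquiv^[n] x : M) = f^[n] (x : M) := by
  induction n generalizing x with
  | zero => rfl
  | succ n ih => rw [Function.iterate_succ_apply, ih, fEquiv_coe, Function.iterate_succ_apply]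

theorem iterate_succEquiv_coe (h : IsModelT₁ M) (n : ℕ) (x : Z M) :
    (h.succEquiv^[n] x : M) = S^[n] (x : M) := by
  induction n generalizing x with
  | zero => rfl
  | succ n ih => rw [Function.iterate_succ_apply, ih, succEquiv_coe, Function.iterate_succ_apply]

theorem isSmallRotation (h : IsModelT₁ M) :
    IsSmallRotation (⟨c₁ M, h.c₁_mem⟩ : Z M) ⟨c₄ M, h.c₄_mem⟩ ⟨c₂ M, h.modelT₀.c₂_mem⟩
      h.succEquiv h.fEquiv where
  bot_le x := h.c₁_le x.2
  le_top x := h.le_c₄ x.2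
  S_top := Subtype.ext h.S_c₄
  lt_S x hx := (h.exists_S_eq x.2 fun e => hx (Subtype.ext e)).1
  S_le x y hxy := by
    have hx : (x : M) ≠ c₄ M := fun e => (h.le_c₄ y.2).not_gt (e ▸ hxy)
    by_contra! hlt
    exact (h.exists_S_eq x.2 hx).2 y y.2 ⟨hxy, hlt⟩
  mono_left x hx y hy hxy := h.f_strictMono_left ⟨x.2, h.c₁_le x.2, hx⟩ ⟨y.2, h.c₁_le y.2, hy⟩ hxy
  mono_right x hx y hy hxy := h.f_strictMono_right ⟨x.2, hx, h.le_c₄ x.2⟩ ⟨y.2, hy, h.le_c₄ y.2⟩ hxy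
  right_lt_left x hx y hy := (h.f_of_gt y.2 hy).2.trans_le (h.f_of_le x.2 hx).2
  lt_left x hx := h.modelT₀.c₂_lt_c₃.trans_le (h.f_of_le x.2 hx).2
  cyc k n hn hnk z := by
    have := h.f_cyc k n hn hnk z z.2
    rwa [← h.iterate_fEquiv_coe, ← h.iterate_fEquiv_coe] at this
  forward n hn z := by
    have := infinite_subtype (h.infinite_forward n hn z z.2)
    rwa [← h.iterate_fEquiv_coe] at this
  backward n hn z := by
    have := infinite_subtype (h.infinite_backward n hn z z.2)
    rwa [← h.iterate_fEquiv_coe] at this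
  infinite := (h.modelT₀.infinite₁₂.mono inter_subset_left).to_subtype

/-- The projection to `Z`. -/
def projZ (h : IsModelT₁ M) (x : M) : Z M := ⟨proj x, h.modelT₀.proj_mem x⟩

theorem isProjection (h : IsModelT₁ M) :
    IsProjection (⟨c₁ M, h.c₁_mem⟩ : Z M) ⟨c₄ M, h.c₄_mem⟩ h.projZ := by
  have hle : ∀ x ≤ c₄ M, x ≤ proj x := by
    intro x hx
    by_contra! hlt
    rcases hx.eq_or_lt with rfl | hx
    · exact hlt.ne (h.modelT₀.proj_of_mem _ h.c₄_mem)
    · exact h.modelT₀.proj_first x (c₄ M) h.c₄_mem (Or.inr (Or.inr ⟨hlt, hx⟩))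
  refine ⟨fun z => Subtype.ext (h.modelT₀.proj_of_mem z z.2), hle, fun x z hxz => ?_, fun x hx => ?_⟩
  · change proj x ≤ z
    by_contra! hlt
    rcases hxz.eq_or_lt with rfl | hxz
    · exact hlt.ne (h.modelT₀.proj_of_mem _ z.2).symm
    · exact h.modelT₀.proj_first x z z.2 (Or.inl ⟨hxz, hlt⟩)
  · refine Subtype.ext (le_antisymm ?_ (h.c₁_le (h.modelT₀.proj_mem x)))
    change proj x ≤ c₁ M
    by_contra! hlt
    exact h.modelT₀.proj_first x (c₁ M) h.c₁_mem
      (Or.inr (Or.inl ⟨hlt, (h.le_c₄ (h.modelT₀.proj_mem x)).trans_lt hx⟩))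

/-! ### The shifted maps -/

theorem iterate_S_of_notMem (h : IsModelT₁ M) {x : M} (hx : x ∉ Z M) (n : ℕ) : S^[n] x = x := by
  induction n with
  | zero => rfl
  | succ n ih => rw [Function.iterate_succ_apply, h.S_of_notMem hx, ih]

theorem shiftF_of_notMem (h : IsModelT₁ M) {x : M} (hx : x ∉ Z M) : shiftF x = x := by
  rw [shiftF, if_neg, h.f_of_notMem x hx]
  rintro ⟨n, hn⟩
  rw [h.iterate_S_of_notMem hx] at hn
  exact hx (hn ▸ h.c₄_mem)

theorem g_of_notMem (h : IsModelT₁ M) {x : M} (hx : x ∉ Z M) : g x = x := by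
  conv_lhs => rw [← h.f_of_notMem x hx]
  exact h.g_f x

theorem shiftG_of_notMem (h : IsModelT₁ M) {x : M} (hx : x ∉ Z M) : shiftG x = x := by
  rw [shiftG, if_neg, h.g_of_notMem hx]
  rintro ⟨n, hn⟩
  rw [h.iterate_S_of_notMem hx] at hn
  exact hx (hn ▸ h.P_mem h.modelT₀.c₃_mem)

theorem f_c₁ (h : IsModelT₁ M) : f (c₁ M) = c₃ M := by
  refine le_antisymm ?_ (h.f_of_le h.c₁_mem h.modelT₀.c₁_lt_c₂.le).2
  have : c₃ M ∈ Z M ∩ Icc (c₃ M) (c₄ M) := ⟨h.modelT₀.c₃_mem, le_rfl, h.modelT₀.c₃_lt_c₄.le⟩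
  rw [← h.f_image_left] at this
  obtain ⟨x, hx, hxc⟩ := this
  conv_rhs => rw [← hxc]
  exact h.f_strictMono_left.monotoneOn ⟨h.c₁_mem, le_rfl, h.modelT₀.c₁_lt_c₂.le⟩ hx hx.2.1

/-- The lift of `f` is an automorphism of a discrete order, hence commutes with its successor;
project to `Z`. -/
theorem f_S (h : IsModelT₁ M) {x : M} (hx : x ∈ Z M) : f (S x) = S (f x) := by
  have h1 := h.isSmallRotation.succ_orderIso h.isSmallRotation.liftF (toLex (0, ⟨x, hx⟩))
  have h2 := congrArg (fun u => ((ofLex u).2 : M)) h1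
  exact h2

theorem f_iterate_S (h : IsModelT₁ M) {x : M} (hx : x ∈ Z M) (n : ℕ) :
    f (S^[n] x) = S^[n] (f x) := by
  induction n generalizing x with
  | zero => rfl
  | succ n ih => rw [Function.iterate_succ_apply, ih (h.S_mem hx), h.f_S hx,
      Function.iterate_succ_apply]

theorem f_c₄ (h : IsModelT₁ M) : f (c₄ M) = P (c₃ M) := by
  rw [← h.f_c₁, ← h.S_c₄, h.f_S h.c₄_mem, h.modelT₀.P_S]

/-- Matches the case distinctions in `shiftF` and `shiftG`: distance to `c₄` before `f` is distance
to `P c₃` after it. -/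
theorem near_f_iff (h : IsModelT₁ M) {x : M} (hx : x ∈ Z M) (n : ℕ) :
    S^[n] (f x) = P (c₃ M) ↔ S^[n] x = c₄ M := by
  rw [← h.f_iterate_S hx, ← h.f_c₄, h.f_bijective.1.eq_iff]

theorem shiftG_shiftF (h : IsModelT₁ M) {x : M} (hx : x ∈ Z M) : shiftG (shiftF x) = x := by
  by_cases hn : ∃ n : ℕ, S^[n] x = c₄ M
  · obtain ⟨n, hn'⟩ := hn
    -- The shift back by `P` puts the point one step further from `P c₃`.
    have : S^[n + 1] (P (f x)) = P (c₃ M) := by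
      rwa [Function.iterate_succ_apply, h.modelT₀.S_P, h.near_f_iff hx]
    rw [shiftF, if_pos ⟨n, hn'⟩, shiftG, if_pos ⟨n + 1, this⟩, h.modelT₀.S_P, h.g_f]
  · rw [shiftF, if_neg hn, shiftG, if_neg, h.g_f]
    simpa only [h.near_f_iff hx] using hn

theorem base_succ (h : IsModelT₁ M) (u : ℤ ×ₗ Z M) :
    base (h.isSmallRotation.succ u) = S (base u) := rfl

theorem base_succ_symm (h : IsModelT₁ M) (u : ℤ ×ₗ Z M) :
    base (h.isSmallRotation.succ.symm u) = P (base u) :=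
  congrArg Subtype.val (h.isSmallRotation.succ_symm_snd u)

theorem near_iff (h : IsModelT₁ M) (z : Z M) :
    (∃ n : ℕ, h.succEquiv^[n] z = ⟨c₄ M, h.c₄_mem⟩) ↔ ∃ n : ℕ, S^[n] (z : M) = c₄ M := by
  simp only [Subtype.ext_iff, h.iterate_succEquiv_coe]

theorem base_shiftedF (h : IsModelT₁ M) (u : ℤ ×ₗ Z M) :
    base (h.isSmallRotation.shiftedF u) = shiftF (base u) := by
  by_cases hu : ∃ n : ℕ, S^[n] (base u) = c₄ M
  · rw [shiftF, if_pos hu, h.isSmallRotation.shiftedF_of_near ((h.near_iff _).2 hu),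
      h.base_succ_symm]
    rfl
  · rw [shiftF, if_neg hu,
      h.isSmallRotation.shiftedF_of_not_near (mt (h.near_iff _).1 hu)]
    rfl

/-- At values of `shiftedF` both adjoints invert it. At the skipped value over `P c₃` the modified
`g` takes the value `c₁`, the successor of `c₄`: it rounds up, as the lower adjoint does, whereas
`shiftedG` rounds down to `c₄`. -/
theorem base_lower_adjoint (h : IsModelT₁ M) (u : ℤ ×ₗ Z M) :
    base (h.isSmallRotation.succ (h.isSmallRotation.shiftedG (h.isSmallRotation.succ.symm u))) =
      shiftG (base u) := by
  have hr := h.isSmallRotation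
  obtain ⟨v, rfl⟩ := hr.liftF.surjective u
  by_cases hv : (ofLex v).2 = ⟨c₄ M, h.c₄_mem⟩
  · rw [← hr.shiftedF_of_near ⟨0, hv⟩, hr.isCover.G_F, h.base_succ]
    have h1 : base v = c₄ M := congrArg Subtype.val hv
    have h2 : base (hr.liftF v) = P (c₃ M) := (congrArg f h1).trans h.f_c₄
    rw [h1, h2, h.S_c₄, shiftG, if_pos ⟨0, rfl⟩, h.modelT₀.S_P, ← h.f_c₁, h.g_f]
  · obtain ⟨w, hw⟩ := hr.mem_range_shiftedF hv
    have : hr.succ (hr.shiftedG (hr.succ.symm (hr.shiftedF w))) = w :=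
      eq_of_forall_ge_iff fun x => by
        rw [hr.isCover.lower_adjoint, hr.shiftedF_strictMono.le_iff_le]
    rw [← hw, this, h.base_shiftedF]
    exact (h.shiftG_shiftF (ofLex w).2.2).symm

theorem up_eq_base (h : IsModelT₁ M) (x : M) :
    proj x = base (up ⟨c₁ M, h.c₁_mem⟩ ⟨c₄ M, h.c₄_mem⟩ h.projZ x) :=
  (congrArg Subtype.val (h.isProjection.snd_up x)).symm

/-! ### Tameness of the shifted structure and its consequences. -/

theorem isInterpretation (h : IsModelT₁ M) :
    IsInterpretation (N := Shift M) (Z M) ⟨c₁ M, h.c₁_mem⟩ ⟨c₄ M, h.c₄_mem⟩ h.projZ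
      h.isSmallRotation.succ (translation (Z M)) h.isSmallRotation.shiftedF
      h.isSmallRotation.shiftedG where
  func₀ φ := by
    cases φ with
    | S => exact ⟨⟨_, .S, fun u => rfl⟩, Or.inl fun x hx => h.S_of_notMem hx⟩
    | P => exact ⟨⟨_, .S_symm, fun u => (h.base_succ_symm u).symm⟩,
        Or.inl fun x hx => h.P_of_notMem hx⟩
    | π => exact ⟨⟨_, .id, fun u => h.modelT₀.proj_of_mem _ (ofLex u).2.2⟩,
        Or.inr fun x hx => h.up_eq_base x⟩
  funcFG φ := by
    cases φ with
    | f => exact ⟨⟨_, .F, fun u => (h.base_shiftedF u).symm⟩,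
        Or.inl fun x hx => h.shiftF_of_notMem hx⟩
    | g => exact ⟨⟨_, .comp .S (.comp .G .S_symm), fun u => (h.base_lower_adjoint u).symm⟩,
        Or.inl fun x hx => h.shiftG_of_notMem hx⟩
  le v := h.modelT₀.dlo.ordered.relMap_leSymb v
  mem v := by
    refine iff_of_eq (congrArg _ (funext fun i => ?_))
    rw [Subsingleton.elim i 0]
    rfl

theorem isDLOExpansion_shift (h : IsModelT₁ M) : IsDLOExpansion L₁ (Shift M) where
  ordered := ⟨h.modelT₀.dlo.ordered.relMap_leSymb⟩
  nonempty := h.modelT₀.dlo.nonempty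
  dense := h.modelT₀.dlo.dense
  noMin := h.modelT₀.dlo.noMin
  noMax := h.modelT₀.dlo.noMax

theorem unaryTame (h : IsModelT₁ M) {A : Set (Shift M)}
    (hA : (univ : Set (Shift M)).Definable₁ L₁ A) :
    UnaryTame (unarySets (Z (Shift M))) A :=
  have := h.isDLOExpansion_shift.dense
  have := h.isDLOExpansion_shift.noMin
  have := h.isDLOExpansion_shift.noMax
  unaryTame_of_definable (N := Shift M) h.isProjection h.isSmallRotation h.isInterpretation hA

theorem isSparse (h : IsModelT₁ M) : IsSparse (Z (Shift M)) :=
  have := h.modelT₀.dlo.dense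
  have := h.modelT₀.dlo.noMin
  have := h.modelT₀.dlo.noMax
  h.isProjection.isSparse h.isSmallRotation

theorem definablyComplete (h : IsModelT₁ M) : DefinablyComplete L₁ (Shift M) :=
  fun _ hA => h.isSparse.exists_isLUB (h.unaryTame hA)

theorem typeComplete (h : IsModelT₁ M) : TypeComplete L₁ (Shift M) :=
  have := h.isDLOExpansion_shift.nonempty
  have := h.isDLOExpansion_shift.noMin
  have := h.isDLOExpansion_shift.noMax
  ⟨fun _ hA a => h.isSparse.locally (h.unaryTame hA) a,
    fun _ hA => h.isSparse.at_infinity (h.unaryTame hA)⟩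

theorem shift_mapsTo (h : IsModelT₁ M) : MapsTo f (Z (Shift M)) (Z (Shift M)) := by
  intro x hx
  have : shiftF (M := M) x = base _ := (h.base_shiftedF (toLex (0, ⟨x, hx⟩))).symm
  change shiftF (M := M) x ∈ Z M
  rw [this]
  exact Subtype.coe_prop _

theorem shift_injOn (h : IsModelT₁ M) : InjOn f (Z (Shift M)) := by
  intro x hx y hy hxy
  have := congrArg (shiftG (M := M)) hxy
  exact (h.shiftG_shiftF hx).symm.trans (this.trans (h.shiftG_shiftF hy))

/-- A shifted point with this value would be `c₁`, which no finite number of steps takes to `c₄`. An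
unshifted one would be `c₄`, which is shifted. -/
theorem shiftF_ne (h : IsModelT₁ M) (x : M) : shiftF x ≠ P (c₃ M) := by
  intro e
  by_cases hn : ∃ n : ℕ, S^[n] x = c₄ M
  · obtain ⟨n, hn'⟩ := hn
    rw [shiftF, if_pos ⟨n, hn'⟩] at e
    have e' := congrArg (S (M := M)) e
    rw [h.modelT₀.S_P, h.modelT₀.S_P, ← h.f_c₁] at e'
    rw [h.f_bijective.1 e'] at hn'
    exact h.isSmallRotation.iterate_S_bot_ne n
      (Subtype.ext ((h.iterate_succEquiv_coe _ _).trans hn'))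
  · rw [shiftF, if_neg hn, ← h.f_c₄] at e
    exact hn ⟨0, h.f_bijective.1 e⟩

theorem shift_image (h : IsModelT₁ M) :
    f '' Z (Shift M) = Z (Shift M) \ {P (c₃ (Shift M))} := by
  have hr := h.isSmallRotation
  ext y
  constructor
  · rintro ⟨x, hx, rfl⟩
    exact ⟨h.shift_mapsTo hx, h.shiftF_ne x⟩
  · rintro ⟨hy, hy'⟩
    obtain ⟨x, hx, hxy⟩ := h.exists_f_eq hy
    have hx' : (⟨x, hx⟩ : Z M) ≠ ⟨c₄ M, h.c₄_mem⟩ := fun e => by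
      have e : x = c₄ M := congrArg Subtype.val e
      exact hy' (hxy.symm.trans ((congrArg f e).trans h.f_c₄))
    obtain ⟨u, hu⟩ := hr.mem_range_shiftedF (v := toLex (0, ⟨x, hx⟩)) hx'
    refine ⟨base u, (ofLex u).2.2, ?_⟩
    have := congrArg base hu
    rw [h.base_shiftedF] at this
    exact this.trans hxy

theorem shift_not_surjOn (h : IsModelT₁ M) : ¬ SurjOn f (Z (Shift M)) (Z (Shift M)) := by
  intro hs
  have : P (c₃ (Shift M)) ∈ f '' Z (Shift M) := hs (h.P_mem h.modelT₀.c₃_mem)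
  rw [h.shift_image] at this
  exact this.2 rfl

/-! ### Failure of the pigeonhole principle -/

theorem isPseudoFinite (h : IsModelT₁ M) :
    IsPseudoFinite L₁ {v : Fin 1 → Shift M | v 0 ∈ Z (Shift M)} := by
  let _ : TopologicalSpace (Shift M) := Preorder.topology (Shift M)
  have : OrderTopology (Shift M) := ⟨rfl⟩
  have hclosed : IsClosed (Z (Shift M)) := by
    rw [← isOpen_compl_iff, isOpen_iff_mem_nhds]
    intro x hx
    obtain ⟨a, b, hxab, hd⟩ := h.modelT₀.closed x hx
    exact Filter.mem_of_superset (Ioo_mem_nhds (α := Shift M) hxab.1 hxab.2) hd.subset_compl_right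
  have hdiscrete : IsDiscrete (Z (Shift M)) := by
    refine IsDiscrete.of_nhdsWithin fun x _ => Filter.le_pure_iff.2 ?_
    obtain ⟨y₁, hy₁, H₁⟩ := h.isSparse.left x
    obtain ⟨y₂, hy₂, H₂⟩ := h.isSparse.right x
    refine Filter.mem_of_superset (inter_mem_nhdsWithin _ (Ioo_mem_nhds hy₁ hy₂)) ?_
    rintro t ⟨ht, ht₁, ht₂⟩
    exact le_antisymm (not_lt.1 fun hxt => H₂ t ht hxt ht₂) (not_lt.1 (H₁ t ht ht₁))
  refine ⟨definable_Z, hclosed.preimage (continuous_apply 0),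
    ⟨fun _ => c₁ (Shift M), fun v hv i => ?_⟩, ⟨fun _ => c₄ (Shift M), fun v hv i => ?_⟩, ?_⟩
  · rw [Subsingleton.elim i 0]
    exact h.c₁_le hv
  · rw [Subsingleton.elim i 0]
    exact h.le_c₄ hv
  · refine hdiscrete.preimage (continuous_apply 0).continuousOn fun v w hvw => funext fun i => ?_
    rw [Subsingleton.elim i 0]
    exact hvw

theorem not_pigeonhole (h : IsModelT₁ M) : ¬ PigeonholePrinciple L₁ (Shift M) := by
  intro H
  let X : Set (Fin 1 → Shift M) := {v | v 0 ∈ Z (Shift M)}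
  let φ : X → X := fun v => ⟨fun _ => f (v.1 0), h.shift_mapsTo v.2⟩
  have hφ : IsDefinableSelfMap L₁ φ := by
    refine cast (congrArg (Definable univ L₁) (Set.ext fun p => ⟨fun hp => ?_, ?_⟩))
      (definable_graph (M := M))
    · refine ⟨⟨p ∘ Sum.inl, hp.1⟩, rfl, funext fun i => ?_⟩
      rw [Subsingleton.elim i 0]
      exact hp.2
    · rintro ⟨x, hx, hy⟩
      refine ⟨?_, ?_⟩
      · have hx0 : p (Sum.inl 0) = x.1 0 := congrFun hx 0
        rw [hx0]
        exact x.2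
      · exact (congrFun hy 0).trans (congrArg f (congrFun hx 0).symm)
  have hs := H 1 X h.isPseudoFinite φ hφ fun v w hvw => by
    have := congrFun (congrArg Subtype.val hvw) 0
    refine Subtype.ext (funext fun i => ?_)
    rw [Subsingleton.elim i 0]
    exact h.shift_injOn v.2 w.2 this
  refine h.shift_not_surjOn fun y hy => ?_
  obtain ⟨v, hv⟩ := hs ⟨fun _ => y, hy⟩
  exact ⟨v.1 0, v.2, congrFun (congrArg Subtype.val hv) 0⟩

end IsModelT₁


/-! ### Cyclic orders -/

section Cyc

variable {X : Type u} [LinearOrder X] {a b c : X}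

theorem Cyc.rotate (h : Cyc a b c) : Cyc b c a := by
  unfold Cyc at *
  tauto

theorem Cyc.not_swap (h : Cyc a b c) : ¬ Cyc a c b := by
  unfold Cyc at *
  grind

theorem not_cyc_left : ¬ Cyc a a c := by
  unfold Cyc
  grind

theorem not_cyc_right : ¬ Cyc a b b := by
  unfold Cyc
  grind

end Cyc

/-! ### Rotations of an initial segment of the natural numbers -/

section Rotation

/-- The integers from `0` to `K - 1`, as rational numbers. -/
def segment (K : ℤ) : Set ℚ := {x | ∃ i : ℤ, 0 ≤ i ∧ i < K ∧ (i : ℚ) = x}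

theorem finite_segment (K : ℤ) : (segment K).Finite :=
  ((Set.finite_Ico 0 K).image (fun i : ℤ => (i : ℚ))).subset
    fun _ ⟨i, h0, hK, hi⟩ => ⟨i, ⟨h0, hK⟩, hi⟩

open Classical in
/-- Addition of `a` modulo `K` on `segment K`, the identity elsewhere. -/
noncomputable def rot (K a : ℤ) (x : ℚ) : ℚ :=
  if x ∈ segment K then (((⌊x⌋ + a) % K : ℤ) : ℚ) else x

open Classical in
/-- The cyclic forward projection to `segment K`. -/
noncomputable def cycProj (K : ℤ) (x : ℚ) : ℚ := if 0 ≤ x ∧ x ≤ K - 1 then ⌈x⌉ else 0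

variable {K a b : ℤ} {x y : ℚ}

theorem coe_mem_segment {i : ℤ} : (i : ℚ) ∈ segment K ↔ 0 ≤ i ∧ i < K := by
  refine ⟨?_, fun h => ⟨i, h.1, h.2, rfl⟩⟩
  rintro ⟨j, h0, hK, hj⟩
  rw [Int.cast_inj] at hj
  exact hj ▸ ⟨h0, hK⟩

theorem zero_mem_segment (hK : 0 < K) : (0 : ℚ) ∈ segment K := by
  exact_mod_cast (coe_mem_segment (K := K) (i := 0)).2 ⟨le_rfl, hK⟩

theorem rot_coe {i : ℤ} (h0 : 0 ≤ i) (hK : i < K) : rot K a i = ((i + a) % K : ℤ) := by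
  rw [rot, if_pos (coe_mem_segment.2 ⟨h0, hK⟩), Int.floor_intCast]

theorem rot_of_notMem (hx : x ∉ segment K) : rot K a x = x := if_neg hx

theorem rot_mem (hx : x ∈ segment K) : rot K a x ∈ segment K := by
  obtain ⟨i, h0, hK, rfl⟩ := hx
  rw [rot_coe h0 hK, coe_mem_segment]
  exact ⟨Int.emod_nonneg _ (by omega), Int.emod_lt_of_pos _ (by omega)⟩

theorem rot_rot (K a b : ℤ) (x : ℚ) : rot K a (rot K b x) = rot K (b + a) x := by
  by_cases hx : x ∈ segment K
  · obtain ⟨i, h0, hK, rfl⟩ := hx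
    rw [rot_coe h0 hK, rot_coe h0 hK,
      rot_coe (Int.emod_nonneg _ (by omega)) (Int.emod_lt_of_pos _ (by omega)), Int.emod_add_emod,
      add_assoc]
  · rw [rot_of_notMem hx, rot_of_notMem hx, rot_of_notMem hx]

theorem rot_zero (K : ℤ) (x : ℚ) : rot K 0 x = x := by
  by_cases hx : x ∈ segment K
  · obtain ⟨i, h0, hK, rfl⟩ := hx
    rw [rot_coe h0 hK, add_zero, Int.emod_eq_of_lt h0 hK]
  · exact rot_of_notMem hx

theorem rot_add_self (K a : ℤ) (x : ℚ) : rot K (K + a) x = rot K a x := by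
  by_cases hx : x ∈ segment K
  · obtain ⟨i, h0, hK, rfl⟩ := hx
    rw [rot_coe h0 hK, rot_coe h0 hK, add_left_comm, Int.add_emod_left]
  · rw [rot_of_notMem hx, rot_of_notMem hx]

theorem rot_coe_cases {i : ℤ} (h0 : 0 ≤ i) (hK : i < K) (ha : 0 ≤ a) (haK : a < K) :
    rot K a i = (i + a : ℤ) ∧ i + a < K ∨ rot K a i = (i + a - K : ℤ) ∧ K ≤ i + a := by
  rw [rot_coe h0 hK, Int.cast_inj, Int.cast_inj]
  rcases lt_or_ge (i + a) K with h | h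
  · exact Or.inl ⟨Int.emod_eq_of_lt (by omega) h, h⟩
  · refine Or.inr ⟨?_, h⟩
    rw [← Int.sub_emod_right, Int.emod_eq_of_lt (by omega) (by omega)]

theorem exists_rot (hx : x ∈ segment K) (hy : y ∈ segment K) :
    ∃ c, 0 ≤ c ∧ c < K ∧ rot K c x = y := by
  obtain ⟨i, hi0, hiK, rfl⟩ := hx
  obtain ⟨j, hj0, hjK, rfl⟩ := hy
  refine ⟨(j - i) % K, Int.emod_nonneg _ (by omega), Int.emod_lt_of_pos _ (by omega), ?_⟩
  rw [rot_coe hi0 hiK, Int.add_emod_emod, add_sub_cancel, Int.emod_eq_of_lt hj0 hjK]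

theorem cyc_rot (hx : x ∈ segment K) (ha : 0 < a) (hab : a < b) (hb : b < K) :
    Cyc x (rot K a x) (rot K b x) := by
  obtain ⟨i, h0, hK, rfl⟩ := hx
  unfold Cyc
  rcases rot_coe_cases h0 hK ha.le (hab.trans hb) with ⟨h1, h1'⟩ | ⟨h1, h1'⟩ <;>
  rcases rot_coe_cases h0 hK (ha.trans hab).le hb with ⟨h2, h2'⟩ | ⟨h2, h2'⟩ <;>
  · rw [h1, h2]
    simp only [Int.cast_lt]
    omega

theorem rot_injective_of_lt (hx : x ∈ segment K) (ha : 0 ≤ a) (hb : 0 ≤ b) (haK : a < K)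
    (hbK : b < K) (h : rot K a x = rot K b x) : a = b := by
  obtain ⟨i, h0, hK, rfl⟩ := hx
  rcases rot_coe_cases h0 hK ha haK with ⟨h1, h1'⟩ | ⟨h1, h1'⟩ <;>
  rcases rot_coe_cases h0 hK hb hbK with ⟨h2, h2'⟩ | ⟨h2, h2'⟩ <;>
  · rw [h1, h2, Int.cast_inj] at h
    omega

theorem ne_rot (hx : x ∈ segment K) (ha : 0 < a) (haK : a < K) : x ≠ rot K a x := fun h =>
  ha.ne (rot_injective_of_lt hx le_rfl ha.le (ha.trans haK) haK ((rot_zero K x).trans h))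

theorem not_cyc_rot_one (hx : x ∈ segment K) (hy : y ∈ segment K) :
    ¬ Cyc x y (rot K 1 x) := by
  obtain ⟨c, hc0, hcK, rfl⟩ := exists_rot hx hy
  rcases lt_trichotomy c 1 with hc | rfl | hc
  · obtain rfl : c = 0 := by omega
    rw [rot_zero]
    exact not_cyc_left
  · exact not_cyc_right
  · exact (cyc_rot hx one_pos hc hcK).not_swap

theorem cyc_rot_one (hx : x ∈ segment K) (hy : y ∈ segment K) (hxy : x ≠ y)
    (hxy' : rot K 1 x ≠ y) : Cyc x (rot K 1 x) y := by
  obtain ⟨c, hc0, hcK, rfl⟩ := exists_rot hx hy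
  have h0 : c ≠ 0 := by
    rintro rfl
    exact hxy (rot_zero K x).symm
  have h1 : c ≠ 1 := by
    rintro rfl
    exact hxy' rfl
  exact cyc_rot hx one_pos (by omega) hcK

theorem cycProj_mem (hK : 0 < K) (x : ℚ) : cycProj K x ∈ segment K := by
  rw [cycProj]
  split_ifs with hx
  · rw [coe_mem_segment]
    have h1 : ⌈x⌉ ≤ K - 1 := Int.ceil_le.2 (by exact_mod_cast hx.2)
    exact ⟨Int.ceil_nonneg hx.1, by omega⟩
  · exact zero_mem_segment hK

theorem cycProj_of_mem (hx : x ∈ segment K) : cycProj K x = x := by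
  obtain ⟨i, h0, hK, rfl⟩ := hx
  rw [cycProj, if_pos, Int.ceil_intCast]
  have h1 : i ≤ K - 1 := by omega
  exact ⟨by exact_mod_cast h0, by exact_mod_cast h1⟩

theorem not_cyc_cycProj (hy : y ∈ segment K) : ¬ Cyc x y (cycProj K x) := by
  obtain ⟨i, h0, hK, rfl⟩ := hy
  have h0' : (0 : ℚ) ≤ i := by exact_mod_cast h0
  have hK' : (i : ℚ) ≤ K - 1 := by
    have h1 : i ≤ K - 1 := by omega
    exact_mod_cast h1
  rw [cycProj]
  split_ifs with hx
  · have h1 : x ≤ i → (⌈x⌉ : ℚ) ≤ i := fun h => by exact_mod_cast Int.ceil_le.2 h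
    have h2 := Int.le_ceil x
    rintro (h | h | h)
    · exact (h1 h.1.le).not_gt h.2
    · exact h2.not_gt h.2
    · exact h2.not_gt h.1
  · rintro (h | h | h)
    · exact h0'.not_gt h.2
    · exact h0'.not_gt h.1
    · exact hx ⟨h.1.le, (h.2.trans_le hK').le⟩

theorem disjoint_segment (hx : x ∉ segment K) :
    x ∈ Ioo ((⌈x⌉ : ℚ) - 1) (⌊x⌋ + 1) ∧ ∀ y ∈ segment K, y ∉ Ioo ((⌈x⌉ : ℚ) - 1) (⌊x⌋ + 1) := by
  refine ⟨⟨by linarith [Int.ceil_lt_add_one x], Int.lt_floor_add_one x⟩, ?_⟩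
  rintro y ⟨j, h0, hK, rfl⟩ ⟨h1, h2⟩
  have h1 : ⌈x⌉ - 1 < j := by exact_mod_cast h1
  have h2 : j < ⌊x⌋ + 1 := by exact_mod_cast h2
  have h3 : x ≤ j := Int.ceil_le.1 (by omega)
  have h4 : (j : ℚ) ≤ x := Int.le_floor.1 (by omega)
  exact hx ⟨j, h0, hK, h4.antisymm h3⟩

end Rotation


/-! ### Automorphisms and o-minimality -/

section Automorphisms

/-- The inverse of the pointwise maximum is the minimum of the inverses. This builds piecewise
affine automorphisms without gluing. -/
theorem exists_orderIso_max {X : Type u} [LinearOrder X] (σ τ : X ≃o X) :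
    ∃ ρ : X ≃o X, (∀ x, ρ x = max (σ x) (τ x)) ∧ ∀ x, ρ.symm x = min (σ.symm x) (τ.symm x) := by
  refine ⟨StrictMono.orderIsoOfRightInverse (fun x => max (σ x) (τ x))
    (fun x y hxy => max_lt_max (σ.strictMono hxy) (τ.strictMono hxy))
    (fun x => min (σ.symm x) (τ.symm x)) fun y => ?_, fun x => rfl, fun x => rfl⟩
  rcases le_total (σ.symm y) (τ.symm y) with h | h
  · have h1 := τ.monotone h
    rw [τ.apply_symm_apply] at h1
    simpa [min_eq_left h] using h1
  · have h1 := σ.monotone h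
    rw [σ.apply_symm_apply] at h1
    simpa [min_eq_right h] using h1

theorem exists_orderIso_min {X : Type u} [LinearOrder X] (σ τ : X ≃o X) :
    ∃ ρ : X ≃o X, ∀ x, ρ x = min (σ x) (τ x) :=
  let ⟨ρ, _, hρ⟩ := exists_orderIso_max σ.symm τ.symm
  ⟨ρ.symm, hρ⟩

theorem exists_orderIso_affine {k : Type u} [Field k] [LinearOrder k] [IsStrictOrderedRing k]
    (p : k) {s : k} (hs : 0 < s) : ∃ σ : k ≃o k, ∀ t, σ t = (t - p) * s + p :=
  ⟨((OrderIso.addRight (-p)).trans (OrderIso.mulRight₀ s hs)).trans (OrderIso.addRight p),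
    fun t => by simp [sub_eq_add_neg]⟩

/-- The map is `max id (min σ τ)`, where `σ` stretches away from `p`, `τ` contracts towards `q`, and
both take `x` to `y`. Below `p` the map `σ`, and above `q` the map `τ`, is at most the identity, so
the maximum fixes these points. -/
theorem exists_orderIso_of_Ioo {k : Type u} [Field k] [LinearOrder k] [IsStrictOrderedRing k]
    {p q x y : k} (hp : p < x) (hxy : x < y) (hq : y < q) :
    ∃ ρ : k ≃o k, ρ x = y ∧ ∀ t, t ≤ p ∨ q ≤ t → ρ t = t := by
  have h1 : 0 < x - p := sub_pos.2 hp
  have h2 : 0 < q - x := sub_pos.2 (hxy.trans hq)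
  have h3 : 1 ≤ (y - p) / (x - p) := by
    rw [one_le_div h1]
    linarith
  have h4 : (q - y) / (q - x) ≤ 1 := by
    rw [div_le_one h2]
    linarith
  obtain ⟨σ, hσ⟩ := exists_orderIso_affine p (zero_lt_one.trans_le h3)
  obtain ⟨τ, hτ⟩ := exists_orderIso_affine q (div_pos (sub_pos.2 hq) h2)
  obtain ⟨μ, hμ⟩ := exists_orderIso_min σ τ
  obtain ⟨ρ, hρ, -⟩ := exists_orderIso_max (OrderIso.refl k) μ
  refine ⟨ρ, ?_, ?_⟩
  · have hσx : σ x = y := by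
      rw [hσ]
      field_simp
      ring
    have hτx : τ x = y := by
      rw [hτ]
      field_simp
      ring
    rw [hρ, hμ, hσx, hτx, min_self]
    exact max_eq_right hxy.le
  · rintro t (ht | ht)
    · rw [hρ, hμ]
      refine max_eq_left ((min_le_left _ _).trans ?_)
      rw [hσ]
      change _ ≤ t
      nlinarith
    · rw [hρ, hμ]
      refine max_eq_left ((min_le_right _ _).trans ?_)
      rw [hτ]
      change _ ≤ t
      nlinarith

/-- `x` and `y` have the same position relative to the points of `E`. -/
def SameCut {X : Type u} [LinearOrder X] (E : Set X) (x y : X) : Prop :=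
  ∀ e ∈ E, (e < x ↔ e < y) ∧ (x < e ↔ y < e)

theorem SameCut.symm {X : Type u} [LinearOrder X] {E : Set X} {x y : X} (h : SameCut E x y) :
    SameCut E y x := fun e he => ⟨(h e he).1.symm, (h e he).2.symm⟩

theorem SameCut.exists_orderIso {k : Type u} [Field k] [LinearOrder k] [IsStrictOrderedRing k]
    {E : Set k} (hE : E.Finite) {x y : k} (h : SameCut E x y) :
    ∃ ρ : k ≃o k, ρ x = y ∧ ∀ e ∈ E, ρ e = e := by
  wlog hxy : x < y generalizing x y
  · rcases (not_lt.1 hxy).eq_or_lt with rfl | hlt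
    · exact ⟨OrderIso.refl k, rfl, fun _ _ => rfl⟩
    · obtain ⟨ρ, h1, h2⟩ := this h.symm hlt
      exact ⟨ρ.symm, ρ.symm_apply_eq.2 h1.symm, fun e he => ρ.symm_apply_eq.2 (h2 e he).symm⟩
  obtain ⟨p, hp, -, hpE⟩ := exists_lt_forall_le hE (sub_one_lt x)
  obtain ⟨q, hq, -, hqE⟩ := exists_gt_forall_ge hE (lt_add_one y)
  obtain ⟨ρ, h1, h2⟩ := exists_orderIso_of_Ioo hp hxy hq
  refine ⟨ρ, h1, fun e he => h2 e ?_⟩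
  rcases lt_trichotomy e x with hlt | rfl | hlt
  · exact Or.inl (hpE e he hlt)
  · exact absurd ((h e he).1.2 hxy) (lt_irrefl e)
  · exact Or.inr (hqE e he ((h e he).2.1 hlt))

theorem isPointOrInterval_sameCut {X : Type u} [LinearOrder X] {E : Set X} (hE : E.Finite)
    (x : X) : IsPointOrInterval {y | SameCut E x y} := by
  by_cases hx : x ∈ E
  · refine Or.inl ⟨x, Set.ext fun y => ⟨fun h => ?_, ?_⟩⟩
    · exact le_antisymm (not_lt.1 (mt (h x hx).1.2 (lt_irrefl x)))
        (not_lt.1 (mt (h x hx).2.2 (lt_irrefl x)))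
    · rintro rfl
      exact fun _ _ => ⟨Iff.rfl, Iff.rfl⟩
  have hl : {y | ∀ e ∈ E, e < x → e < y} = univ ∨ ∃ a, {y | ∀ e ∈ E, e < x → e < y} = Ioi a := by
    by_cases hne : {e ∈ E | e < x}.Nonempty
    · obtain ⟨a, ha, H⟩ := Set.exists_max_image _ id (hE.subset (sep_subset E _)) hne
      exact Or.inr ⟨a, Set.ext fun y => ⟨fun h => h a ha.1 ha.2,
        fun h e he hex => (H e ⟨he, hex⟩).trans_lt h⟩⟩
    · exact Or.inl (eq_univ_of_forall fun y e he hex => absurd ⟨e, he, hex⟩ hne)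
  have hr : {y | ∀ e ∈ E, x < e → y < e} = univ ∨ ∃ b, {y | ∀ e ∈ E, x < e → y < e} = Iio b := by
    by_cases hne : {e ∈ E | x < e}.Nonempty
    · obtain ⟨b, hb, H⟩ := Set.exists_min_image _ id (hE.subset (sep_subset E _)) hne
      exact Or.inr ⟨b, Set.ext fun y => ⟨fun h => h b hb.1 hb.2,
        fun h e he hex => h.trans_le (H e ⟨he, hex⟩)⟩⟩
    · exact Or.inl (eq_univ_of_forall fun y e he hex => absurd ⟨e, he, hex⟩ hne)
  have hcut : {y | SameCut E x y} =
      {y | ∀ e ∈ E, e < x → e < y} ∩ {y | ∀ e ∈ E, x < e → y < e} := by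
    ext y
    refine ⟨fun h => ⟨fun e he => (h e he).1.1, fun e he => (h e he).2.1⟩,
      fun h e he => ⟨⟨h.1 e he, fun hey => ?_⟩, ⟨h.2 e he, fun hye => ?_⟩⟩⟩
    · rcases lt_trichotomy e x with hlt | rfl | hlt
      · exact hlt
      · exact absurd he hx
      · exact absurd hey (h.2 e he hlt).not_gt
    · rcases lt_trichotomy e x with hlt | rfl | hlt
      · exact absurd hye (h.1 e he hlt).not_gt
      · exact absurd he hx
      · exact hlt
  rw [hcut]
  rcases hl with hl | ⟨a, hl⟩ <;> rcases hr with hr | ⟨b, hr⟩ <;> rw [hl, hr]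
  · exact Or.inr (Or.inr (Or.inr (Or.inr (univ_inter _))))
  · exact Or.inr (Or.inr (Or.inl ⟨b, univ_inter _⟩))
  · exact Or.inr (Or.inr (Or.inr (Or.inl ⟨a, inter_univ _⟩)))
  · exact Or.inr (Or.inl ⟨a, b, rfl⟩)

theorem exists_finite_sUnion {X : Type u} [LinearOrder X] {E A : Set X} (hE : E.Finite)
    (hA : ∀ x y, SameCut E x y → x ∈ A → y ∈ A) :
    ∃ F : Set (Set X), F.Finite ∧ (∀ I ∈ F, IsPointOrInterval I) ∧ A = ⋃₀ F := by
  refine ⟨(fun x => {y | SameCut E x y}) '' A, ?_, ?_, ?_⟩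
  -- A cut is determined by the points of `E` below it and those above it, so there are finitely
  -- many.
  · refine ((hE.finite_subsets.prod hE.finite_subsets).image fun U : Set X × Set X =>
      {y | ∀ e ∈ E, (e ∈ U.1 ↔ e < y) ∧ (e ∈ U.2 ↔ y < e)}).subset ?_
    rintro _ ⟨x, -, rfl⟩
    refine ⟨({e ∈ E | e < x}, {e ∈ E | x < e}), ⟨sep_subset _ _, sep_subset _ _⟩, ?_⟩
    ext y
    refine forall₂_congr fun e he => ?_
    simp only [mem_ofPred_eq, he, true_and]
  · rintro _ ⟨x, -, rfl⟩
    exact isPointOrInterval_sameCut hE x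
  · ext y
    refine ⟨fun hy => ⟨_, mem_image_of_mem _ hy, fun _ _ => ⟨Iff.rfl, Iff.rfl⟩⟩, ?_⟩
    rintro ⟨_, ⟨x, hx, rfl⟩, hxy⟩
    exact hA x y hxy hx

/-- A definable set is invariant under the automorphisms that fix finitely many parameters. -/
theorem exists_finite_forall_equiv {L : FirstOrder.Language.{u, v}} {M : Type w} [L.Structure M]
    {A : Set M} (hA : (univ : Set M).Definable₁ L A) :
    ∃ E : Set M, E.Finite ∧ ∀ ρ : M ≃[L] M, (∀ e ∈ E, ρ e = e) → ∀ x, ρ x ∈ A ↔ x ∈ A := by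
  obtain ⟨E, -, hE⟩ := definable_iff_finitely_definable.1 hA
  obtain ⟨φ, hφ⟩ := definable_iff_exists_formula_sum.1 hE
  have hmem : ∀ x, x ∈ A ↔ φ.Realize (Sum.elim (fun e : (E : Set M) => (e : M)) fun _ => x) :=
    fun x => iff_of_eq (congrArg (fun B : Set (Fin 1 → M) => (fun _ => x) ∈ B) hφ)
  refine ⟨E, E.finite_toSet, fun ρ hρ x => ?_⟩
  rw [hmem, hmem, ← FirstOrder.Language.StrongHomClass.realize_formula ρ φ (v := Sum.elim _ fun _ => x)]
  refine iff_of_eq (congrArg _ (funext ?_))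
  rintro (e | i)
  · exact (hρ e e.2).symm
  · rfl

end Automorphisms


/-! ### The finite levels -/

section Level

/-- The rational line, with an `L₁`-structure in which `Z` has `(N + 2) ^ 2` elements. -/
def Level (_ : ℕ) : Type := ℚ

/-- The step of `f` on the level `N`. -/
def width (N : ℕ) : ℤ := N + 2

/-- The number of elements of `Z` on the level `N`. -/
def size (N : ℕ) : ℤ := width N * width N

theorem width_pos (N : ℕ) : 0 < width N := by
  unfold width
  omega

theorem size_pos (N : ℕ) : 0 < size N := mul_pos (width_pos N) (width_pos N)

instance (N : ℕ) : LinearOrder (Level N) := inferInstanceAs (LinearOrder ℚ)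

noncomputable instance (N : ℕ) : L₀.Structure (Level N) where
  funMap {n} s := match n, s with
    | _, Func₀.S => fun v => rot (size N) 1 (v 0)
    | _, Func₀.P => fun v => rot (size N) (-1) (v 0)
    | _, Func₀.π => fun v => cycProj (size N) (v 0)
    | _, Func₀.c₁ => fun _ => (0 : ℚ)
    | _, Func₀.c₂ => fun _ => (width N - 1 : ℚ)
    | _, Func₀.c₃ => fun _ => (size N - width N : ℚ)
    | _, Func₀.c₄ => fun _ => (size N - 1 : ℚ)
  RelMap {n} r := match n, r with
    | _, Rel₀.le => fun v => v 0 ≤ v 1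
    | _, Rel₀.Z => fun v => v 0 ∈ segment (size N)

/-- Rotation back by `width N`: the first `width N` elements, from `c₁` to `c₂`, wrap around onto
the last `width N`, from `c₃` to `c₄`. -/
noncomputable instance (N : ℕ) : LFG.Structure (Level N) where
  funMap {n} s := match n, s with
    | _, FuncFG.f => fun v => rot (size N) (-width N) (v 0)
    | _, FuncFG.g => fun v => rot (size N) (width N) (v 0)
  RelMap r := r.elim

theorem c₂_mem_segment (N : ℕ) : (width N - 1 : ℚ) ∈ segment (size N) := by
  have h := width_pos N
  have h1 : width N ≤ size N := le_mul_of_one_le_left h.le h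
  exact_mod_cast (coe_mem_segment (i := width N - 1)).2 ⟨by omega, by omega⟩

theorem c₃_mem_segment (N : ℕ) : (size N - width N : ℚ) ∈ segment (size N) := by
  have h := width_pos N
  have h1 : width N ≤ size N := le_mul_of_one_le_left h.le h
  exact_mod_cast (coe_mem_segment (i := size N - width N)).2 ⟨by omega, by omega⟩

theorem c₄_mem_segment {K : ℤ} (h : 0 < K) : (K - 1 : ℚ) ∈ segment K := by
  exact_mod_cast (coe_mem_segment (i := K - 1)).2 ⟨by omega, by omega⟩

theorem apply_mem_segment_iff {K : ℤ} {ρ : ℚ ≃o ℚ} (hρ : ∀ x ∈ segment K, ρ x = x) {x : ℚ} :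
    ρ x ∈ segment K ↔ x ∈ segment K :=
  ⟨fun h => ρ.injective (hρ _ h) ▸ h, fun h => (hρ x h).symm ▸ h⟩

theorem apply_rot {K a : ℤ} {ρ : ℚ ≃o ℚ} (hρ : ∀ x ∈ segment K, ρ x = x) (x : ℚ) :
    ρ (rot K a x) = rot K a (ρ x) := by
  by_cases hx : x ∈ segment K
  · rw [hρ x hx, hρ _ (rot_mem hx)]
  · rw [rot_of_notMem hx, rot_of_notMem (mt (apply_mem_segment_iff hρ).1 hx)]

/-- An automorphism fixing the integers of the segment preserves the half-open intervals between
consecutive ones, hence the ceiling of a point. -/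
theorem apply_cycProj {K : ℤ} (hK : 0 < K) {ρ : ℚ ≃o ℚ} (hρ : ∀ x ∈ segment K, ρ x = x) (x : ℚ) :
    ρ (cycProj K x) = cycProj K (ρ x) := by
  rw [hρ _ (cycProj_mem hK x), cycProj, cycProj]
  have h0 : 0 ≤ ρ x ↔ 0 ≤ x := by
    have h := ρ.le_iff_le (x := 0) (y := x)
    rwa [hρ 0 (zero_mem_segment hK)] at h
  have h1 : ρ x ≤ K - 1 ↔ x ≤ K - 1 := by
    have h := ρ.le_iff_le (x := x) (y := (K - 1 : ℚ))
    rwa [hρ _ (c₄_mem_segment hK)] at h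
  simp only [h0, h1]
  split_ifs with hx
  · congr 1
    refine (Int.ceil_eq_iff.2 ⟨?_, ?_⟩).symm
    · rcases hx.1.eq_or_lt with rfl | hlt
      · rw [hρ 0 (zero_mem_segment hK)]
        simp
      · have h2 : ⌈x⌉ ≤ K - 1 := Int.ceil_le.2 (by exact_mod_cast hx.2)
        have h3 : 0 < ⌈x⌉ := Int.ceil_pos.2 hlt
        have h4 := hρ _ (coe_mem_segment (K := K) (i := ⌈x⌉ - 1) |>.2 ⟨by omega, by omega⟩)
        rw [Int.cast_sub, Int.cast_one] at h4
        rw [← h4, ρ.lt_iff_lt]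
        linarith [Int.ceil_lt_add_one x]
    · have h2 : ⌈x⌉ ≤ K - 1 := Int.ceil_le.2 (by exact_mod_cast hx.2)
      rw [← hρ (⌈x⌉ : ℚ) (coe_mem_segment.2 ⟨Int.ceil_nonneg hx.1, by omega⟩), ρ.le_iff_le]
      exact Int.le_ceil x
  · rfl

/-- An order automorphism of the line that fixes `Z` is an automorphism of the `L₀`-structure. -/
noncomputable def levelEquiv (N : ℕ) (ρ : ℚ ≃o ℚ) (hρ : ∀ x ∈ segment (size N), ρ x = x) :
    Level N ≃[L₀] Level N where
  toEquiv := ρ.toEquiv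
  map_fun' φ v := by
    cases φ with
    | S => exact apply_rot hρ _
    | P => exact apply_rot hρ _
    | π => exact apply_cycProj (size_pos N) hρ _
    | c₁ => exact hρ _ (zero_mem_segment (size_pos N))
    | c₂ => exact hρ _ (c₂_mem_segment N)
    | c₃ => exact hρ _ (c₃_mem_segment N)
    | c₄ => exact hρ _ (c₄_mem_segment (size_pos N))
  map_rel' r v := by
    cases r with
    | le => exact ρ.le_iff_le
    | Z => exact apply_mem_segment_iff hρ

/-- Two points in the same cut of the finite set formed by `Z` and the parameters are exchanged by
an automorphism fixing that set. So a definable set is a union of such cuts. -/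
theorem isOMinimal_level (N : ℕ) : IsOMinimal L₀ (Level N) := by
  refine ⟨⟨⟨fun v => Iff.rfl⟩, inferInstanceAs (Nonempty ℚ), inferInstanceAs (DenselyOrdered ℚ),
    inferInstanceAs (NoMinOrder ℚ), inferInstanceAs (NoMaxOrder ℚ)⟩, fun A hA => ?_⟩
  obtain ⟨E, hE, H⟩ := exists_finite_forall_equiv hA
  have hE' : (E ∪ segment (size N) : Set ℚ).Finite := Set.Finite.union hE (finite_segment _)
  refine exists_finite_sUnion (E := (E ∪ segment (size N) : Set ℚ)) hE' fun x y hxy hx => ?_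
  obtain ⟨ρ, h1, h2⟩ := SameCut.exists_orderIso (k := ℚ) hE' hxy
  have h3 := H (levelEquiv N ρ fun x hx => h2 x (Or.inr hx)) (fun e he => h2 e (Or.inl he)) x
  have h4 : ρ x ∈ A := h3.2 hx
  rwa [h1] at h4

end Level


/-! ### The ultraproduct of the levels -/

section Ultraproduct

open Filter

theorem rot_eq_add {K a : ℤ} {x : ℚ} (hx : x ∈ segment K) (ha : 0 ≤ a) (h : x + a < K) :
    rot K a x = x + a := by
  obtain ⟨i, h0, hK, rfl⟩ := hx
  rw [rot_coe h0 hK, Int.emod_eq_of_lt (by omega) (by exact_mod_cast h), Int.cast_add]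

theorem rot_neg_eq_sub {K a : ℤ} {x : ℚ} (hx : x ∈ segment K) (ha : 0 ≤ a) (h : (a : ℚ) ≤ x) :
    rot K (-a) x = x - a := by
  obtain ⟨i, h0, hK, rfl⟩ := hx
  have h : a ≤ i := by exact_mod_cast h
  rw [rot_coe h0 hK, Int.emod_eq_of_lt (by omega) (by omega), Int.cast_add, Int.cast_neg,
    sub_eq_add_neg]

theorem eventually_lt_width (k : ℕ) : ∀ᶠ N in hyperfilter ℕ, k < width N :=
  Nat.hyperfilter_le_atTop ((eventually_ge_atTop k).mono fun N hN => by
    unfold width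
    omega)

/-- The square outgrows every multiple of the width: a fixed number of iterations of `f` stays far
short of a full turn. -/
theorem eventually_lt_size (n k : ℕ) : ∀ᶠ N in hyperfilter ℕ, n * width N + k < size N := by
  filter_upwards [eventually_lt_width (n + k + 1)] with N hN
  push_cast at hN
  unfold size
  nlinarith

/-- The ultraproduct of the levels. -/
abbrev UltraLevel : Type := Germ (hyperfilter ℕ : Filter ℕ) ℚ

noncomputable instance : L₀.Structure UltraLevel :=
  inferInstanceAs (L₀.Structure ((hyperfilter ℕ : Filter ℕ).Product Level))

noncomputable instance : LFG.Structure UltraLevel :=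
  inferInstanceAs (LFG.Structure ((hyperfilter ℕ : Filter ℕ).Product Level))

/-- The element of the ultraproduct represented by a sequence. -/
noncomputable abbrev ultra (x : ℕ → ℚ) : UltraLevel := x

open FirstOrder.Language FirstOrder.Language.Ultraproduct

theorem mem_Z_ultra {x : ℕ → ℚ} :
    ultra x ∈ Z UltraLevel ↔ ∀ᶠ N in hyperfilter ℕ, x N ∈ segment (size N) :=
  relMap_quotient_mk' (s := (hyperfilter ℕ : Filter ℕ).productSetoid Level) (L := L₀) Rel₀.Z ![x]

theorem S_ultra (x : ℕ → ℚ) : S (ultra x) = ultra fun N => rot (size N) 1 (x N) :=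
  funMap_cast (M := Level) (u := hyperfilter ℕ) (L := L₀) Func₀.S ![x]

theorem P_ultra (x : ℕ → ℚ) : P (ultra x) = ultra fun N => rot (size N) (-1) (x N) :=
  funMap_cast (M := Level) (u := hyperfilter ℕ) (L := L₀) Func₀.P ![x]

theorem proj_ultra (x : ℕ → ℚ) : proj (ultra x) = ultra fun N => cycProj (size N) (x N) :=
  funMap_cast (M := Level) (u := hyperfilter ℕ) (L := L₀) Func₀.π ![x]

theorem f_ultra (x : ℕ → ℚ) : f (ultra x) = ultra fun N => rot (size N) (-width N) (x N) :=
  funMap_cast (M := Level) (u := hyperfilter ℕ) (L := LFG) FuncFG.f ![x]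

theorem g_ultra (x : ℕ → ℚ) : g (ultra x) = ultra fun N => rot (size N) (width N) (x N) :=
  funMap_cast (M := Level) (u := hyperfilter ℕ) (L := LFG) FuncFG.g ![x]

theorem c₁_ultra : c₁ UltraLevel = ultra fun _ => 0 :=
  funMap_cast (M := Level) (u := hyperfilter ℕ) (L := L₀) Func₀.c₁ ![]

theorem c₂_ultra : c₂ UltraLevel = ultra fun N => width N - 1 :=
  funMap_cast (M := Level) (u := hyperfilter ℕ) (L := L₀) Func₀.c₂ ![]

theorem c₃_ultra : c₃ UltraLevel = ultra fun N => size N - width N :=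
  funMap_cast (M := Level) (u := hyperfilter ℕ) (L := L₀) Func₀.c₃ ![]

theorem c₄_ultra : c₄ UltraLevel = ultra fun N => size N - 1 :=
  funMap_cast (M := Level) (u := hyperfilter ℕ) (L := L₀) Func₀.c₄ ![]

theorem cyc_ultra {x y z : ℕ → ℚ} :
    Cyc (ultra x) (ultra y) (ultra z) ↔ ∀ᶠ N in hyperfilter ℕ, Cyc (x N) (y N) (z N) := by
  simp only [Cyc, Germ.coe_lt, Ultrafilter.eventually_or, eventually_and]

theorem ultra_eq {x y : ℕ → ℚ} : ultra x = ultra y ↔ ∀ᶠ N in hyperfilter ℕ, x N = y N :=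
  Germ.coe_eq

theorem ultra_ne {x y : ℕ → ℚ} : ultra x ≠ ultra y ↔ ∀ᶠ N in hyperfilter ℕ, x N ≠ y N :=
  (not_congr ultra_eq).trans Ultrafilter.eventually_not.symm

theorem notMem_Z_ultra {x : ℕ → ℚ} :
    ultra x ∉ Z UltraLevel ↔ ∀ᶠ N in hyperfilter ℕ, x N ∉ segment (size N) :=
  (not_congr mem_Z_ultra).trans Ultrafilter.eventually_not.symm

theorem exists_ultra (x : UltraLevel) : ∃ y, ultra y = x :=
  Germ.inductionOn x fun y => ⟨y, rfl⟩

theorem iterate_S_ultra (n : ℕ) (x : ℕ → ℚ) :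
    S^[n] (ultra x) = ultra fun N => rot (size N) n (x N) := by
  induction n generalizing x with
  | zero => simp only [Nat.cast_zero, rot_zero, Function.iterate_zero_apply]
  | succ n ih =>
    rw [Function.iterate_succ_apply, S_ultra, ih]
    simp only [rot_rot, Nat.cast_succ, add_comm]

/-- The offset is normalized by adding `size N`: for `n > 0` it then lies, for almost all `N`,
strictly between `0` and `size N`, as `cyc_rot` requires. -/
theorem iterate_f_ultra (n : ℕ) (x : ℕ → ℚ) :
    f^[n] (ultra x) = ultra fun N => rot (size N) (size N - n * width N) (x N) := by
  induction n generalizing x with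
  | zero =>
    simp only [Nat.cast_zero, zero_mul, sub_zero, Function.iterate_zero_apply]
    refine ultra_eq.2 (Eventually.of_forall fun N => ?_)
    have := rot_add_self (size N) 0 (x N)
    rwa [add_zero, rot_zero, eq_comm] at this
  | succ n ih =>
    rw [Function.iterate_succ_apply, f_ultra, ih]
    refine ultra_eq.2 (Eventually.of_forall fun N => ?_)
    rw [rot_rot]
    congr 1
    push_cast
    ring

/-- The iterates are distinct because the number of elements of `Z` on a level eventually exceeds
any fixed number of steps. -/
theorem infinite_of_iterate_S_mem {A : Set UltraLevel} {z : UltraLevel} (hz : z ∈ Z UltraLevel)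
    (h : ∀ k : ℕ, S^[k + 1] z ∈ A) : A.Infinite := by
  obtain ⟨z, rfl⟩ := exists_ultra z
  refine infinite_of_injective_forall_mem (f := fun k : ℕ => S^[k + 1] (ultra z))
    (fun k l hkl => ?_) h
  dsimp only at hkl
  rw [iterate_S_ultra, iterate_S_ultra, ultra_eq] at hkl
  obtain ⟨N, h1, h2, h3, h4⟩ := (hkl.and ((mem_Z_ultra.1 hz).and
    ((eventually_lt_size 0 (k + 1)).and (eventually_lt_size 0 (l + 1))))).exists
  have := rot_injective_of_lt h2 (by omega) (by omega) (by omega) (by omega) h1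
  omega

theorem S_mem_Z_ultra {x : UltraLevel} (hx : x ∈ Z UltraLevel) : S x ∈ Z UltraLevel := by
  obtain ⟨x, rfl⟩ := exists_ultra x
  rw [S_ultra]
  exact mem_Z_ultra.2 ((mem_Z_ultra.1 hx).mono fun N => rot_mem)

theorem S_iff_ultra (x y : UltraLevel) : S x = y ↔
    (x ∉ Z UltraLevel ∧ x = y) ∨
      (x ∈ Z UltraLevel ∧ y ∈ Z UltraLevel ∧ x ≠ y ∧ ¬ ∃ z ∈ Z UltraLevel, Cyc x z y) := by
  constructor
  · rintro rfl
    by_cases hx : x ∈ Z UltraLevel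
    · refine Or.inr ⟨hx, S_mem_Z_ultra hx, ?_, ?_⟩
      · obtain ⟨x, rfl⟩ := exists_ultra x
        rw [S_ultra, ultra_ne]
        filter_upwards [mem_Z_ultra.1 hx, eventually_lt_size 0 1] with N h1 h2
        exact ne_rot h1 one_pos (by omega)
      · rintro ⟨z, hz, h⟩
        obtain ⟨x, rfl⟩ := exists_ultra x
        obtain ⟨z, rfl⟩ := exists_ultra z
        rw [S_ultra, cyc_ultra] at h
        obtain ⟨N, h1, h2, h3⟩ := (h.and ((mem_Z_ultra.1 hx).and (mem_Z_ultra.1 hz))).exists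
        exact not_cyc_rot_one h2 h3 h1
    · refine Or.inl ⟨hx, ?_⟩
      obtain ⟨x, rfl⟩ := exists_ultra x
      rw [S_ultra, ultra_eq]
      exact (notMem_Z_ultra.1 hx).mono fun N h => (rot_of_notMem h).symm
  · rintro (⟨hx, rfl⟩ | ⟨hx, hy, hxy, h⟩)
    · obtain ⟨x, rfl⟩ := exists_ultra x
      rw [S_ultra, ultra_eq]
      exact (notMem_Z_ultra.1 hx).mono fun N h => rot_of_notMem h
    · by_contra hne
      refine h ⟨S x, S_mem_Z_ultra hx, ?_⟩
      obtain ⟨x, rfl⟩ := exists_ultra x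
      obtain ⟨y, rfl⟩ := exists_ultra y
      rw [S_ultra] at hne ⊢
      rw [cyc_ultra]
      filter_upwards [mem_Z_ultra.1 hx, mem_Z_ultra.1 hy, ultra_ne.1 hxy,
        ultra_ne.1 hne] with N h1 h2 h3 h4
      exact cyc_rot_one h1 h2 h3 h4

theorem P_S_ultra (x : UltraLevel) : P (S x) = x := by
  obtain ⟨x, rfl⟩ := exists_ultra x
  simp only [S_ultra, P_ultra, rot_rot, add_neg_cancel, rot_zero]

theorem S_P_ultra (x : UltraLevel) : S (P x) = x := by
  obtain ⟨x, rfl⟩ := exists_ultra x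
  simp only [S_ultra, P_ultra, rot_rot, neg_add_cancel, rot_zero]

theorem g_f_ultra (x : UltraLevel) : g (f x) = x := by
  obtain ⟨x, rfl⟩ := exists_ultra x
  simp only [f_ultra, g_ultra, rot_rot, neg_add_cancel, rot_zero]

theorem f_g_ultra (x : UltraLevel) : f (g x) = x := by
  obtain ⟨x, rfl⟩ := exists_ultra x
  simp only [f_ultra, g_ultra, rot_rot, add_neg_cancel, rot_zero]

theorem f_mem_ultra {x : UltraLevel} (hx : x ∈ Z UltraLevel) : f x ∈ Z UltraLevel := by
  obtain ⟨x, rfl⟩ := exists_ultra x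
  rw [f_ultra]
  exact mem_Z_ultra.2 ((mem_Z_ultra.1 hx).mono fun N => rot_mem)

theorem g_mem_ultra {x : UltraLevel} (hx : x ∈ Z UltraLevel) : g x ∈ Z UltraLevel := by
  obtain ⟨x, rfl⟩ := exists_ultra x
  rw [g_ultra]
  exact mem_Z_ultra.2 ((mem_Z_ultra.1 hx).mono fun N => rot_mem)

end Ultraproduct


/-! ### Verification of the axioms in the ultraproduct. -/

section UltraModel

open Filter

/-- On the two parts of `Z`, `f` is a translation of the ordered field `UltraLevel`, so its
monotonicity and its images become linear arithmetic. -/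
theorem f_eq_add_ultra {x : UltraLevel} (hx : x ∈ Z UltraLevel) (h : x ≤ c₂ UltraLevel) :
    f x = x + c₃ UltraLevel := by
  obtain ⟨x, rfl⟩ := exists_ultra x
  rw [c₂_ultra, Germ.coe_le] at h
  rw [f_ultra, c₃_ultra, ← Germ.coe_add, ultra_eq]
  filter_upwards [mem_Z_ultra.1 hx, h, eventually_lt_size 1 0] with N h1 h2 h3
  dsimp only [Pi.add_apply]
  rw [← rot_add_self, ← sub_eq_add_neg, rot_eq_add h1 (by push_cast at h3; omega), Int.cast_sub]
  push_cast
  linarith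

theorem f_eq_sub_ultra {x : UltraLevel} (hx : x ∈ Z UltraLevel) (h : c₂ UltraLevel < x) :
    f x = x - (c₂ UltraLevel + 1) := by
  obtain ⟨x, rfl⟩ := exists_ultra x
  rw [c₂_ultra, Germ.coe_lt] at h
  rw [f_ultra, c₂_ultra, ← Germ.coe_one, ← Germ.coe_add, ← Germ.coe_sub, ultra_eq]
  filter_upwards [mem_Z_ultra.1 hx, h] with N h1 h2
  simp only [Pi.add_apply, Pi.sub_apply, Pi.one_apply, sub_add_cancel]
  refine rot_neg_eq_sub h1 (width_pos N).le ?_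
  obtain ⟨i, -, -, hi⟩ := h1
  rw [← hi] at h2 ⊢
  have h2 : width N - 1 < i := by exact_mod_cast h2
  exact_mod_cast (by omega : width N ≤ i)

theorem g_eq_sub_ultra {x : UltraLevel} (hx : x ∈ Z UltraLevel) (h : c₃ UltraLevel ≤ x) :
    g x = x - c₃ UltraLevel := by
  obtain ⟨x, rfl⟩ := exists_ultra x
  rw [c₃_ultra, Germ.coe_le] at h
  rw [g_ultra, c₃_ultra, ← Germ.coe_sub, ultra_eq]
  filter_upwards [mem_Z_ultra.1 hx, h, eventually_lt_size 1 0] with N h1 h2 h3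
  have h4 : width N = size N + -(size N - width N) := by ring
  dsimp only [Pi.sub_apply]
  rw [← Int.cast_sub, ← rot_neg_eq_sub h1 (by push_cast at h3; omega) (by exact_mod_cast h2),
    ← rot_add_self (a := -_), ← h4]

theorem g_eq_add_ultra {x : UltraLevel} (hx : x ∈ Z UltraLevel) (h : x < c₃ UltraLevel) :
    g x = x + (c₂ UltraLevel + 1) := by
  obtain ⟨x, rfl⟩ := exists_ultra x
  rw [c₃_ultra, Germ.coe_lt] at h
  rw [g_ultra, c₂_ultra, ← Germ.coe_one, ← Germ.coe_add, ← Germ.coe_add, ultra_eq]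
  filter_upwards [mem_Z_ultra.1 hx, h] with N h1 h2
  simp only [Pi.add_apply, Pi.one_apply, sub_add_cancel]
  exact rot_eq_add h1 (width_pos N).le (by linarith)

theorem c₄_eq_ultra : c₄ UltraLevel = c₃ UltraLevel + c₂ UltraLevel := by
  rw [c₄_ultra, c₃_ultra, c₂_ultra, ← Germ.coe_add, ultra_eq]
  exact Eventually.of_forall fun N => by simp

theorem c₁_eq_ultra : c₁ UltraLevel = 0 := c₁_ultra

theorem isLeast_ultra : IsLeast (Z UltraLevel) (c₁ UltraLevel) := by
  rw [c₁_ultra]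
  refine ⟨mem_Z_ultra.2 (Eventually.of_forall fun N => zero_mem_segment (size_pos N)), fun x hx => ?_⟩
  obtain ⟨x, rfl⟩ := exists_ultra x
  refine Germ.coe_le.2 ((mem_Z_ultra.1 hx).mono ?_)
  rintro N ⟨i, h0, -, hi⟩
  dsimp only
  rw [← hi]
  exact_mod_cast h0

theorem isGreatest_ultra : IsGreatest (Z UltraLevel) (c₄ UltraLevel) := by
  rw [c₄_ultra]
  refine ⟨mem_Z_ultra.2 (Eventually.of_forall fun N => c₄_mem_segment (size_pos N)), fun x hx => ?_⟩
  obtain ⟨x, rfl⟩ := exists_ultra x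
  refine Germ.coe_le.2 ((mem_Z_ultra.1 hx).mono ?_)
  rintro N ⟨i, -, hK, hi⟩
  dsimp only
  rw [← hi]
  exact_mod_cast (by omega : i ≤ size N - 1)

theorem c₂_mem_ultra : c₂ UltraLevel ∈ Z UltraLevel := by
  rw [c₂_ultra]
  exact mem_Z_ultra.2 (Eventually.of_forall c₂_mem_segment)

theorem c₃_mem_ultra : c₃ UltraLevel ∈ Z UltraLevel := by
  rw [c₃_ultra]
  exact mem_Z_ultra.2 (Eventually.of_forall c₃_mem_segment)

/-- Between two elements of `Z` whose distance is infinite lie infinitely many elements of `Z`. -/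
theorem infinite_Ioo_ultra {x y : ℕ → ℚ} (hx : ultra x ∈ Z UltraLevel)
    (hy : ultra y ∈ Z UltraLevel) (h : ∀ k : ℕ, ∀ᶠ N in hyperfilter ℕ, x N + k < y N) :
    (Z UltraLevel ∩ Ioo (ultra x) (ultra y)).Infinite := by
  refine infinite_of_iterate_S_mem hx fun k => ?_
  have hrot : ∀ᶠ N in hyperfilter ℕ,
      rot (size N) (k + 1 : ℕ) (x N) = x N + (k + 1 : ℕ) := by
    filter_upwards [mem_Z_ultra.1 hx, mem_Z_ultra.1 hy, h (k + 1)] with N h1 h2 h3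
    obtain ⟨j, -, hjK, hj⟩ := h2
    have hjK' : (j : ℚ) < size N := by exact_mod_cast hjK
    rw [rot_eq_add h1 (by omega), Int.cast_natCast]
    rw [Int.cast_natCast]
    linarith
  rw [iterate_S_ultra]
  refine ⟨mem_Z_ultra.2 ((mem_Z_ultra.1 hx).mono fun N => rot_mem), Germ.coe_lt.2 ?_,
    Germ.coe_lt.2 ?_⟩
  · filter_upwards [hrot] with N h1
    rw [h1]
    push_cast
    linarith [(k.cast_nonneg : (0 : ℚ) ≤ k)]
  · filter_upwards [hrot, h (k + 1)] with N h1 h2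
    rwa [h1]

theorem infinite₁₂_ultra : (Z UltraLevel ∩ Ioo (c₁ UltraLevel) (c₂ UltraLevel)).Infinite := by
  have h1 := isLeast_ultra.1
  have h2 := c₂_mem_ultra
  rw [c₁_ultra] at h1 ⊢
  rw [c₂_ultra] at h2 ⊢
  refine infinite_Ioo_ultra h1 h2 fun k => ?_
  filter_upwards [eventually_lt_width (k + 1)] with N hN
  have hN : ((k + 1 : ℕ) : ℚ) < width N := by exact_mod_cast hN
  push_cast at hN
  linarith

theorem infinite₂₃_ultra : (Z UltraLevel ∩ Ioo (c₂ UltraLevel) (c₃ UltraLevel)).Infinite := by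
  have h2 := c₂_mem_ultra
  have h3 := c₃_mem_ultra
  rw [c₂_ultra] at h2 ⊢
  rw [c₃_ultra] at h3 ⊢
  refine infinite_Ioo_ultra h2 h3 fun k => ?_
  filter_upwards [eventually_lt_size 2 k] with N hN
  have hN : (2 * width N + k : ℚ) < size N := by exact_mod_cast hN
  linarith

theorem infinite₃₄_ultra : (Z UltraLevel ∩ Ioo (c₃ UltraLevel) (c₄ UltraLevel)).Infinite := by
  have h3 := c₃_mem_ultra
  have h4 := isGreatest_ultra.1
  rw [c₃_ultra] at h3 ⊢
  rw [c₄_ultra] at h4 ⊢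
  refine infinite_Ioo_ultra h3 h4 fun k => ?_
  filter_upwards [eventually_lt_width (k + 1)] with N hN
  have hN : ((k + 1 : ℕ) : ℚ) < width N := by exact_mod_cast hN
  push_cast at hN
  linarith

theorem lt_of_infinite_ultra {x y : UltraLevel} (h : (Z UltraLevel ∩ Ioo x y).Infinite) : x < y :=
  let ⟨_, hz⟩ := h.nonempty
  hz.2.1.trans hz.2.2

theorem ne_S_ultra {x : UltraLevel} (hx : x ∈ Z UltraLevel) : x ≠ S x := by
  rcases (S_iff_ultra x (S x)).1 rfl with h | h
  · exact absurd hx h.1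
  · exact h.2.2.1

theorem not_cyc_S_ultra {x y : UltraLevel} (hx : x ∈ Z UltraLevel) (hy : y ∈ Z UltraLevel) :
    ¬ Cyc x y (S x) := by
  rcases (S_iff_ultra x (S x)).1 rfl with h | h
  · exact absurd hx h.1
  · exact fun hc => h.2.2.2 ⟨y, hy, hc⟩

theorem P_mem_ultra {x : UltraLevel} (hx : x ∈ Z UltraLevel) : P x ∈ Z UltraLevel := by
  obtain ⟨x, rfl⟩ := exists_ultra x
  rw [P_ultra]
  exact mem_Z_ultra.2 ((mem_Z_ultra.1 hx).mono fun N => rot_mem)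

theorem isOrdered_ultra : L₀.OrderedStructure UltraLevel where
  relMap_leSymb v := by
    obtain ⟨x, hx⟩ := exists_ultra (v 0)
    obtain ⟨y, hy⟩ := exists_ultra (v 1)
    rw [← hx, ← hy, Germ.coe_le]
    have hv : v = fun i => ultra (![x, y] i) := by
      funext i
      fin_cases i
      · exact hx.symm
      · exact hy.symm
    rw [hv]
    exact FirstOrder.Language.relMap_quotient_mk'
      (s := (hyperfilter ℕ : Filter ℕ).productSetoid Level) (L := L₀) Rel₀.le ![x, y]

/-- Each level is o-minimal and so satisfies the sentence; Łoś's theorem transfers it. -/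
theorem models_common_ultra : UltraLevel ⊨ commonOMinimalTheory L₀ := by
  refine ⟨fun φ hφ => ?_⟩
  have : ∀ N, Nonempty (Level N) := fun _ => inferInstanceAs (Nonempty ℚ)
  refine (FirstOrder.Language.Ultraproduct.sentence_realize (M := Level) (u := hyperfilter ℕ) φ).2
    (Eventually.of_forall fun N => ?_)
  exact hφ (Level N) (isOMinimal_level N)

theorem isModelT₀_ultra : IsModelT₀ UltraLevel where
  dlo := ⟨isOrdered_ultra, inferInstance, inferInstance, inferInstance, inferInstance⟩
  common := models_common_ultra
  exists_succ x hx := by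
    rintro ⟨y, hy, hxy⟩
    have hlt : x < S x := by
      refine lt_of_not_ge fun hle => not_cyc_S_ultra hx hy (Or.inr (Or.inr ⟨?_, hxy⟩))
      exact hle.lt_of_ne (ne_S_ultra hx).symm
    exact ⟨S x, S_mem_Z_ultra hx, hlt, fun z hz h => not_cyc_S_ultra hx hz (Or.inl h)⟩
  exists_pred x hx := by
    rintro ⟨y, hy, hyx⟩
    have hP := P_mem_ultra hx
    have hne := ne_S_ultra hP
    have hcyc : ∀ z ∈ Z UltraLevel, ¬ Cyc (P x) z x := fun z hz h =>
      not_cyc_S_ultra hP hz ((S_P_ultra x).symm ▸ h)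
    rw [S_P_ultra] at hne
    have hlt : P x < x := by
      refine lt_of_not_ge fun hle => hcyc y hy (Or.inr (Or.inl ⟨hyx, hle.lt_of_ne hne.symm⟩))
    exact ⟨P x, hP, hlt, fun z hz h => hcyc z hz (Or.inl h)⟩
  closed x hx := by
    obtain ⟨x, rfl⟩ := exists_ultra x
    refine ⟨ultra fun N => (⌈x N⌉ : ℚ) - 1, ultra fun N => ⌊x N⌋ + 1, ⟨?_, ?_⟩,
      Set.disjoint_left.2 fun y hy hyZ => ?_⟩
    · exact Germ.coe_lt.2 ((notMem_Z_ultra.1 hx).mono fun N h => (disjoint_segment h).1.1)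
    · exact Germ.coe_lt.2 ((notMem_Z_ultra.1 hx).mono fun N h => (disjoint_segment h).1.2)
    · obtain ⟨y, rfl⟩ := exists_ultra y
      obtain ⟨N, h1, h2, h3, h4⟩ := ((Germ.coe_lt.1 hy.1).and ((Germ.coe_lt.1 hy.2).and
        ((mem_Z_ultra.1 hyZ).and (notMem_Z_ultra.1 hx)))).exists
      exact (disjoint_segment h4).2 _ h3 ⟨h1, h2⟩
  isLeast := isLeast_ultra
  isGreatest := isGreatest_ultra
  c₂_mem := c₂_mem_ultra
  c₃_mem := c₃_mem_ultra
  c₁_lt_c₂ := lt_of_infinite_ultra infinite₁₂_ultra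
  c₂_lt_c₃ := lt_of_infinite_ultra infinite₂₃_ultra
  c₃_lt_c₄ := lt_of_infinite_ultra infinite₃₄_ultra
  infinite₁₂ := infinite₁₂_ultra
  infinite₂₃ := infinite₂₃_ultra
  infinite₃₄ := infinite₃₄_ultra
  proj_mem x := by
    obtain ⟨x, rfl⟩ := exists_ultra x
    rw [proj_ultra]
    exact mem_Z_ultra.2 (Eventually.of_forall fun N => cycProj_mem (size_pos N) _)
  proj_first x y hy h := by
    obtain ⟨x, rfl⟩ := exists_ultra x
    obtain ⟨y, rfl⟩ := exists_ultra y
    rw [proj_ultra, cyc_ultra] at h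
    obtain ⟨N, h1, h2⟩ := (h.and (mem_Z_ultra.1 hy)).exists
    exact not_cyc_cycProj h2 h1
  proj_of_mem x hx := by
    obtain ⟨x, rfl⟩ := exists_ultra x
    rw [proj_ultra, ultra_eq]
    exact (mem_Z_ultra.1 hx).mono fun N h => cycProj_of_mem h
  S_iff := S_iff_ultra
  P_S := P_S_ultra
  S_P := S_P_ultra

theorem isModelT₁_ultra : IsModelT₁ UltraLevel where
  modelT₀ := isModelT₀_ultra
  f_bijective := Function.bijective_iff_has_inverse.2 ⟨g, g_f_ultra, f_g_ultra⟩
  g_f := g_f_ultra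
  f_g := f_g_ultra
  f_image_left := by
    refine Subset.antisymm ?_ fun y hy => ⟨g y, ⟨g_mem_ultra hy.1, ?_, ?_⟩, f_g_ultra y⟩
    · rintro _ ⟨x, ⟨hx, h1, h2⟩, rfl⟩
      refine ⟨f_mem_ultra hx, ?_, isGreatest_ultra.2 (f_mem_ultra hx)⟩
      rw [f_eq_add_ultra hx h2]
      rw [c₁_eq_ultra] at h1
      linarith
    · exact isLeast_ultra.2 (g_mem_ultra hy.1)
    · have := isGreatest_ultra.2 hy.1
      rw [c₄_eq_ultra] at this
      rw [g_eq_sub_ultra hy.1 hy.2.1]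
      linarith
  f_strictMono_left x hx y hy hxy := by
    rw [f_eq_add_ultra hx.1 hx.2.2, f_eq_add_ultra hy.1 hy.2.2]
    linarith
  f_image_right := by
    refine Subset.antisymm ?_ fun y hy => ⟨g y, ⟨g_mem_ultra hy.1, ?_, ?_⟩, f_g_ultra y⟩
    · rintro _ ⟨x, ⟨hx, h1, h2⟩, rfl⟩
      refine ⟨f_mem_ultra hx, isLeast_ultra.2 (f_mem_ultra hx), ?_⟩
      rw [f_eq_sub_ultra hx h1]
      rw [c₄_eq_ultra] at h2
      linarith
    · have := hy.2.1
      rw [c₁_eq_ultra] at this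
      rw [g_eq_add_ultra hy.1 hy.2.2]
      linarith
    · exact isGreatest_ultra.2 (g_mem_ultra hy.1)
  f_strictMono_right x hx y hy hxy := by
    rw [f_eq_sub_ultra hx.1 hx.2.1, f_eq_sub_ultra hy.1 hy.2.1]
    linarith
  infinite_forward n hn z hz := by
    refine infinite_of_iterate_S_mem hz fun k => ?_
    obtain ⟨z, rfl⟩ := exists_ultra z
    rw [iterate_S_ultra]
    refine ⟨mem_Z_ultra.2 ((mem_Z_ultra.1 hz).mono fun N => rot_mem), ?_⟩
    change Cyc _ _ _
    rw [iterate_f_ultra, cyc_ultra]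
    filter_upwards [mem_Z_ultra.1 hz, eventually_lt_size n (k + 1)] with N h1 h2
    have h3 := mul_pos (Nat.cast_pos.2 (zero_lt_one.trans hn) : (0 : ℤ) < n) (width_pos N)
    exact cyc_rot h1 (by omega) (by omega) (by omega)
  infinite_backward n hn z hz := by
    obtain ⟨z, rfl⟩ := exists_ultra z
    have hfz : f^[n] (ultra z) ∈ Z UltraLevel := by
      rw [iterate_f_ultra]
      exact mem_Z_ultra.2 ((mem_Z_ultra.1 hz).mono fun N => rot_mem)
    refine infinite_of_iterate_S_mem hfz fun k => ?_
    rw [iterate_f_ultra] at hfz ⊢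
    rw [iterate_S_ultra]
    refine ⟨mem_Z_ultra.2 ((mem_Z_ultra.1 hfz).mono fun N => rot_mem), ?_⟩
    change Cyc _ _ _
    rw [cyc_ultra]
    filter_upwards [mem_Z_ultra.1 hz, eventually_lt_size n 0,
      eventually_lt_width (k + 1)] with N h1 h2 h3
    -- A fixed number of steps after `f^[n] z` is still before `z`, as the distance is at least the
    -- width.
    have h4 : width N ≤ n * width N :=
      le_mul_of_one_le_left (width_pos N).le (by exact_mod_cast hn.le)
    rw [rot_rot]
    exact (cyc_rot h1 (by omega) (by omega) (by omega)).rotate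
  f_of_notMem x hx := by
    obtain ⟨x, rfl⟩ := exists_ultra x
    rw [f_ultra, ultra_eq]
    exact (notMem_Z_ultra.1 hx).mono fun N h => rot_of_notMem h
  f_cyc m n hn hnm z hz := by
    obtain ⟨z, rfl⟩ := exists_ultra z
    rw [iterate_f_ultra, iterate_f_ultra, cyc_ultra]
    filter_upwards [mem_Z_ultra.1 hz, eventually_lt_size m 0] with N h1 h2
    have h3 := mul_pos (Nat.cast_pos.2 hn : (0 : ℤ) < n) (width_pos N)
    have h4 : n * width N < m * width N :=
      mul_lt_mul_of_pos_right (by exact_mod_cast hnm) (width_pos N)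
    exact (cyc_rot h1 (by omega) (by omega) (by omega)).rotate

end UltraModel

end PigeonholeFailure

/-! ### Assembly of the three claims. -/

theorem mainTheorem2 :
    -- `T₁` has a model
    (∃ (M : Type) (_ : LinearOrder M) (_ : L₀.Structure M)
      (_ : LFG.Structure M), IsModelT₁ M) ∧
    -- for every model `M₁ = M` of `T₁`, the structure `M₂ = Shift M` is as claimed
    (∀ (M : Type u) [LinearOrder M] [L₀.Structure M]
      [LFG.Structure M], IsModelT₁ M →
      IsDLOExpansion L₁ (Shift M) ∧
      DefinablyComplete L₁ (Shift M) ∧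
      TypeComplete L₁ (Shift M) ∧
      ¬ PigeonholePrinciple L₁ (Shift M) ∧
      IsPseudoFinite L₁
        {v : Fin 1 → Shift M | v 0 ∈ Z (Shift M)} ∧
      MapsTo f (Z (Shift M))
        (Z (Shift M)) ∧
      InjOn f (Z (Shift M)) ∧
      f '' Z (Shift M) =
        Z (Shift M) \
          {P (c₃ (Shift M))} ∧
      ¬ SurjOn f (Z (Shift M))
        (Z (Shift M))) ∧
    -- hence a definably complete, type complete structure need not have the pigeonhole principle
    (∃ (L : FirstOrder.Language.{0, 0}) (_ : L.IsOrdered) (M : Type) (_ : LinearOrder M) (_ : L.Structure M),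
      IsDLOExpansion L M ∧ DefinablyComplete L M ∧
      TypeComplete L M ∧ ¬ PigeonholePrinciple L M) := by
  have hmodel : ∃ (M : Type) (_ : LinearOrder M) (_ : L₀.Structure M)
      (_ : LFG.Structure M), IsModelT₁ M :=
    ⟨UltraLevel, inferInstance, inferInstance, inferInstance, isModelT₁_ultra⟩
  refine ⟨hmodel, fun M _ _ _ h => ⟨h.isDLOExpansion_shift, h.definablyComplete, h.typeComplete,
    h.not_pigeonhole, h.isPseudoFinite, h.shift_mapsTo, h.shift_injOn, h.shift_image,
    h.shift_not_surjOn⟩, ?_⟩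
  obtain ⟨M, _, _, _, h⟩ := hmodel
  exact ⟨L₁, inferInstance, Shift M, inferInstance, inferInstance, h.isDLOExpansion_shift,
    h.definablyComplete, h.typeComplete, h.not_pigeonhole⟩
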